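/- **Setting.** Let $(\mathcal C,\otimes,\mathbf 1)$ be a symmetric monoidal category and $\mathcal D\subset\mathcal C$ a full subcategory. Write $\Delta\mathcal D$ for cosimplicial objects, $c$ for the constant cosimplicial object and $\mathrm D$ for the diagonal of a bicosimplicial object. *Descent structure on a category $\mathcal D$ with finite products*: a saturated class $\mathrm E$ of morphisms ("equivalences") closed under finite products, a functor $\mathbf s:\Delta\mathcal D\to\mathcal D$ and natural transformations $\mu:\mathbf s\mathbf s\to\mathbf s\mathrm D$, $\lambda:\mathrm{id}\to\mathbf s c$ such that: $\mathbf s(X\times Y)\to\mathbf sX\times\mathbf sY$ is in $\mathrm E$; all $\mu_Z$ and $\lambda_A$ are in $\mathrm E$; $\lambda$ and $\mu$ are compatible (for every $X\in\Delta\mathcal D$ the composites $\mathbf sX\xrightarrow{\lambda_{\mathbf sX}}\mathbf sc\,\mathbf sX\xrightarrow{\mu}\mathbf sX$ and $\mathbf sX\xrightarrow{\mathbf s(\lambda_{X^n})}\mathbf s([n]\mapsto\mathbf s cX^n)\xrightarrow{\mu}\mathbf sX$ are identities); $\mathbf s(f)\in\mathrm E$ if all $f^n\in\mathrm E$; and $\mathbf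 s(A^{d^0}):\mathbf s(A^{\Delta[1]})\to\mathbf s(A^{\Delta[0]})$ is in $\mathrm E$ for every $A\in\mathcal D$. *Monoidal descent subcategory*: $\mathcal D$ has a descent structure $(\mathrm E,\mathbf s,\mu,\lambda)$ whose triple $(\mathbf s,\mu,\lambda)$ is the restriction of such a triple on $\mathcal C$, with $\lambda$ and $\mu$ compatible also on $\mathcal C$, where $\mathbf s:\Delta\mathcal C\to\mathcal C$ is a (lax) symmetric monoidal functor and $\mu,\lambda$ are monoidal natural transformations. *Operads* are unital symmetric operads in $\mathcal C$ with arities $l\ge1$. $\mathrm{Op}^{\mathcal D}$ is the category of operads in $\mathcal C$ with all components in $\mathcal D$; $\mathrm{Alg}^{\mathcal D}$ is the category of pairs $(P,A)$ with $P\in\mathrm{Op}^{\mathcal D}$ and $A$ a $P$-algebra with underlying object in $\mathcal D$; and, for an operad $P$ in $\mathcal C$, $\mathrm{Alg}^{\mathcal D}_P$ is the category of $P$-algebras with underlying object in $\mathcal D$. Sheaves with values in these categories are presheaves whose components (each arity of the operad, and the underlying object of the algebra) are sheaves with values in $\mathcal D$. *Hypotheses on a category $\mathcal E$ with a descent structure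 and a small Grothendieck site $\mathcal X$*: (G0) $\mathcal X$ has a set $X$ of enough points; (G1) $\mathcal E$ has filtered colimits and arbitrary products (indexed by small categories and sets); (G2) these preserve equivalences. Under these hypotheses $(\mathcal X,\mathcal E)$ is *compatible* if $\mathbf s$ commutes with stalks up to equivalence: for every cosimplicial sheaf $\mathcal F^\bullet$ with values in $\mathcal E$ and every $x\in X$ the canonical map $(\mathbf s\mathcal F^\bullet)_x\to\mathbf s(\mathcal F_x^\bullet)$ is an equivalence, where $\mathbf s\mathcal F^\bullet$ is computed objectwise. **Theorem.** Let $\mathcal D\subset\mathcal C$ be a monoidal descent subcategory and $\mathcal X$ a small Grothendieck site such that (G0)–(G2) hold for $\mathcal D$ and $(\mathcal X,\mathcal D)$ is compatible. Assume that the filtered colimits and products of $\mathcal D$ are also colimits and products in $\mathcal C$, and that (G3) for every $A\in\mathcal C$ the functor $A\otimes-:\mathcal D\to\mathcal C$ preserves filtered colimits. Then each of $\mathrm{Op}^{\mathcal D}$, $\mathrm{Alg}^{\mathcal D}$ and $\mathrm{Alg}^{\mathcal D}_P$ (for every operad $P$ in $\mathcal C$) has a descent structure whose equivalences and whose $\mathbf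 s,\mu,\lambda$ are computed on components (arity-wise for operads, on underlying objects for algebras), the operad and algebra structures on the values of $\mathbf s$ being induced by the monoidal structure of $\mathbf s$ (and, for fixed $P$, by $\lambda_P:P\to\mathbf s(cP)$). With this structure each of the three satisfies (G1) and (G2), and is compatible with $\mathcal X$. -/

import Mathlib

open CategoryTheory Limits MonoidalCategory Opposite

universe w v u v' u'

namespace OperadDescent

noncomputable section

/-! ### Descent categories -/

section Cosimplicial

variable {D : Type u} [Category.{v} D]

/-- The diagonal functor from bicosimplicial to cosimplicial objects. -/
def diag (D : Type u) [Category.{v} D] :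
    (SimplexCategory ⥤ SimplexCategory ⥤ D) ⥤ (SimplexCategory ⥤ D) where
  obj Z :=
    { obj := fun n => (Z.obj n).obj n
      map := fun {n n'} f => (Z.map f).app n ≫ (Z.obj n').map f
      map_id := fun n => by simp
      map_comp := fun f g => by simp }
  map α := { app := fun n => (α.app n).app n
             naturality := fun n n' f => by
               have h := NatTrans.congr_app (α.naturality f) n
               simp only [NatTrans.comp_app] at h
               simp [reassoc_of% h] }

/-- The constant cosimplicial object functor. -/
abbrev cst (D : Type u) [Category.{v} D] : D ⥤ (SimplexCategory ⥤ D) :=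
  Functor.const SimplexCategory

/-- The simple functor applied in the inner variable of a bicosimplicial object. -/
abbrev inner (s : (SimplexCategory ⥤ D) ⥤ D) :
    (SimplexCategory ⥤ SimplexCategory ⥤ D) ⥤ (SimplexCategory ⥤ D) :=
  (Functor.whiskeringRight SimplexCategory (SimplexCategory ⥤ D) D).obj s

/-- The diagonal of the bicosimplicial object `(n, m) ↦ X m` is `X`. -/
def diagConstIso (X : SimplexCategory ⥤ D) :
    (diag D).obj ((Functor.const SimplexCategory).obj X) ≅ X :=
  NatIso.ofComponents (fun _ => Iso.refl _) (fun f => by simp [diag])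

/-- The diagonal of the bicosimplicial object `(n, m) ↦ X n` is `X`. -/
def diagCompConstIso (X : SimplexCategory ⥤ D) :
    (diag D).obj (X ⋙ cst D) ≅ X :=
  NatIso.ofComponents (fun _ => Iso.refl _) (fun f => by simp [diag])

/-- A functor `U` applied degreewise commutes with the diagonal. -/
def diagCompIso {E : Type u'} [Category.{v'} E] (U : E ⥤ D)
    (Z : SimplexCategory ⥤ SimplexCategory ⥤ E) :
    (diag E).obj Z ⋙ U ≅
      (diag D).obj (Z ⋙ (Functor.whiskeringRight SimplexCategory E D).obj U) :=
  NatIso.ofComponents (fun _ => Iso.refl _) (fun f => by simp [diag])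

/-- The data `(s, μ, λ)` of a descent structure: a simple functor, `μ : s s ⟶ s diag`
and `λ : id ⟶ s cst`. -/
structure DescentTriple (D : Type u) [Category.{v} D] where
  /-- the simple functor -/
  simple : (SimplexCategory ⥤ D) ⥤ D
  mu : inner simple ⋙ simple ⟶ diag D ⋙ simple
  lam : 𝟭 D ⟶ cst D ⋙ simple

/-- The transformations `μ` and `λ` are compatible: for every cosimplicial object `X`,
both composites `s X ⟶ s s Z ⟶ s (diag Z) ≅ s X`, where `Z` is one of the bicosimplicial objects
`(n, m) ↦ X m` and `(n, m) ↦ X n`, are the identity. -/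
structure DescentTriple.IsNormalized (T : DescentTriple D) : Prop where
  outer : ∀ X : SimplexCategory ⥤ D,
    T.lam.app (T.simple.obj X) ≫
      T.simple.map (Functor.constComp SimplexCategory X T.simple).inv ≫
      T.mu.app ((Functor.const SimplexCategory).obj X) ≫
      T.simple.map (diagConstIso X).hom = 𝟙 (T.simple.obj X)
  inner : ∀ X : SimplexCategory ⥤ D,
    T.simple.map (Functor.whiskerLeft X T.lam) ≫ T.mu.app (X ⋙ cst D) ≫
      T.simple.map (diagCompConstIso X).hom = 𝟙 (T.simple.obj X)

/-- The cosimplicial object `A ^ Δ[k]`, equal in degree `n` to the product of copies of `A`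
indexed by the `n`-simplices of `Δ[k]`. -/
def power [HasFiniteProducts D] (A : D) (k : SimplexCategory) : SimplexCategory ⥤ D where
  obj n := ∏ᶜ fun _ : (n ⟶ k) => A
  map {n n'} f := Pi.lift fun g : (n' ⟶ k) => Pi.π (fun _ : (n ⟶ k) => A) (f ≫ g)

/-- The map `A ^ d : A ^ Δ[k'] ⟶ A ^ Δ[k]` induced by `d : Δ[k] ⟶ Δ[k']`. -/
def powerMap [HasFiniteProducts D] (A : D) {k k' : SimplexCategory} (d : k ⟶ k') :
    power A k' ⟶ power A k where
  app n := Pi.lift fun g : (n ⟶ k) => Pi.π (fun _ : (n ⟶ k') => A) (g ≫ d)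
  naturality n n' f := by
    dsimp [power]
    ext g
    simp

/-- `(s, μ, λ)` and the class `E` of equivalences form a (cosimplicial) descent structure on `D`. -/
class IsDescent (T : DescentTriple D) (E : MorphismProperty D) : Prop where
  [hasFiniteProducts : HasFiniteProducts D]
  /-- `E` is saturated: it contains every morphism that becomes invertible in `D[E⁻¹]`. -/
  saturated : ∀ {A B : D} (f : A ⟶ B), IsIso (E.Q.map f) → E f
  products : E.IsStableUnderFiniteProducts
  additivity : ∀ X Y : SimplexCategory ⥤ D,
    E (prod.lift (T.simple.map (prod.fst : X ⨯ Y ⟶ X)) (T.simple.map (prod.snd : X ⨯ Y ⟶ Y)))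
  factorization : ∀ Z : SimplexCategory ⥤ SimplexCategory ⥤ D, E (T.mu.app Z)
  normalization : ∀ A : D, E (T.lam.app A)
  normalized : T.IsNormalized
  exactness : ∀ {X Y : SimplexCategory ⥤ D} (f : X ⟶ Y), (∀ n, E (f.app n)) → E (T.simple.map f)
  acyclicity : ∀ A : D,
    E (T.simple.map (powerMap A (SimplexCategory.δ (0 : Fin 2))))

/-- The restriction of `(s, μ, λ)` to a full subcategory stable by `s`. -/
def DescentTriple.restrict (T : DescentTriple D) (P : ObjectProperty D)
    (h : ∀ X : SimplexCategory ⥤ D, (∀ n, P (X.obj n)) → P (T.simple.obj X)) :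
    DescentTriple P.FullSubcategory where
  simple := P.lift ((Functor.whiskeringRight SimplexCategory _ _).obj P.ι ⋙ T.simple)
    (fun X => h _ fun n => (X.obj n).property)
  mu :=
    { app := fun Z => P.homMk (T.mu.app (Z ⋙ (Functor.whiskeringRight SimplexCategory _ _).obj P.ι))
      naturality := fun Z Z' f => by
        apply P.hom_ext
        exact T.mu.naturality
          (Functor.whiskerRight f ((Functor.whiskeringRight SimplexCategory _ _).obj P.ι)) }
  lam :=
    { app := fun A => P.homMk (T.lam.app A.obj ≫
        T.simple.map (Functor.constComp SimplexCategory A P.ι).inv)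
      naturality := fun A B f => by
        apply P.hom_ext
        have h := T.lam.naturality f.hom
        dsimp at h ⊢
        simp only [reassoc_of% h, Category.assoc, ← Functor.map_comp]
        congr 2
        ext n
        simp [Functor.constComp] }

end Cosimplicial

/-! ### Monoidal descent subcategories -/

section Monoidal

variable (C : Type u) [Category.{v} C] [MonoidalCategory C]

instance diagLaxMonoidal : (diag C).LaxMonoidal where
  ε := { app := fun _ => 𝟙 (𝟙_ C)
         naturality := fun n n' f => by
           dsimp [diag]
           simp }
  μ Z Z' := { app := fun n => 𝟙 ((Z.obj n).obj n ⊗ (Z'.obj n).obj n)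
              naturality := fun n n' f => by
                dsimp [diag]
                simp }
  μ_natural_left f Z := by
    ext n
    simp [diag]
  μ_natural_right Z f := by
    ext n
    simp [diag]
  associativity X Y Z := by
    ext n
    simp [diag]
  left_unitality X := by
    ext n
    simp [diag]
  right_unitality X := by
    ext n
    simp [diag]

instance cstLaxMonoidal : (cst C).LaxMonoidal where
  ε := { app := fun _ => 𝟙 (𝟙_ C) }
  μ A B := { app := fun _ => 𝟙 (A ⊗ B) }

variable [SymmetricCategory C]

/-- A structure of monoidal descent subcategory on the full subcategory `D` of `C` given by `P`:
a triple `(s, μ, λ)` on `C`, with `μ` and `λ` compatible, where `s` is a symmetric monoidal functor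
(for the degreewise tensor product of cosimplicial objects) and `μ` and `λ` are monoidal, such that
`s` restricts to `D` and the restricted triple is, together with a class of equivalences of `D`, a
descent structure on `D`. -/
structure MonoidalDescentSubcategory (P : ObjectProperty C) where
  triple : DescentTriple C
  normalized : triple.IsNormalized
  [laxBraided : triple.simple.LaxBraided]
  mu_isMonoidal : NatTrans.IsMonoidal triple.mu
  lam_isMonoidal : NatTrans.IsMonoidal triple.lam
  closed : ∀ X : SimplexCategory ⥤ C, (∀ n, P (X.obj n)) → P (triple.simple.obj X)
  equiv : MorphismProperty P.FullSubcategory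
  isDescent : IsDescent (triple.restrict P closed) equiv

attribute [instance] MonoidalDescentSubcategory.laxBraided

/-- The descent triple on the full subcategory `D`. -/
abbrev MonoidalDescentSubcategory.restricted {C : Type u} [Category.{v} C] [MonoidalCategory C]
    [SymmetricCategory C] {P : ObjectProperty C} (𝒟 : MonoidalDescentSubcategory C P) :
    DescentTriple P.FullSubcategory :=
  𝒟.triple.restrict P 𝒟.closed

end Monoidal

/-! ### Iterated tensor products -/

section Tensor

variable {C : Type u} [Category.{v} C] [MonoidalCategory C]

/-- The iterated tensor product `X i₁ ⊗ (X i₂ ⊗ (⋯ ⊗ 𝟙))` along a list of indices. -/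
def tensOn {ι : Type*} (X : ι → C) : List ι → C
  | [] => 𝟙_ C
  | a :: s => X a ⊗ tensOn X s

/-- The tensor product of a family of morphisms. -/
def tensOnMap {ι : Type*} {X Y : ι → C} (f : ∀ i, X i ⟶ Y i) :
    (s : List ι) → (tensOn X s ⟶ tensOn Y s)
  | [] => 𝟙 (𝟙_ C)
  | a :: s => f a ⊗ₘ tensOnMap f s

/-- The tensor product of a family of isomorphisms. -/
def tensOnIso {ι : Type*} {X Y : ι → C} (e : ∀ i, X i ≅ Y i) :
    (s : List ι) → (tensOn X s ≅ tensOn Y s)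
  | [] => Iso.refl (𝟙_ C)
  | a :: s => e a ⊗ᵢ tensOnIso e s

/-- Reindexing along a map. -/
def tensOnMapList {ι κ : Type*} (X : κ → C) (g : ι → κ) :
    (s : List ι) → (tensOn (fun i => X (g i)) s ≅ tensOn X (s.map g))
  | [] => Iso.refl (𝟙_ C)
  | a :: s => Iso.refl (X (g a)) ⊗ᵢ tensOnMapList X g s

/-- The associativity isomorphism for a concatenation of two lists. -/
def tensOnAppend {ι : Type*} (X : ι → C) :
    (s t : List ι) → (tensOn X (s ++ t) ≅ tensOn X s ⊗ tensOn X t)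
  | [], t => (λ_ (tensOn X t)).symm
  | a :: s, t => (Iso.refl (X a) ⊗ᵢ tensOnAppend X s t) ≪≫
      (α_ (X a) (tensOn X s) (tensOn X t)).symm

/-- The associativity isomorphism for a concatenation of a list of lists. -/
def tensOnFlatMap {ι κ : Type*} (X : κ → C) (g : ι → List κ) :
    (s : List ι) → (tensOn X (s.flatMap g) ≅ tensOn (fun i => tensOn X (g i)) s)
  | [] => Iso.refl (𝟙_ C)
  | a :: s => tensOnAppend X (g a) (s.flatMap g) ≪≫
      (Iso.refl (tensOn X (g a)) ⊗ᵢ tensOnFlatMap X g s)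

/-- The morphism `𝟙 ≅ 𝟙 ⊗ ⋯ ⊗ 𝟙 ⟶ X i₁ ⊗ ⋯ ⊗ X iₙ` induced by morphisms `𝟙 ⟶ X i`. -/
def tensOnUnits {ι : Type*} {X : ι → C} (e : ∀ i, 𝟙_ C ⟶ X i) :
    (s : List ι) → (𝟙_ C ⟶ tensOn X s)
  | [] => 𝟙 (𝟙_ C)
  | a :: s => (λ_ (𝟙_ C)).inv ≫ (e a ⊗ₘ tensOnUnits e s)

/-- The morphism `X i₁ ⊗ ⋯ ⊗ X iₙ ⟶ F (Y i₁ ⊗ ⋯ ⊗ Y iₙ)` given by morphisms `X i ⟶ F (Y i)` and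
the Künneth and unit morphisms of a lax monoidal functor `F`. -/
def tensOnLax {C' : Type u'} [Category.{v'} C'] [MonoidalCategory C'] (F : C' ⥤ C)
    [F.LaxMonoidal] {ι : Type*} {X : ι → C} {Y : ι → C'} (f : ∀ i, X i ⟶ F.obj (Y i)) :
    (s : List ι) → (tensOn X s ⟶ F.obj (tensOn Y s))
  | [] => Functor.LaxMonoidal.ε F
  | a :: s => (f a ⊗ₘ tensOnLax F f s) ≫ Functor.LaxMonoidal.μ F (Y a) (tensOn Y s)

/-- The tensor product of functors is computed pointwise: evaluation at `k`. -/
def tensOnEval {K : Type u'} [Category.{v'} K] {ι : Type*} (X : ι → (K ⥤ C)) (k : K) :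
    (s : List ι) → ((tensOn X s).obj k ≅ tensOn (fun i => (X i).obj k) s)
  | [] => Iso.refl (𝟙_ C)
  | a :: s => Iso.refl ((X a).obj k) ⊗ᵢ tensOnEval X k s

lemma tensOnEval_naturality {K : Type u'} [Category.{v'} K] {ι : Type*} (X : ι → (K ⥤ C))
    {k k' : K} (f : k ⟶ k') (s : List ι) :
    (tensOn X s).map f ≫ (tensOnEval X k' s).hom =
      (tensOnEval X k s).hom ≫ tensOnMap (fun i => (X i).map f) s := by
  induction s with
  | nil => exact (Category.comp_id _).trans (Category.id_comp _).symm
  | cons a s ih =>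
    change ((X a).map f ⊗ₘ (tensOn X s).map f) ≫ (𝟙 _ ⊗ₘ (tensOnEval X k' s).hom) =
      (𝟙 _ ⊗ₘ (tensOnEval X k s).hom) ≫ ((X a).map f ⊗ₘ tensOnMap (fun i => (X i).map f) s)
    rw [tensorHom_comp_tensorHom, tensorHom_comp_tensorHom, ih, Category.id_comp, Category.comp_id]

lemma tensOnMap_id {ι : Type*} (X : ι → C) (s : List ι) :
    tensOnMap (fun i => 𝟙 (X i)) s = 𝟙 (tensOn X s) := by
  induction s with
  | nil => rfl
  | cons a s ih => simp [tensOnMap, ih, tensOn]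

lemma tensOnMap_comp {ι : Type*} {X Y Z : ι → C} (f : ∀ i, X i ⟶ Y i) (g : ∀ i, Y i ⟶ Z i)
    (s : List ι) : tensOnMap (fun i => f i ≫ g i) s = tensOnMap f s ≫ tensOnMap g s := by
  induction s with
  | nil => exact (Category.comp_id (𝟙 (𝟙_ C))).symm
  | cons a s ih =>
    change (f a ≫ g a) ⊗ₘ _ = (f a ⊗ₘ tensOnMap f s) ≫ (g a ⊗ₘ tensOnMap g s)
    rw [ih, tensorHom_comp_tensorHom]

/-- The tensor product `X 0 ⊗ (X 1 ⊗ (⋯ ⊗ 𝟙))` of a finite sequence of objects. -/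
def tens {n : ℕ} (X : Fin n → C) : C := tensOn X (List.finRange n)

/-- The tensor product of a finite sequence of morphisms. -/
def tensMap {n : ℕ} {X Y : Fin n → C} (f : ∀ i, X i ⟶ Y i) : tens X ⟶ tens Y :=
  tensOnMap f (List.finRange n)

lemma tensMap_id {n : ℕ} (X : Fin n → C) : tensMap (fun i => 𝟙 (X i)) = 𝟙 (tens X) :=
  tensOnMap_id X _

lemma tensMap_comp {n : ℕ} {X Y Z : Fin n → C} (f : ∀ i, X i ⟶ Y i) (g : ∀ i, Y i ⟶ Z i) :
    tensMap (fun i => f i ≫ g i) = tensMap f ≫ tensMap g :=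
  tensOnMap_comp f g _

/-- The morphism `⨂ X ⟶ F (⨂ Y)` given by morphisms `X i ⟶ F (Y i)` and the Künneth and unit
morphisms of a lax monoidal functor `F`. -/
def tensLax {C' : Type u'} [Category.{v'} C'] [MonoidalCategory C'] (F : C' ⥤ C)
    [F.LaxMonoidal] {n : ℕ} {X : Fin n → C} {Y : Fin n → C'} (f : ∀ i, X i ⟶ F.obj (Y i)) :
    tens X ⟶ F.obj (tens Y) :=
  tensOnLax F f (List.finRange n)

/-- The tensor product of functors is computed pointwise. -/
def tensEval {K : Type u'} [Category.{v'} K] {n : ℕ} (X : Fin n → (K ⥤ C)) (k : K) :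
    (tens X).obj k ≅ tens (fun i => (X i).obj k) :=
  tensOnEval X k (List.finRange n)

lemma tensEval_naturality {K : Type u'} [Category.{v'} K] {n : ℕ} (X : Fin n → (K ⥤ C))
    {k k' : K} (f : k ⟶ k') :
    (tens X).map f ≫ (tensEval X k').hom =
      (tensEval X k).hom ≫ tensMap (fun i => (X i).map f) :=
  tensOnEval_naturality X f _

lemma evalAct_naturality {A A' B B' T T' S S' : C} {a : A ⟶ A'} {t : T ⟶ T'} {g : T ⟶ S}
    {g' : T' ⟶ S'} {b : S ⟶ S'} {c : A ⊗ S ⟶ B} {c' : A' ⊗ S' ⟶ B'} {r : B ⟶ B'}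
    (e : t ≫ g' = g ≫ b) (e' : c ≫ r = (a ⊗ₘ b) ≫ c') :
    (a ⊗ₘ t) ≫ (A' ◁ g') ≫ c' = ((A ◁ g) ≫ c) ≫ r := by
  rw [Category.assoc, e', ← id_tensorHom, ← id_tensorHom, tensorHom_comp_tensorHom_assoc,
    tensorHom_comp_tensorHom_assoc, e, Category.comp_id, Category.id_comp]

/-- The tensor product of a sequence with only one term. -/
def tensOne (X : Fin 1 → C) : tens X ≅ X 0 := ρ_ (X 0)

variable [SymmetricCategory C]

/-- The isomorphism moving the factor of index `a` to the front. -/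
def tensOnPull {ι : Type*} [DecidableEq ι] (X : ι → C) (a : ι) :
    (t : List ι) → a ∈ t → (tensOn X t ≅ X a ⊗ tensOn X (t.erase a))
  | [], h => (List.not_mem_nil h).elim
  | b :: t, h =>
    if hb : b = a then
      eqToIso (by subst hb; rw [List.erase_cons_head]; rfl)
    else
      (Iso.refl (X b) ⊗ᵢ tensOnPull X a t ((List.mem_cons.1 h).resolve_left (Ne.symm hb))) ≪≫
        (α_ (X b) (X a) (tensOn X (t.erase a))).symm ≪≫
        (β_ (X b) (X a) ⊗ᵢ Iso.refl (tensOn X (t.erase a))) ≪≫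
        α_ (X a) (X b) (tensOn X (t.erase a)) ≪≫
        eqToIso (by rw [List.erase_cons_tail (by simpa using hb)]; rfl)

/-- The symmetry isomorphism between the tensor products of the same factors taken in two
different orders. For lists without repetitions each factor is sent to the factor of the
same index. -/
def tensOnReorder {ι : Type*} [DecidableEq ι] (X : ι → C) :
    (s t : List ι) → s.Perm t → (tensOn X s ≅ tensOn X t)
  | [], t, h => eqToIso (by rw [List.nil_perm.1 h])
  | a :: s, t, h =>
    (Iso.refl (X a) ⊗ᵢ tensOnReorder X s (t.erase a)
        ((List.cons_perm_iff_perm_erase.1 h).2)) ≪≫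
      (tensOnPull X a t ((List.cons_perm_iff_perm_erase.1 h).1)).symm

/-- The interchange `(⨂ X) ⊗ (⨂ Y) ⟶ ⨂ (X ⊗ Y)`. -/
def tensOnZip {ι : Type*} (X Y : ι → C) :
    (s : List ι) → (tensOn X s ⊗ tensOn Y s ⟶ tensOn (fun i => X i ⊗ Y i) s)
  | [] => (λ_ (𝟙_ C)).hom
  | a :: s => tensorμ (X a) (tensOn X s) (Y a) (tensOn Y s) ≫
      (𝟙 (X a ⊗ Y a) ⊗ₘ tensOnZip X Y s)

/-- The symmetry isomorphism `⨂ᵢ X (σ i) ≅ ⨂ᵢ X i`; it sends the `i`-th factor of the source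
to the `σ i`-th factor of the target. -/
def tensPerm {n : ℕ} (X : Fin n → C) (σ : Equiv.Perm (Fin n)) :
    tens (fun i => X (σ i)) ≅ tens X :=
  tensOnMapList X σ (List.finRange n) ≪≫
    tensOnReorder X ((List.finRange n).map σ) (List.finRange n)
      (Equiv.Perm.map_finRange_perm σ)

lemma finRange_perm_flatMap {l M : ℕ} {m : Fin l → ℕ} (e : (Σ i : Fin l, Fin (m i)) ≃ Fin M) :
    (List.finRange M).Perm
      ((List.finRange l).flatMap fun i => (List.finRange (m i)).map fun j => e ⟨i, j⟩) := by
  rw [List.perm_ext_iff_of_nodup (List.nodup_finRange M)]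
  · intro k
    obtain ⟨⟨i, j⟩, rfl⟩ := e.surjective k
    simp only [List.mem_finRange, List.mem_flatMap, List.mem_map, true_and, true_iff]
    exact ⟨i, j, rfl⟩
  · rw [List.nodup_flatMap]
    refine ⟨fun i _ => (List.nodup_finRange _).map fun j j' h => by simpa using h, ?_⟩
    refine (List.nodup_finRange l).imp fun {i i'} hne => ?_
    intro k hk hk'
    simp only [List.mem_map, List.mem_finRange, true_and] at hk hk'
    obtain ⟨j, rfl⟩ := hk
    obtain ⟨j', h⟩ := hk'
    exact hne (congrArg Sigma.fst (e.injective h)).symm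

/-- For a bijection `e` between the pairs `(i, j)` and the positions `k`, the symmetry isomorphism
`⨂ₖ Z k ≅ ⨂ᵢ ⨂ⱼ Z (e (i, j))`. -/
def tensGroup {l M : ℕ} {m : Fin l → ℕ} (e : (Σ i : Fin l, Fin (m i)) ≃ Fin M) (Z : Fin M → C) :
    tens Z ≅ tens (fun i => tens (fun j => Z (e ⟨i, j⟩))) :=
  tensOnReorder Z (List.finRange M)
      ((List.finRange l).flatMap fun i => (List.finRange (m i)).map fun j => e ⟨i, j⟩)
      (finRange_perm_flatMap e) ≪≫
    tensOnFlatMap Z _ (List.finRange l) ≪≫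
    tensOnIso (fun i => (tensOnMapList Z (fun j => e ⟨i, j⟩) (List.finRange (m i))).symm)
      (List.finRange l)

/-- The symmetry `(A ⊗ ⨂ᵢ X i) ⊗ ⨂ₖ Z k ⟶ A ⊗ ⨂ᵢ (X i ⊗ ⨂ⱼ Z (e (i, j)))`. -/
def tensShuffle {l M : ℕ} {m : Fin l → ℕ} (e : (Σ i : Fin l, Fin (m i)) ≃ Fin M)
    (A : C) (X : Fin l → C) (Z : Fin M → C) :
    (A ⊗ tens X) ⊗ tens Z ⟶ A ⊗ tens (fun i => X i ⊗ tens (fun j => Z (e ⟨i, j⟩))) :=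
  (α_ A (tens X) (tens Z)).hom ≫
    (A ◁ ((tens X ◁ (tensGroup e Z).hom) ≫
      tensOnZip X (fun i => tens (fun j => Z (e ⟨i, j⟩))) (List.finRange l)))

end Tensor

/-! ### Operads -/

section Operads

/-- The lexicographic bijection between the pairs `(i, j)` with `i < l` and `j < m i` and the
positions `k < n = m 0 + ⋯ + m (l - 1)`. -/
def blocks {l n : ℕ+} (m : Fin l → ℕ+) (h : ∑ i, (m i : ℕ) = n) :
    (Σ i : Fin l, Fin (m i)) ≃ Fin n :=
  finSigmaFinEquiv.trans (finCongr h)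

/-- The permutation of `m 0 + ⋯ + m (l - 1)` letters which permutes the `l` blocks as `σ`
permutes `l` letters; the `i`-th block of the source has length `m (σ i)`. -/
def blockPerm {l n : ℕ+} (m : Fin l → ℕ+) (σ : Equiv.Perm (Fin l))
    (h : ∑ i, (m i : ℕ) = n) (h' : ∑ i, (m (σ i) : ℕ) = n) : Equiv.Perm (Fin n) :=
  (blocks (fun i => m (σ i)) h').symm.trans
    ((Equiv.sigmaCongrLeft (β := fun i => Fin (m i)) σ).trans (blocks m h))

/-- The direct sum `τ 0 ⊕ ⋯ ⊕ τ (l - 1)` of permutations. -/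
def sumPerm {l n : ℕ+} (m : Fin l → ℕ+) (h : ∑ i, (m i : ℕ) = n)
    (τ : ∀ i, Equiv.Perm (Fin (m i))) : Equiv.Perm (Fin n) :=
  (blocks m h).symm.trans ((Equiv.sigmaCongrRight τ).trans (blocks m h))

variable (C : Type u) [Category.{v} C] [MonoidalCategory C] [SymmetricCategory C]

/-- A unital symmetric operad in a symmetric monoidal category, with arities `l ≥ 1`. -/
structure Operad where
  obj : ℕ+ → C
  /-- the right action of the symmetric groups -/
  act {l : ℕ+} : Equiv.Perm (Fin l) → (obj l ⟶ obj l)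
  /-- the composition `P(l) ⊗ P(m 0) ⊗ ⋯ ⊗ P(m (l - 1)) ⟶ P(n)`, where `n = m 0 + ⋯ + m (l - 1)` -/
  comp (l : ℕ+) (m : Fin l → ℕ+) (n : ℕ+) (h : ∑ i, (m i : ℕ) = n) :
    obj l ⊗ tens (fun i => obj (m i)) ⟶ obj n
  unit : 𝟙_ C ⟶ obj 1
  act_one (l : ℕ+) : act (1 : Equiv.Perm (Fin l)) = 𝟙 (obj l)
  act_mul {l : ℕ+} (σ τ : Equiv.Perm (Fin l)) : act (σ * τ) = act σ ≫ act τ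
  comp_act (l : ℕ+) (m : Fin l → ℕ+) (n : ℕ+) (σ : Equiv.Perm (Fin l))
    (h : ∑ i, (m i : ℕ) = n) (h' : ∑ i, (m (σ i) : ℕ) = n) :
    (act σ ▷ tens (fun i => obj (m (σ i)))) ≫ comp l (fun i => m (σ i)) n h' =
      (obj l ◁ (tensPerm (fun i => obj (m i)) σ).hom) ≫ comp l m n h ≫ act (blockPerm m σ h h')
  act_comp (l : ℕ+) (m : Fin l → ℕ+) (n : ℕ+) (h : ∑ i, (m i : ℕ) = n)
    (τ : ∀ i, Equiv.Perm (Fin (m i))) :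
    (obj l ◁ tensMap (fun i => act (τ i))) ≫ comp l m n h = comp l m n h ≫ act (sumPerm m h τ)
  unit_comp (n : ℕ+) (h : ∑ _i : Fin (1 : ℕ+), (n : ℕ) = n) :
    (unit ▷ tens (fun _ : Fin 1 => obj n)) ≫ comp 1 (fun _ => n) n h =
      (λ_ (tens (fun _ : Fin 1 => obj n))).hom ≫ (tensOne (fun _ => obj n)).hom
  comp_unit (l : ℕ+) (h : ∑ _i : Fin l, ((1 : ℕ+) : ℕ) = l) :
    (obj l ◁ tensOnUnits (fun _ => unit) (List.finRange l)) ≫ comp l (fun _ => 1) l h =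
      (ρ_ (obj l)).hom
  assoc (l : ℕ+) (m : Fin l → ℕ+) (M : ℕ+) (hM : ∑ i, (m i : ℕ) = M)
    (n : Fin M → ℕ+) (N : ℕ+) (hN : ∑ k, (n k : ℕ) = N)
    (N' : Fin l → ℕ+) (hN' : ∀ i, ∑ j, (n (blocks m hM ⟨i, j⟩) : ℕ) = N' i)
    (h : ∑ i, (N' i : ℕ) = N) :
    (comp l m M hM ▷ tens (fun k => obj (n k))) ≫ comp M n N hN =
      tensShuffle (blocks m hM) (obj l) (fun i => obj (m i)) (fun k => obj (n k)) ≫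
        (obj l ◁ tensMap (fun i => comp (m i) (fun j => n (blocks m hM ⟨i, j⟩)) (N' i) (hN' i))) ≫
        comp l N' N h

variable {C}

namespace Operad

/-- A morphism of operads. -/
@[ext]
structure Hom (P Q : Operad C) where
  app (l : ℕ+) : P.obj l ⟶ Q.obj l
  act_app {l : ℕ+} (σ : Equiv.Perm (Fin l)) : P.act σ ≫ app l = app l ≫ Q.act σ
  comp_app (l : ℕ+) (m : Fin l → ℕ+) (n : ℕ+) (h : ∑ i, (m i : ℕ) = n) :
    P.comp l m n h ≫ app n = (app l ⊗ₘ tensMap (fun i => app (m i))) ≫ Q.comp l m n h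
  unit_app : P.unit ≫ app 1 = Q.unit

instance : Category (Operad C) where
  Hom := Hom
  id P :=
    { app := fun l => 𝟙 (P.obj l)
      act_app := fun σ => by simp
      comp_app := fun l m n h => by simp [tensMap_id]
      unit_app := by simp }
  comp f g :=
    { app := fun l => f.app l ≫ g.app l
      act_app := fun σ => by rw [reassoc_of% f.act_app, g.act_app, Category.assoc]
      comp_app := fun l m n h => by
        rw [reassoc_of% f.comp_app, g.comp_app, tensMap_comp, ← tensorHom_comp_tensorHom_assoc]
      unit_app := by rw [reassoc_of% f.unit_app, g.unit_app] }

/-- The functor sending an operad to its component of arity `l`. -/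
def arity (C : Type u) [Category.{v} C] [MonoidalCategory C] [SymmetricCategory C] (l : ℕ+) :
    Operad C ⥤ C where
  obj P := P.obj l
  map f := f.app l

/-- An algebra over the operad `P`. -/
structure Algebra (P : Operad C) where
  obj : C
  act (l : ℕ+) : P.obj l ⊗ tens (fun _ : Fin l => obj) ⟶ obj
  equivariant {l : ℕ+} (σ : Equiv.Perm (Fin l)) :
    (P.act σ ▷ tens (fun _ : Fin l => obj)) ≫ act l =
      (P.obj l ◁ (tensPerm (fun _ : Fin l => obj) σ).hom) ≫ act l
  unit_act :
    (P.unit ▷ tens (fun _ : Fin 1 => obj)) ≫ act 1 =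
      (λ_ (tens (fun _ : Fin 1 => obj))).hom ≫ (tensOne (fun _ => obj)).hom
  assoc (l : ℕ+) (m : Fin l → ℕ+) (M : ℕ+) (hM : ∑ i, (m i : ℕ) = M) :
    (P.comp l m M hM ▷ tens (fun _ : Fin M => obj)) ≫ act M =
      tensShuffle (blocks m hM) (P.obj l) (fun i => P.obj (m i)) (fun _ => obj) ≫
        (P.obj l ◁ tensMap (fun i => act (m i))) ≫ act l

/-- A morphism of algebras over a fixed operad. -/
@[ext]
structure Algebra.Hom {P : Operad C} (A B : P.Algebra) where
  hom : A.obj ⟶ B.obj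
  act_hom (l : ℕ+) : A.act l ≫ hom = (P.obj l ◁ tensMap (fun _ => hom)) ≫ B.act l

instance (P : Operad C) : Category P.Algebra where
  Hom := Algebra.Hom
  id A :=
    { hom := 𝟙 A.obj
      act_hom := fun l => by simp [tensMap_id] }
  comp f g :=
    { hom := f.hom ≫ g.hom
      act_hom := fun l => by
        rw [reassoc_of% f.act_hom, g.act_hom, tensMap_comp, ← whiskerLeft_comp_assoc] }

/-- The functor forgetting the algebra structure. -/
def Algebra.forget (P : Operad C) : P.Algebra ⥤ C where
  obj A := A.obj
  map f := f.hom

end Operad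

/-- A pair `(P, A)` of an operad `P` and a `P`-algebra `A`. -/
structure OperadAlgebra (C : Type u) [Category.{v} C] [MonoidalCategory C]
    [SymmetricCategory C] where
  operad : Operad C
  algebra : operad.Algebra

namespace OperadAlgebra

/-- A morphism `(P, A) ⟶ (Q, B)`: a morphism of operads `f : P ⟶ Q` and a morphism `A ⟶ B`
compatible with the actions of `P` on `A` and, through `f`, on `B`. -/
@[ext]
structure Hom (A B : OperadAlgebra C) where
  operadHom : A.operad ⟶ B.operad
  hom : A.algebra.obj ⟶ B.algebra.obj
  act_hom (l : ℕ+) :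
    A.algebra.act l ≫ hom = (operadHom.app l ⊗ₘ tensMap (fun _ => hom)) ≫ B.algebra.act l

instance : Category (OperadAlgebra C) where
  Hom := Hom
  id A :=
    { operadHom := 𝟙 A.operad
      hom := 𝟙 A.algebra.obj
      act_hom := fun l => by
        change _ = (𝟙 _ ⊗ₘ _) ≫ _
        simp [tensMap_id] }
  comp f g :=
    { operadHom := f.operadHom ≫ g.operadHom
      hom := f.hom ≫ g.hom
      act_hom := fun l => by
        change _ = (f.operadHom.app l ≫ g.operadHom.app l ⊗ₘ _) ≫ _
        rw [reassoc_of% f.act_hom, g.act_hom, tensMap_comp, ← tensorHom_comp_tensorHom_assoc] }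

/-- The functor `(P, A) ↦ P`. -/
def toOperad (C : Type u) [Category.{v} C] [MonoidalCategory C] [SymmetricCategory C] :
    OperadAlgebra C ⥤ Operad C where
  obj A := A.operad
  map f := f.operadHom

/-- The functor `(P, A) ↦ A`. -/
def forget (C : Type u) [Category.{v} C] [MonoidalCategory C] [SymmetricCategory C] :
    OperadAlgebra C ⥤ C where
  obj A := A.algebra.obj
  map f := f.hom

end OperadAlgebra

end Operads

/-! ### Descent structures computed on underlying objects -/

section Lift

/-- The triple `T'` on `E` is computed on underlying objects: through the functor `U : E ⥤ C` it
corresponds to the triple `T` on `C`. -/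
structure TripleLift {E : Type u'} [Category.{v'} E] {C : Type u} [Category.{v} C]
    (U : E ⥤ C) (T' : DescentTriple E) (T : DescentTriple C) where
  /-- `U (s' F) ≅ s (U F)`, naturally in the cosimplicial object `F` -/
  iso : T'.simple ⋙ U ≅
    (Functor.whiskeringRight SimplexCategory E C).obj U ⋙ T.simple
  mu : ∀ Z : SimplexCategory ⥤ SimplexCategory ⥤ E,
    U.map (T'.mu.app Z) ≫ iso.hom.app ((diag E).obj Z) ≫ T.simple.map (diagCompIso U Z).hom =
      iso.hom.app (Z ⋙ T'.simple) ≫ T.simple.map (Functor.whiskerLeft Z iso.hom) ≫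
        T.mu.app (Z ⋙ (Functor.whiskeringRight SimplexCategory E C).obj U)
  lam : ∀ A : E,
    U.map (T'.lam.app A) ≫ iso.hom.app ((cst E).obj A) ≫
      T.simple.map (Functor.constComp SimplexCategory A U).hom = T.lam.app (U.obj A)

variable {C : Type u} [Category.{v} C] [MonoidalCategory C] [SymmetricCategory C]

/-- The value of a `TripleLift` on a cosimplicial object: `U (s' F) ⟶ s (U F)`. -/
def TripleLift.hom {E : Type u'} [Category.{v'} E] {U : E ⥤ C} {T' : DescentTriple E}
    {T : DescentTriple C} (θ : TripleLift U T' T) (F : SimplexCategory ⥤ E) :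
    U.obj (T'.simple.obj F) ⟶ T.simple.obj (F ⋙ U) :=
  θ.iso.hom.app F

/-! The structure morphisms of a cosimplicial operad, as morphisms of cosimplicial objects. -/

variable (F : SimplexCategory ⥤ Operad C)

/-- The cosimplicial object of arity `l` of a cosimplicial operad. -/
abbrev cosArity (l : ℕ+) : SimplexCategory ⥤ C := F ⋙ Operad.arity C l

def cosAct {l : ℕ+} (σ : Equiv.Perm (Fin l)) : cosArity F l ⟶ cosArity F l where
  app k := (F.obj k).act σ
  naturality _ _ f := ((F.map f).act_app σ).symm

def cosUnit : 𝟙_ (SimplexCategory ⥤ C) ⟶ cosArity F 1 where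
  app k := (F.obj k).unit
  naturality k k' f := by
    change 𝟙 (𝟙_ C) ≫ _ = _ ≫ (F.map f).app 1
    rw [(F.map f).unit_app, Category.id_comp]

def cosComp (l : ℕ+) (m : Fin l → ℕ+) (n : ℕ+) (h : ∑ i, (m i : ℕ) = n) :
    cosArity F l ⊗ tens (fun i => cosArity F (m i)) ⟶ cosArity F n where
  app k := ((F.obj k).obj l ◁ (tensEval (fun i => cosArity F (m i)) k).hom) ≫
    (F.obj k).comp l m n h
  naturality _ _ f :=
    evalAct_naturality (tensEval_naturality (fun i => cosArity F (m i)) f)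
      ((F.map f).comp_app l m n h)

/-- The operad `R` with the morphisms `θ l : R(l) ⟶ s (F(l))` carries the operad structure induced
arity-wise on `s F` by the symmetric monoidal functor `s`. -/
structure IsSimpleOperad (s : (SimplexCategory ⥤ C) ⥤ C) [s.LaxMonoidal]
    (R : Operad C) (θ : ∀ l, R.obj l ⟶ s.obj (cosArity F l)) : Prop where
  act {l : ℕ+} (σ : Equiv.Perm (Fin l)) : R.act σ ≫ θ l = θ l ≫ s.map (cosAct F σ)
  unit : R.unit ≫ θ 1 = Functor.LaxMonoidal.ε s ≫ s.map (cosUnit F)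
  comp (l : ℕ+) (m : Fin l → ℕ+) (n : ℕ+) (h : ∑ i, (m i : ℕ) = n) :
    R.comp l m n h ≫ θ n =
      (θ l ⊗ₘ tensLax s (fun i => θ (m i))) ≫
        Functor.LaxMonoidal.μ s _ _ ≫ s.map (cosComp F l m n h)

/-- The action morphisms of a cosimplicial object of pairs of an operad and an algebra over it. -/
def cosAlgAct (F : SimplexCategory ⥤ OperadAlgebra C) (l : ℕ+) :
    cosArity (F ⋙ OperadAlgebra.toOperad C) l ⊗
      tens (fun _ : Fin l => F ⋙ OperadAlgebra.forget C) ⟶ F ⋙ OperadAlgebra.forget C where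
  app k := ((F.obj k).operad.obj l ◁
      (tensEval (fun _ => F ⋙ OperadAlgebra.forget C) k).hom) ≫
    (F.obj k).algebra.act l
  naturality _ _ f :=
    evalAct_naturality (tensEval_naturality (fun _ : Fin l => F ⋙ OperadAlgebra.forget C) f)
      ((F.map f).act_hom l)

/-- The algebra `R` over an operad, with morphisms `θ` from its components to the simple objects
of the components of `F`, carries the structure induced on `s F` by the symmetric monoidal
functor `s`. -/
structure IsSimpleOperadAlgebra (F : SimplexCategory ⥤ OperadAlgebra C)
    (s : (SimplexCategory ⥤ C) ⥤ C) [s.LaxMonoidal] (R : OperadAlgebra C)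
    (θ : ∀ l, R.operad.obj l ⟶ s.obj (cosArity (F ⋙ OperadAlgebra.toOperad C) l))
    (θ' : R.algebra.obj ⟶ s.obj (F ⋙ OperadAlgebra.forget C)) : Prop where
  operad : IsSimpleOperad (F ⋙ OperadAlgebra.toOperad C) s R.operad θ
  act (l : ℕ+) :
    R.algebra.act l ≫ θ' =
      (θ l ⊗ₘ tensLax s (fun _ => θ')) ≫
        Functor.LaxMonoidal.μ s _ _ ≫ s.map (cosAlgAct F l)

/-- The action morphisms of a cosimplicial `P`-algebra, which is the same as an algebra over the
constant cosimplicial operad `P`. -/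
def cosFixedAct {P : Operad C} (F : SimplexCategory ⥤ P.Algebra) (l : ℕ+) :
    (cst C).obj (P.obj l) ⊗ tens (fun _ : Fin l => F ⋙ Operad.Algebra.forget P) ⟶
      F ⋙ Operad.Algebra.forget P where
  app k := (P.obj l ◁
      (tensEval (fun _ => F ⋙ Operad.Algebra.forget P) k).hom) ≫
    (F.obj k).act l
  naturality _ _ f :=
    evalAct_naturality (tensEval_naturality (fun _ : Fin l => F ⋙ Operad.Algebra.forget P) f)
      (((F.map f).act_hom l).trans (by rw [← id_tensorHom]; rfl))

/-- The `P`-algebra `R` with the morphism `θ : R ⟶ s F` carries the structure of the reciprocal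
image, along `λ : P ⟶ s (cst P)`, of the `s (cst P)`-algebra `s F`. -/
structure IsSimpleAlgebra {P : Operad C} (F : SimplexCategory ⥤ P.Algebra)
    (T : DescentTriple C) [T.simple.LaxMonoidal] (R : P.Algebra)
    (θ : R.obj ⟶ T.simple.obj (F ⋙ Operad.Algebra.forget P)) : Prop where
  act (l : ℕ+) :
    R.act l ≫ θ =
      (T.lam.app (P.obj l) ⊗ₘ tensLax T.simple (fun _ => θ)) ≫
        Functor.LaxMonoidal.μ T.simple _ _ ≫ T.simple.map (cosFixedAct F l)

end Lift

/-! ### Compatibility with a site -/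

section Compatible

variable {X : Type w} [SmallCategory X] {J : GrothendieckTopology X}
  {E : Type u} [Category.{v} E]

variable [HasFilteredColimitsOfSize.{w, w} E]

instance (Φ : GrothendieckTopology.Point.{w} J) : HasColimitsOfShape Φ.fiber.Elementsᵒᵖ E :=
  HasFilteredColimitsOfSize.HasColimitsOfShape _

/-- The stalk at the point `Φ`: the filtered colimit of `F(U)` over the neighbourhoods `(U, u)`,
where `u` belongs to the fibre of `U`. -/
def stalk (E : Type u) [Category.{v} E] [HasFilteredColimitsOfSize.{w, w} E]
    (Φ : GrothendieckTopology.Point.{w} J) : (Xᵒᵖ ⥤ E) ⥤ E :=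
  (Functor.whiskeringLeft _ _ E).obj (CategoryOfElements.π Φ.fiber).op ⋙ colim

/-- The canonical morphism `(s F)_Φ ⟶ s (F_Φ)` for a cosimplicial presheaf `F`, where `s F` is
computed objectwise. -/
def stalkComparison (s : (SimplexCategory ⥤ E) ⥤ E) (Φ : GrothendieckTopology.Point.{w} J)
    (F : SimplexCategory ⥤ Xᵒᵖ ⥤ E) :
    (stalk E Φ).obj (F.flip ⋙ s) ⟶ s.obj (F ⋙ stalk E Φ) :=
  colimit.desc ((CategoryOfElements.π Φ.fiber).op ⋙ F.flip ⋙ s)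
    { pt := s.obj (F ⋙ stalk E Φ)
      ι :=
        { app := fun e => s.map
            { app := fun k => colimit.ι ((CategoryOfElements.π Φ.fiber).op ⋙ F.obj k) e
              naturality := fun k k' f =>
                (ι_colimMap (Functor.whiskerLeft (CategoryOfElements.π Φ.fiber).op
                  (F.map f)) e).symm }
          naturality := fun e e' f => by
            change s.map (F.flip.map _) ≫ _ = _ ≫ 𝟙 _
            rw [Category.comp_id, ← s.map_comp]
            congr 1
            ext k
            exact colimit.w ((CategoryOfElements.π Φ.fiber).op ⋙ F.obj k) f } }

/-- The pair of the site `(X, J)`, with the points in `Ξ`, and of the category `E`, with the descent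
structure `(W, T)`, is compatible: `E` is a descent category which has filtered colimits and
products, these are exact with respect to the class `W` of equivalences, and the simple functor
commutes with stalks up to equivalences on cosimplicial sheaves. The predicate `S` tells which
presheaves with values in `E` are sheaves. -/
structure IsCompatible {X : Type w} [SmallCategory X] {J : GrothendieckTopology X}
    (Ξ : ObjectProperty (GrothendieckTopology.Point.{w} J))
    {E : Type u} [Category.{v} E] (T : DescentTriple E) (W : MorphismProperty E)
    (S : ObjectProperty (Xᵒᵖ ⥤ E)) : Prop where
  isDescent : IsDescent T W
  [hasFilteredColimits : HasFilteredColimitsOfSize.{w, w} E]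
  hasProducts : HasProducts.{w} E
  filteredColimits_exact : MorphismProperty.IsStableUnderFilteredColimits.{w, w} W
  products_exact : ∀ I : Type w, W.IsStableUnderProductsOfShape I
  stalks : ∀ F : SimplexCategory ⥤ Xᵒᵖ ⥤ E, (∀ k, S (F.obj k)) →
    ∀ Φ : GrothendieckTopology.Point.{w} J, Ξ Φ → W (stalkComparison T.simple Φ F)

end Compatible

/-! ### Operads and algebras in a full subcategory -/

section Subcategory

variable {C : Type u} [Category.{v} C] [MonoidalCategory C] [SymmetricCategory C]
  (P : ObjectProperty C)

/-- The operads in `C` whose components belong to the full subcategory given by `P`. -/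
def opIn : ObjectProperty (Operad C) := fun O => ∀ l, P (O.obj l)

/-- The pairs of an operad and an algebra over it which both belong to the full subcategory. -/
def algIn : ObjectProperty (OperadAlgebra C) := fun A => opIn P A.operad ∧ P A.algebra.obj

/-- The algebras over `O` which belong to the full subcategory. -/
def algOverIn (O : Operad C) : ObjectProperty O.Algebra := fun A => P A.obj

/-- The category of operads in the full subcategory given by `P`. -/
abbrev Op := (opIn P).FullSubcategory

/-- The category of algebras over variable operads in the full subcategory given by `P`. -/
abbrev Alg := (algIn P).FullSubcategory

/-- The category of algebras over the operad `O` in the full subcategory given by `P`. -/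
abbrev AlgOver (O : Operad C) := (algOverIn P O).FullSubcategory

/-- The component of arity `l`, as a functor with values in the full subcategory. -/
def opArity (l : ℕ+) : Op P ⥤ P.FullSubcategory :=
  P.lift ((opIn P).ι ⋙ Operad.arity C l) fun O => O.property l

/-- The operad of a pair. -/
def algOperad : Alg P ⥤ Op P :=
  (opIn P).lift ((algIn P).ι ⋙ OperadAlgebra.toOperad C) fun A => A.property.1

/-- The underlying object of the algebra of a pair. -/
def algForget : Alg P ⥤ P.FullSubcategory :=
  P.lift ((algIn P).ι ⋙ OperadAlgebra.forget C) fun A => A.property.2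

/-- The underlying object of an algebra over `O`. -/
def algOverForget (O : Operad C) : AlgOver P O ⥤ P.FullSubcategory :=
  P.lift ((algOverIn P O).ι ⋙ Operad.Algebra.forget O) fun A => A.property

variable {P} (W : MorphismProperty P.FullSubcategory)

/-- The arity-wise equivalences of operads. -/
def opEquiv : MorphismProperty (Op P) := fun _ _ f => ∀ l, W ((opArity P l).map f)

/-- The componentwise equivalences of pairs. -/
def algEquiv : MorphismProperty (Alg P) :=
  fun _ _ f => opEquiv W ((algOperad P).map f) ∧ W ((algForget P).map f)

/-- The morphisms of algebras over `O` which are equivalences of the underlying objects. -/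
def algOverEquiv (O : Operad C) : MorphismProperty (AlgOver P O) :=
  fun _ _ f => W ((algOverForget P O).map f)

variable {X : Type w} [SmallCategory X] (J : GrothendieckTopology X) (P)

/-- A presheaf of operads is a sheaf if it is a sheaf in every arity. -/
def opSheaf : ObjectProperty (Xᵒᵖ ⥤ Op P) :=
  fun F => ∀ l, Presheaf.IsSheaf J (F ⋙ opArity P l)

/-- A presheaf of pairs of an operad and an algebra over it is a sheaf if the operads and
the underlying objects of the algebras form sheaves. -/
def algSheaf : ObjectProperty (Xᵒᵖ ⥤ Alg P) :=
  fun F => opSheaf P J (F ⋙ algOperad P) ∧ Presheaf.IsSheaf J (F ⋙ algForget P)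

/-- A presheaf of algebras over `O` is a sheaf if the underlying objects form a sheaf. -/
def algOverSheaf (O : Operad C) : ObjectProperty (Xᵒᵖ ⥤ AlgOver P O) :=
  fun F => Presheaf.IsSheaf J (F ⋙ algOverForget P O)

end Subcategory

end

end OperadDescent

-- Everything is reduced to underlying objects. Let `F` be a lax monoidal functor. Morphisms `θ l :
-- R(l) ⟶ F(O(l))` compatible with the structure morphisms form a lax morphism from `R` to `O` along
-- `F` (`IsLaxHom`, and `IsLaxAlgHom` for algebras). The permutations, regroupings and shuffles in
-- the axioms are built from associators, unitors and symmetries, so they commute with such families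
-- as soon as `F` is symmetric; this is the calculus of squares `Sq`. Hence, for each axiom, its
-- left-hand sides for `R` and `O` form a square, its right-hand sides form another, and the two
-- squares have the same comparison morphisms (`OperadAxiom.sq_lhs`, `OperadAxiom.sq_rhs`). The
-- axioms therefore pass from `O` to `R` if the `θ` are jointly monic
-- (`PreOperad.IsOperad.of_mono`), and from `R` to `O` if the `θ` lie in a class of jointly epic
-- families stable under tensor products (`EpiClass.isOperad`).
--
-- This principle gives all the constructions. Identities are monic, so `F` sends operads to
-- operads. Evaluations are jointly conservative on equalities, so a cosimplicial operad is an
-- operad in cosimplicial objects; the composite of the two constructions is the simple operad.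
-- Projections of a limit are jointly monic, so limits are computed on components. Inclusions into a
-- filtered colimit preserved by all `Z ⊗ -` form a tensor-stable epic class, because a filtered
-- category has a cofinal diagonal (`StableColimit.tensor`), so filtered colimits are computed on
-- components as well. Composing lax morphisms with the monoidal transformations `μ` and `λ` shows
-- that `μ` and `λ` are morphisms of operads and of algebras. For a fixed operad `P`, algebras are
-- pulled back along `λ_P`; that `μ` respects this restriction is the compatibility of `μ` and `λ`,
-- applied to the constant cosimplicial objects `P(l)`.
--
-- It remains to transfer the descent structure (`isCompatible_familyInverseImage`). The component
-- functors to `𝒟` are jointly faithful, compute products and filtered colimits, and commute with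
-- the triples up to isomorphism. They carry each morphism which an axiom requires to be an
-- equivalence to a morphism isomorphic to its analogue in `𝒟`, and the same holds for the stalk
-- comparison. Since a saturated class is invariant under isomorphism of arrows, the statements
-- follow from those for `𝒟`.

universe v'' u''


namespace OperadDescent

/-! ### Squares over a lax monoidal functor -/

section Squares

variable {C : Type u} [Category.{v} C] {C' : Type u'} [Category.{v'} C']

/-- `f` and `F.map g` are compatible with the morphisms `x` and `y` from objects of `C` to the
images of objects of `C'`. -/
def Sq (F : C' ⥤ C) {X Y : C} {X' Y' : C'} (f : X ⟶ Y) (g : X' ⟶ Y') (x : X ⟶ F.obj X')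
    (y : Y ⟶ F.obj Y') : Prop := f ≫ y = x ≫ F.map g

namespace Sq

variable {F : C' ⥤ C} {X Y Z W : C} {X' Y' Z' W' : C'} {f : X ⟶ Y} {g : X' ⟶ Y'}
  {x : X ⟶ F.obj X'} {y : Y ⟶ F.obj Y'} {z : Z ⟶ F.obj Z'} {w : W ⟶ F.obj W'}

lemma comp {f' : Y ⟶ Z} {g' : Y' ⟶ Z'} (h : Sq F f g x y) (h' : Sq F f' g' y z) :
    Sq F (f ≫ f') (g ≫ g') x z := by
  unfold Sq at *
  rw [Category.assoc, h', reassoc_of% h, F.map_comp]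

variable (x) in
lemma id : Sq F (𝟙 X) (𝟙 X') x x := by simp [Sq]

lemma map (F : C' ⥤ C) {X Y : C'} (f : X ⟶ Y) :
    Sq F (F.map f) f (𝟙 (F.obj X)) (𝟙 (F.obj Y)) :=
  (Category.comp_id _).trans (Category.id_comp _).symm

lemma symm {e : X ≅ Y} {e' : X' ≅ Y'} (h : Sq F e.hom e'.hom x y) :
    Sq F e.inv e'.inv y x := by
  unfold Sq at *
  rw [Iso.inv_comp_eq, reassoc_of% h, ← F.map_comp]
  simp

lemma eq {f' : X ⟶ Y} (h : Sq F f g x y) (h' : Sq F f' g x y) : f ≫ y = f' ≫ y :=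
  Eq.trans h (Eq.symm h')

section Functors

variable {C'' : Type u''} [Category.{v''} C'']

/-- Squares along `G` can be pasted under squares along `F`; this is what makes lax morphisms
composable. -/
lemma trans {F : C' ⥤ C} {G : C'' ⥤ C'} {X Y : C} {X' Y' : C'} {X'' Y'' : C''} {f : X ⟶ Y}
    {g : X' ⟶ Y'} {h : X'' ⟶ Y''} {x : X ⟶ F.obj X'} {y : Y ⟶ F.obj Y'} {x' : X' ⟶ G.obj X''}
    {y' : Y' ⟶ G.obj Y''} (e : Sq F f g x y) (e' : Sq G g h x' y') :
    Sq (G ⋙ F) f h (x ≫ F.map x') (y ≫ F.map y') := by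
  unfold Sq at *
  rw [reassoc_of% e, ← F.map_comp, e', F.map_comp, Category.assoc, Functor.comp_map]

lemma natTrans {F G : C' ⥤ C} {X Y : C} {X' Y' : C'} {f : X ⟶ Y} {g : X' ⟶ Y'}
    {x : X ⟶ F.obj X'} {y : Y ⟶ F.obj Y'} (e : Sq F f g x y) (τ : F ⟶ G) :
    Sq G f g (x ≫ τ.app X') (y ≫ τ.app Y') := by
  unfold Sq at *
  rw [reassoc_of% e, τ.naturality, Category.assoc]

/-- Both paths agree after composition with every `y' k`, since each of them then computes `x k ≫
F.map (h k)`, and the `y' k` are jointly monic. -/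
lemma cancel {κ : Type*} {F : C' ⥤ C} {X Y Z W : C} {X' Y' : κ → C'} {f : X ⟶ Y}
    {h : ∀ k, X' k ⟶ Y' k} {x : ∀ k, X ⟶ F.obj (X' k)} {y : ∀ k, Y ⟶ F.obj (Y' k)} {f' : Z ⟶ W}
    {x' : ∀ k, Z ⟶ F.obj (X' k)} {y' : ∀ k, W ⟶ F.obj (Y' k)}
    (hy : ∀ (V : C) (a b : V ⟶ W), (∀ k, a ≫ y' k = b ≫ y' k) → a = b)
    (e : ∀ k, Sq F f (h k) (x k) (y k)) (e' : ∀ k, Sq F f' (h k) (x' k) (y' k)) {a : X ⟶ Z}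
    {b : Y ⟶ W} (ha : ∀ k, a ≫ x' k = x k) (hb : ∀ k, b ≫ y' k = y k) :
    Sq (𝟭 C) f f' a b :=
  hy _ _ _ fun k => by
    have h₁ := e k
    have h₂ := e' k
    unfold Sq at h₁ h₂
    rw [Category.assoc, hb, h₁, ← ha, Functor.id_map, Category.assoc, Category.assoc, h₂]

end Functors

end Sq

end Squares

/-! ### Squares and the monoidal structure. -/

section MonoidalSquares

variable {C : Type u} [Category.{v} C] [MonoidalCategory C]
  {C' : Type u'} [Category.{v'} C'] [MonoidalCategory C']

/-- The tensor product of `x : X ⟶ F X'` and `y : Y ⟶ F Y'`. -/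
def tensorLax (F : C' ⥤ C) [F.LaxMonoidal] {X Y : C} {X' Y' : C'} (x : X ⟶ F.obj X')
    (y : Y ⟶ F.obj Y') : X ⊗ Y ⟶ F.obj (X' ⊗ Y') :=
  (x ⊗ₘ y) ≫ Functor.LaxMonoidal.μ F X' Y'

namespace Sq

section Lax

variable {F : C' ⥤ C} [F.LaxMonoidal] {X Y Z W : C} {X' Y' Z' W' : C'} {f : X ⟶ Y} {g : X' ⟶ Y'}
  {x : X ⟶ F.obj X'} {y : Y ⟶ F.obj Y'} {z : Z ⟶ F.obj Z'} {w : W ⟶ F.obj W'}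

/-- This is the naturality of the Künneth morphism of `F`. -/
lemma tensor {f' : Z ⟶ W} {g' : Z' ⟶ W'} (h : Sq F f g x y) (h' : Sq F f' g' z w) :
    Sq F (f ⊗ₘ f') (g ⊗ₘ g') (tensorLax F x z) (tensorLax F y w) := by
  unfold Sq tensorLax at *
  rw [tensorHom_comp_tensorHom_assoc, h, h', Category.assoc, ← tensorHom_comp_tensorHom_assoc,
    Functor.LaxMonoidal.μ_natural]

variable (z) in
lemma whiskerLeft (h : Sq F f g x y) :
    Sq F (Z ◁ f) (Z' ◁ g) (tensorLax F z x) (tensorLax F z y) := by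
  simpa only [id_tensorHom] using (id z).tensor h

variable (z) in
lemma whiskerRight (h : Sq F f g x y) :
    Sq F (f ▷ Z) (g ▷ Z') (tensorLax F x z) (tensorLax F y z) := by
  simpa only [tensorHom_id] using h.tensor (id z)

variable (x y z)

/-- This square and the two for unitors are the coherence axioms of a lax monoidal functor,
precomposed with arbitrary `x`, `y`, `z`. -/
lemma associator : Sq F (α_ X Y Z).hom (α_ X' Y' Z').hom
    (tensorLax F (tensorLax F x y) z) (tensorLax F x (tensorLax F y z)) := by
  unfold Sq tensorLax
  rw [← Category.comp_id z, ← tensorHom_comp_tensorHom_assoc, tensorHom_id, Category.assoc,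
    Category.assoc, Functor.LaxMonoidal.associativity, associator_naturality_assoc,
    Category.comp_id, ← Category.comp_id x, ← tensorHom_comp_tensorHom_assoc, id_tensorHom,
    Category.comp_id]

lemma leftUnitor : Sq F (λ_ X).hom (λ_ X').hom
    (tensorLax F (Functor.LaxMonoidal.ε F) x) x := by
  unfold Sq tensorLax
  rw [tensorHom_def', Category.assoc, Category.assoc, ← Functor.LaxMonoidal.left_unitality,
    leftUnitor_naturality]

lemma rightUnitor : Sq F (ρ_ X).hom (ρ_ X').hom
    (tensorLax F x (Functor.LaxMonoidal.ε F)) x := by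
  unfold Sq tensorLax
  rw [MonoidalCategory.tensorHom_def, Category.assoc, Category.assoc, ← Functor.LaxMonoidal.right_unitality,
    rightUnitor_naturality]

end Lax

section Braided

variable [SymmetricCategory C] [SymmetricCategory C'] {F : C' ⥤ C} [F.LaxBraided]
  {X Y Z W : C} {X' Y' Z' W' : C'}
  (x : X ⟶ F.obj X') (y : Y ⟶ F.obj Y') (z : Z ⟶ F.obj Z') (w : W ⟶ F.obj W')

lemma braiding : Sq F (β_ X Y).hom (β_ X' Y').hom (tensorLax F x y) (tensorLax F y x) := by
  unfold Sq tensorLax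
  rw [Category.assoc, Functor.LaxBraided.braided, BraidedCategory.braiding_naturality_assoc]

/-- Exchanging the two middle factors uses the symmetry, so this is where `F` must be braided and
not only lax monoidal. -/
lemma tensorμ : Sq F (tensorμ X Y Z W) (tensorμ X' Y' Z' W')
    (tensorLax F (tensorLax F x y) (tensorLax F z w))
    (tensorLax F (tensorLax F x z) (tensorLax F y w)) := by
  unfold Sq tensorLax
  rw [← tensorHom_comp_tensorHom, ← tensorHom_comp_tensorHom, Category.assoc, Category.assoc,
    Category.assoc, ← tensorμ_comp_μ_tensorHom_μ_comp_μ, tensorμ_natural_assoc]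

end Braided

end Sq

/-! ### Structural isomorphisms of iterated tensor products and lax monoidal functors -/

section Iterated

variable {F : C' ⥤ C} [F.LaxMonoidal] {ι : Type*} {X : ι → C} {X' : ι → C'}
  (x : ∀ i, X i ⟶ F.obj (X' i))

lemma sq_tensOnMap {Y : ι → C} {Y' : ι → C'} {y : ∀ i, Y i ⟶ F.obj (Y' i)}
    {f : ∀ i, X i ⟶ Y i} {g : ∀ i, X' i ⟶ Y' i} (h : ∀ i, Sq F (f i) (g i) (x i) (y i))
    (s : List ι) : Sq F (tensOnMap f s) (tensOnMap g s) (tensOnLax F x s) (tensOnLax F y s) := by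
  induction s with
  | nil => exact Sq.id _
  | cons a s ih => exact (h a).tensor ih

lemma sq_tensOnIso {Y : ι → C} {Y' : ι → C'} {y : ∀ i, Y i ⟶ F.obj (Y' i)}
    {f : ∀ i, X i ≅ Y i} {g : ∀ i, X' i ≅ Y' i}
    (h : ∀ i, Sq F (f i).hom (g i).hom (x i) (y i)) (s : List ι) :
    Sq F (tensOnIso f s).hom (tensOnIso g s).hom (tensOnLax F x s) (tensOnLax F y s) := by
  induction s with
  | nil => exact Sq.id _
  | cons a s ih => exact (h a).tensor ih

lemma sq_tensOnMapList {κ : Type*} (f : κ → ι) (s : List κ) :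
    Sq F (tensOnMapList X f s).hom (tensOnMapList X' f s).hom
      (tensOnLax F (fun i => x (f i)) s) (tensOnLax F x (s.map f)) := by
  induction s with
  | nil => exact Sq.id _
  | cons a s ih => exact (Sq.id (x (f a))).tensor ih

lemma sq_tensOnAppend (s t : List ι) :
    Sq F (tensOnAppend X s t).hom (tensOnAppend X' s t).hom
      (tensOnLax F x (s ++ t)) (tensorLax F (tensOnLax F x s) (tensOnLax F x t)) := by
  induction s with
  | nil => exact (Sq.leftUnitor (tensOnLax F x t)).symm
  | cons a s ih =>
    exact ((Sq.id (x a)).tensor ih).comp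
      (Sq.associator (x a) (tensOnLax F x s) (tensOnLax F x t)).symm

lemma sq_tensOnFlatMap {κ : Type*} (g : κ → List ι) (s : List κ) :
    Sq F (tensOnFlatMap X g s).hom (tensOnFlatMap X' g s).hom
      (tensOnLax F x (s.flatMap g)) (tensOnLax F (fun i => tensOnLax F x (g i)) s) := by
  induction s with
  | nil => exact Sq.id _
  | cons a s ih =>
    exact (sq_tensOnAppend x (g a) (s.flatMap g)).comp ((Sq.id (tensOnLax F x (g a))).tensor ih)

lemma sq_tensOnUnits {e : ∀ i, 𝟙_ C ⟶ X i} {e' : ∀ i, 𝟙_ C' ⟶ X' i}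
    (h : ∀ i, Sq F (e i) (e' i) (Functor.LaxMonoidal.ε F) (x i)) (s : List ι) :
    Sq F (tensOnUnits e s) (tensOnUnits e' s) (Functor.LaxMonoidal.ε F) (tensOnLax F x s) := by
  induction s with
  | nil => exact Sq.id _
  | cons a s ih => exact (Sq.leftUnitor (Functor.LaxMonoidal.ε F)).symm.comp ((h a).tensor ih)

lemma sq_tensOne {X : Fin 1 → C} {X' : Fin 1 → C'} (x : ∀ i, X i ⟶ F.obj (X' i)) :
    Sq F (tensOne X).hom (tensOne X').hom (tensLax F x) (x 0) :=
  Sq.rightUnitor (x 0)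

/-- Both casts come from one equality of index lists, so substituting it turns them into identities
simultaneously. -/
lemma sq_eqToHom {s t : List ι} (h : s = t) (p : tensOn X s = tensOn X t)
    (p' : tensOn X' s = tensOn X' t) :
    Sq F (eqToHom p) (eqToHom p') (tensOnLax F x s) (tensOnLax F x t) := by
  subst h
  exact Sq.id _

end Iterated

section IteratedBraided

variable [SymmetricCategory C] [SymmetricCategory C'] {F : C' ⥤ C} [F.LaxBraided] {ι : Type*}
  {X : ι → C} {X' : ι → C'} (x : ∀ i, X i ⟶ F.obj (X' i))

/-- By recursion on the list, the isomorphism is a composite of associators, one symmetry and a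
cast, each of which has its own square. -/
lemma sq_tensOnPull [DecidableEq ι] (a : ι) (t : List ι) (h : a ∈ t) :
    Sq F (tensOnPull X a t h).hom (tensOnPull X' a t h).hom
      (tensOnLax F x t) (tensorLax F (x a) (tensOnLax F x (t.erase a))) := by
  induction t with
  | nil => exact (List.not_mem_nil h).elim
  | cons b t ih =>
    by_cases hb : b = a
    · subst hb
      simp only [tensOnPull, dif_pos]
      exact sq_eqToHom x (s := b :: t) (t := b :: (b :: t).erase b)
        (by rw [List.erase_cons_head]) (by rw [List.erase_cons_head]) (by rw [List.erase_cons_head])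
    · simp only [tensOnPull, dif_neg hb]
      refine Sq.comp ((Sq.id (x b)).tensor (ih _)) (Sq.comp (Sq.associator _ _ _).symm
        (Sq.comp ((Sq.braiding _ _).tensor (Sq.id _)) (Sq.comp (Sq.associator _ _ _) ?_)))
      exact sq_eqToHom x (s := a :: b :: t.erase a) (t := a :: (b :: t).erase a)
        (by rw [List.erase_cons_tail (by simpa using hb)])
        (by rw [List.erase_cons_tail (by simpa using hb)])
        (by rw [List.erase_cons_tail (by simpa using hb)])

lemma sq_tensOnReorder [DecidableEq ι] (s t : List ι) (h : s.Perm t) :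
    Sq F (tensOnReorder X s t h).hom (tensOnReorder X' s t h).hom
      (tensOnLax F x s) (tensOnLax F x t) := by
  induction s generalizing t with
  | nil =>
    exact sq_eqToHom x (List.nil_perm.1 h).symm (by rw [List.nil_perm.1 h])
      (by rw [List.nil_perm.1 h])
  | cons a s ih => exact ((Sq.id (x a)).tensor (ih _ _)).comp (sq_tensOnPull x a t _).symm

lemma sq_tensOnZip {Y : ι → C} {Y' : ι → C'} (y : ∀ i, Y i ⟶ F.obj (Y' i)) (s : List ι) :
    Sq F (tensOnZip X Y s) (tensOnZip X' Y' s)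
      (tensorLax F (tensOnLax F x s) (tensOnLax F y s))
      (tensOnLax F (fun i => tensorLax F (x i) (y i)) s) := by
  induction s with
  | nil => exact Sq.leftUnitor (Functor.LaxMonoidal.ε F)
  | cons a s ih => exact (Sq.tensorμ _ _ _ _).comp ((Sq.id (tensorLax F (x a) (y a))).tensor ih)

lemma sq_tensPerm {n : ℕ} {X : Fin n → C} {X' : Fin n → C'} (x : ∀ i, X i ⟶ F.obj (X' i))
    (σ : Equiv.Perm (Fin n)) :
    Sq F (tensPerm X σ).hom (tensPerm X' σ).hom (tensLax F (fun i => x (σ i))) (tensLax F x) :=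
  (sq_tensOnMapList x σ _).comp (sq_tensOnReorder x _ _ _)

lemma sq_tensGroup {l M : ℕ} {m : Fin l → ℕ} (e : (Σ i : Fin l, Fin (m i)) ≃ Fin M)
    {Z : Fin M → C} {Z' : Fin M → C'} (z : ∀ i, Z i ⟶ F.obj (Z' i)) :
    Sq F (tensGroup e Z).hom (tensGroup e Z').hom (tensLax F z)
      (tensLax F fun i => tensLax F fun j => z (e ⟨i, j⟩)) :=
  (sq_tensOnReorder z _ _ _).comp ((sq_tensOnFlatMap z _ _).comp
    (sq_tensOnIso _ (fun _ => (sq_tensOnMapList z _ _).symm) _))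

/-- This square handles the symmetry in the associativity axioms of operads and of algebras. -/
lemma sq_tensShuffle {l M : ℕ} {m : Fin l → ℕ} (e : (Σ i : Fin l, Fin (m i)) ≃ Fin M)
    {A : C} {A' : C'} (a : A ⟶ F.obj A') {X : Fin l → C} {X' : Fin l → C'}
    (x : ∀ i, X i ⟶ F.obj (X' i)) {Z : Fin M → C} {Z' : Fin M → C'}
    (z : ∀ i, Z i ⟶ F.obj (Z' i)) :
    Sq F (tensShuffle e A X Z) (tensShuffle e A' X' Z')
      (tensorLax F (tensorLax F a (tensLax F x)) (tensLax F z))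
      (tensorLax F a (tensLax F fun i => tensorLax F (x i) (tensLax F fun j => z (e ⟨i, j⟩)))) :=
  (Sq.associator _ _ _).comp
    (((sq_tensGroup e z).whiskerLeft (tensLax F x)).comp (sq_tensOnZip x _ _) |>.whiskerLeft a)

end IteratedBraided

/-! ### Composition of lax monoidal functors, monoidal transformations -/

section Comp

variable {ι : Type*} {X : ι → C} {X' : ι → C'}

lemma tensOnLax_id {Y : ι → C} (f : ∀ i, X i ⟶ Y i) (s : List ι) :
    tensOnLax (𝟭 C) f s = tensOnMap f s := by
  induction s with
  | nil => rfl
  | cons a s ih =>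
    simp only [tensOnLax, ih, Functor.LaxMonoidal.id_μ]
    exact Category.comp_id _

lemma tensorLax_id {X Y X' Y' : C} (x : X ⟶ X') (y : Y ⟶ Y') :
    tensorLax (𝟭 C) x y = x ⊗ₘ y :=
  Category.comp_id _

/-- The Künneth morphism of `G ⋙ F` is that of `F` followed by the image of that of `G`; naturality
of the former moves `x'` and `y'` across it. -/
lemma tensorLax_comp {C'' : Type u''} [Category.{v''} C''] [MonoidalCategory C'']
    (F : C' ⥤ C) [F.LaxMonoidal] (G : C'' ⥤ C') [G.LaxMonoidal] {X Y : C} {X' Y' : C'}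
    {X'' Y'' : C''} (x : X ⟶ F.obj X') (y : Y ⟶ F.obj Y') (x' : X' ⟶ G.obj X'')
    (y' : Y' ⟶ G.obj Y'') :
    tensorLax (G ⋙ F) (x ≫ F.map x') (y ≫ F.map y') =
      tensorLax F x y ≫ F.map (tensorLax G x' y') := by
  simp only [tensorLax, Functor.LaxMonoidal.comp_μ, Functor.comp_obj, Functor.map_comp,
    Category.assoc]
  rw [← tensorHom_comp_tensorHom_assoc, Functor.LaxMonoidal.μ_natural_assoc]

lemma tensOnLax_comp {C'' : Type u''} [Category.{v''} C''] [MonoidalCategory C'']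
    (F : C' ⥤ C) [F.LaxMonoidal] (G : C'' ⥤ C') [G.LaxMonoidal] {X'' : ι → C''}
    (x : ∀ i, X i ⟶ F.obj (X' i)) (x' : ∀ i, X' i ⟶ G.obj (X'' i)) (s : List ι) :
    tensOnLax (G ⋙ F) (fun i => x i ≫ F.map (x' i)) s =
      tensOnLax F x s ≫ F.map (tensOnLax G x' s) := by
  induction s with
  | nil => rfl
  | cons a s ih =>
    refine Eq.trans ?_ (tensorLax_comp F G (x a) (tensOnLax F x s) (x' a) (tensOnLax G x' s))
    rw [← ih]
    rfl

lemma tensorLax_natTrans {F G : C' ⥤ C} [F.LaxMonoidal] [G.LaxMonoidal] (τ : F ⟶ G)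
    [NatTrans.IsMonoidal τ] {X Y : C} {X' Y' : C'} (x : X ⟶ F.obj X') (y : Y ⟶ F.obj Y') :
    tensorLax F x y ≫ τ.app (X' ⊗ Y') =
      tensorLax G (x ≫ τ.app X') (y ≫ τ.app Y') := by
  simp only [tensorLax, Category.assoc, NatTrans.IsMonoidal.tensor]
  rw [tensorHom_comp_tensorHom_assoc]

/-- A monoidal transformation respects binary Künneth morphisms and units, hence iterated ones by
induction. It allows a lax morphism along `F` to be pushed to one along `G`. -/
lemma tensOnLax_natTrans {F G : C' ⥤ C} [F.LaxMonoidal] [G.LaxMonoidal] (τ : F ⟶ G)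
    [NatTrans.IsMonoidal τ] (x : ∀ i, X i ⟶ F.obj (X' i)) (s : List ι) :
    tensOnLax F x s ≫ τ.app (tensOn X' s) = tensOnLax G (fun i => x i ≫ τ.app (X' i)) s := by
  induction s with
  | nil => exact NatTrans.IsMonoidal.unit
  | cons a s ih =>
    refine (tensorLax_natTrans τ (x a) (tensOnLax F x s)).trans ?_
    rw [ih]
    rfl

lemma tensOnMap_tensOnLax (F : C' ⥤ C) [F.LaxMonoidal] {Y : ι → C} (f : ∀ i, X i ⟶ Y i)
    (x : ∀ i, Y i ⟶ F.obj (X' i)) (s : List ι) :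
    tensOnMap f s ≫ tensOnLax F x s = tensOnLax F (fun i => f i ≫ x i) s := by
  induction s with
  | nil => exact Category.id_comp _
  | cons a s ih =>
    change (f a ⊗ₘ tensOnMap f s) ≫ (x a ⊗ₘ tensOnLax F x s) ≫ _ = (_ ⊗ₘ _) ≫ _
    rw [← ih]
    exact tensorHom_comp_tensorHom_assoc _ _ _ _ _

lemma tensorHom_tensorLax (F : C' ⥤ C) [F.LaxMonoidal] {X Y Z W : C} {X' Y' : C'} (f : X ⟶ Z)
    (g : Y ⟶ W) (x : Z ⟶ F.obj X') (y : W ⟶ F.obj Y') :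
    (f ⊗ₘ g) ≫ tensorLax F x y = tensorLax F (f ≫ x) (g ≫ y) :=
  tensorHom_comp_tensorHom_assoc _ _ _ _ _

lemma tensLax_id {n : ℕ} {X Y : Fin n → C} (f : ∀ i, X i ⟶ Y i) :
    tensLax (𝟭 C) f = tensMap f :=
  tensOnLax_id _ _

lemma tensLax_comp {C'' : Type u''} [Category.{v''} C''] [MonoidalCategory C'']
    (F : C' ⥤ C) [F.LaxMonoidal] (G : C'' ⥤ C') [G.LaxMonoidal] {n : ℕ} {X : Fin n → C}
    {X' : Fin n → C'} {X'' : Fin n → C''} (x : ∀ i, X i ⟶ F.obj (X' i))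
    (x' : ∀ i, X' i ⟶ G.obj (X'' i)) :
    tensLax (G ⋙ F) (fun i => x i ≫ F.map (x' i)) = tensLax F x ≫ F.map (tensLax G x') :=
  tensOnLax_comp F G x x' _

lemma tensLax_natTrans {F G : C' ⥤ C} [F.LaxMonoidal] [G.LaxMonoidal] (τ : F ⟶ G)
    [NatTrans.IsMonoidal τ] {n : ℕ} {X : Fin n → C} {X' : Fin n → C'}
    (x : ∀ i, X i ⟶ F.obj (X' i)) :
    tensLax F x ≫ τ.app (tens X') = tensLax G (fun i => x i ≫ τ.app (X' i)) :=
  tensOnLax_natTrans τ x _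

lemma tensMap_tensLax (F : C' ⥤ C) [F.LaxMonoidal] {n : ℕ} {X Y : Fin n → C} {X' : Fin n → C'}
    (f : ∀ i, X i ⟶ Y i) (x : ∀ i, Y i ⟶ F.obj (X' i)) :
    tensMap f ≫ tensLax F x = tensLax F (fun i => f i ≫ x i) :=
  tensOnMap_tensOnLax F f x _

end Comp

end MonoidalSquares

end OperadDescent


namespace OperadDescent

/-! ### Raw operads and their axioms -/

section Raw

variable (C : Type u) [Category.{v} C] [MonoidalCategory C]
  {C' : Type u'} [Category.{v'} C'] [MonoidalCategory C']
  {C'' : Type u''} [Category.{v''} C''] [MonoidalCategory C'']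

/-- The structure morphisms of an operad, without the axioms. -/
structure PreOperad where
  obj : ℕ+ → C
  act {l : ℕ+} : Equiv.Perm (Fin l) → (obj l ⟶ obj l)
  comp (l : ℕ+) (m : Fin l → ℕ+) (n : ℕ+) (h : ∑ i, (m i : ℕ) = n) :
    obj l ⊗ tens (fun i => obj (m i)) ⟶ obj n
  unit : 𝟙_ C ⟶ obj 1

variable {C}

/-- The structure morphisms of an algebra over a (raw) operad with components `X`. -/
structure PreAlgebra (X : ℕ+ → C) where
  obj : C
  act (l : ℕ+) : X l ⊗ tens (fun _ : Fin l => obj) ⟶ obj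

/-- The morphisms `θ l : R(l) ⟶ F (O(l))` are compatible with the structure morphisms. -/
structure IsLaxHom (F : C' ⥤ C) [F.LaxMonoidal] (R : PreOperad C) (O : PreOperad C')
    (θ : ∀ l, R.obj l ⟶ F.obj (O.obj l)) : Prop where
  act {l : ℕ+} (σ : Equiv.Perm (Fin l)) : Sq F (R.act σ) (O.act σ) (θ l) (θ l)
  unit : Sq F R.unit O.unit (Functor.LaxMonoidal.ε F) (θ 1)
  comp (l : ℕ+) (m : Fin l → ℕ+) (n : ℕ+) (h : ∑ i, (m i : ℕ) = n) :
    Sq F (R.comp l m n h) (O.comp l m n h)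
      (tensorLax F (θ l) (tensLax F (fun i => θ (m i)))) (θ n)

/-- The morphism `θ' : A ⟶ F B` is compatible with the actions, relatively to the morphisms
`θ l : X l ⟶ F (Y l)`. -/
def IsLaxAlgHom (F : C' ⥤ C) [F.LaxMonoidal] {X : ℕ+ → C} {Y : ℕ+ → C'} (A : PreAlgebra X)
    (B : PreAlgebra Y) (θ : ∀ l, X l ⟶ F.obj (Y l)) (θ' : A.obj ⟶ F.obj B.obj) : Prop :=
  ∀ l : ℕ+, Sq F (A.act l) (B.act l) (tensorLax F (θ l) (tensLax F (fun _ => θ'))) θ'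

lemma IsLaxHom.trans {F : C' ⥤ C} [F.LaxMonoidal] {G : C'' ⥤ C'} [G.LaxMonoidal]
    {R : PreOperad C} {O : PreOperad C'} {Q : PreOperad C''}
    {θ : ∀ l, R.obj l ⟶ F.obj (O.obj l)} {φ : ∀ l, O.obj l ⟶ G.obj (Q.obj l)}
    (h : IsLaxHom F R O θ) (h' : IsLaxHom G O Q φ) :
    IsLaxHom (G ⋙ F) R Q (fun l => θ l ≫ F.map (φ l)) where
  act σ := (h.act σ).trans (h'.act σ)
  unit := h.unit.trans h'.unit
  comp l m n hn := by
    rw [tensLax_comp, tensorLax_comp]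
    exact (h.comp l m n hn).trans (h'.comp l m n hn)

lemma IsLaxAlgHom.trans {F : C' ⥤ C} [F.LaxMonoidal] {G : C'' ⥤ C'} [G.LaxMonoidal]
    {X : ℕ+ → C} {Y : ℕ+ → C'} {Z : ℕ+ → C''} {A : PreAlgebra X} {B : PreAlgebra Y}
    {D : PreAlgebra Z} {θ : ∀ l, X l ⟶ F.obj (Y l)} {φ : ∀ l, Y l ⟶ G.obj (Z l)}
    {θ' : A.obj ⟶ F.obj B.obj} {φ' : B.obj ⟶ G.obj D.obj}
    (h : IsLaxAlgHom F A B θ θ') (h' : IsLaxAlgHom G B D φ φ') :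
    IsLaxAlgHom (G ⋙ F) A D (fun l => θ l ≫ F.map (φ l)) (θ' ≫ F.map φ') := fun l => by
  rw [tensLax_comp, tensorLax_comp]
  exact (h l).trans (h' l)

/-- Applied to `μ` and `λ`, this is the only way in which their monoidality enters. -/
lemma IsLaxHom.natTrans {F G : C' ⥤ C} [F.LaxMonoidal] [G.LaxMonoidal] {R : PreOperad C}
    {O : PreOperad C'} {θ : ∀ l, R.obj l ⟶ F.obj (O.obj l)} (h : IsLaxHom F R O θ) (τ : F ⟶ G)
    [NatTrans.IsMonoidal τ] : IsLaxHom G R O (fun l => θ l ≫ τ.app (O.obj l)) where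
  act σ := (h.act σ).natTrans τ
  unit := by
    rw [← NatTrans.IsMonoidal.unit (τ := τ)]
    exact h.unit.natTrans τ
  comp l m n hn := by
    rw [← tensLax_natTrans, ← tensorLax_natTrans]
    exact (h.comp l m n hn).natTrans τ

lemma IsLaxAlgHom.natTrans {F G : C' ⥤ C} [F.LaxMonoidal] [G.LaxMonoidal] {X : ℕ+ → C}
    {Y : ℕ+ → C'} {A : PreAlgebra X} {B : PreAlgebra Y} {θ : ∀ l, X l ⟶ F.obj (Y l)}
    {θ' : A.obj ⟶ F.obj B.obj} (h : IsLaxAlgHom F A B θ θ') (τ : F ⟶ G)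
    [NatTrans.IsMonoidal τ] :
    IsLaxAlgHom G A B (fun l => θ l ≫ τ.app (Y l)) (θ' ≫ τ.app B.obj) := fun l => by
  rw [← tensLax_natTrans, ← tensorLax_natTrans]
  exact (h l).natTrans τ

/-- A family of morphisms is a morphism of raw operads if its composites with jointly monomorphic
lax morphisms are lax morphisms. -/
lemma IsLaxHom.cancel {κ : Type*} {F : C' ⥤ C} [F.LaxMonoidal] {R Q : PreOperad C}
    {O : κ → PreOperad C'} {θ : ∀ k l, R.obj l ⟶ F.obj ((O k).obj l)}
    {φ : ∀ k l, Q.obj l ⟶ F.obj ((O k).obj l)}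
    (hφ : ∀ (l : ℕ+) (V : C) (a b : V ⟶ Q.obj l), (∀ k, a ≫ φ k l = b ≫ φ k l) → a = b)
    (h : ∀ k, IsLaxHom F R (O k) (θ k)) (h' : ∀ k, IsLaxHom F Q (O k) (φ k))
    (f : ∀ l, R.obj l ⟶ Q.obj l) (hf : ∀ k l, f l ≫ φ k l = θ k l) : IsLaxHom (𝟭 C) R Q f where
  act σ := Sq.cancel (hφ _) (fun k => (h k).act σ) (fun k => (h' k).act σ)
    (fun k => hf k _) (fun k => hf k _)
  unit := Sq.cancel (hφ 1) (fun k => (h k).unit) (fun k => (h' k).unit)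
    (fun _ => Category.id_comp _) (fun k => hf k _)
  comp l m n hn := Sq.cancel (hφ n) (fun k => (h k).comp l m n hn) (fun k => (h' k).comp l m n hn)
    (fun k => by
      rw [tensorLax_id, tensLax_id, tensorHom_tensorLax, tensMap_tensLax]
      simp only [hf])
    (fun k => hf k _)

lemma IsLaxAlgHom.cancel {κ : Type*} {F : C' ⥤ C} [F.LaxMonoidal] {X Y : ℕ+ → C}
    {Z : κ → ℕ+ → C'} {A : PreAlgebra X} {B : PreAlgebra Y} {D : ∀ k, PreAlgebra (Z k)}
    {θ : ∀ k l, X l ⟶ F.obj (Z k l)} {φ : ∀ k l, Y l ⟶ F.obj (Z k l)}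
    {θ' : ∀ k, A.obj ⟶ F.obj (D k).obj} {φ' : ∀ k, B.obj ⟶ F.obj (D k).obj}
    (hφ : ∀ (V : C) (a b : V ⟶ B.obj), (∀ k, a ≫ φ' k = b ≫ φ' k) → a = b)
    (h : ∀ k, IsLaxAlgHom F A (D k) (θ k) (θ' k)) (h' : ∀ k, IsLaxAlgHom F B (D k) (φ k) (φ' k))
    (f : ∀ l, X l ⟶ Y l) (f' : A.obj ⟶ B.obj) (hf : ∀ k l, f l ≫ φ k l = θ k l)
    (hf' : ∀ k, f' ≫ φ' k = θ' k) : IsLaxAlgHom (𝟭 C) A B f f' := fun l =>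
  Sq.cancel hφ (fun k => h k l) (fun k => h' k l)
    (fun k => by
      rw [tensorLax_id, tensLax_id, tensorHom_tensorLax, tensMap_tensLax]
      simp only [hf, hf'])
    hf'

/-- The axioms of operads. -/
inductive OperadAxiom : Type
  | act_one (l : ℕ+)
  | act_mul {l : ℕ+} (σ τ : Equiv.Perm (Fin l))
  | comp_act (l : ℕ+) (m : Fin l → ℕ+) (n : ℕ+) (σ : Equiv.Perm (Fin l))
    (h : ∑ i, (m i : ℕ) = n) (h' : ∑ i, (m (σ i) : ℕ) = n)
  | act_comp (l : ℕ+) (m : Fin l → ℕ+) (n : ℕ+) (h : ∑ i, (m i : ℕ) = n)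
    (τ : ∀ i, Equiv.Perm (Fin (m i)))
  | unit_comp (n : ℕ+) (h : ∑ _i : Fin (1 : ℕ+), (n : ℕ) = n)
  | comp_unit (l : ℕ+) (h : ∑ _i : Fin l, ((1 : ℕ+) : ℕ) = l)
  | assoc (l : ℕ+) (m : Fin l → ℕ+) (M : ℕ+) (hM : ∑ i, (m i : ℕ) = M)
    (n : Fin M → ℕ+) (N : ℕ+) (hN : ∑ k, (n k : ℕ) = N)
    (N' : Fin l → ℕ+) (hN' : ∀ i, ∑ j, (n (blocks m hM ⟨i, j⟩) : ℕ) = N' i)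
    (h : ∑ i, (N' i : ℕ) = N)

namespace OperadAxiom

/-- The source of the two morphisms which the axiom identifies. -/
def dom (X : ℕ+ → C) : OperadAxiom → C
  | act_one l => X l
  | act_mul (l := l) _ _ => X l
  | comp_act l m _ σ _ _ => X l ⊗ tens (fun i => X (m (σ i)))
  | act_comp l m _ _ _ => X l ⊗ tens (fun i => X (m i))
  | unit_comp n _ => 𝟙_ C ⊗ tens (fun _ : Fin 1 => X n)
  | comp_unit l _ => X l ⊗ 𝟙_ C
  | assoc l m _ _ n _ _ _ _ _ => (X l ⊗ tens (fun i => X (m i))) ⊗ tens (fun k => X (n k))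

/-- The arity of the target of the two morphisms which the axiom identifies. -/
def cod : OperadAxiom → ℕ+
  | act_one l => l
  | act_mul (l := l) _ _ => l
  | comp_act _ _ n _ _ _ => n
  | act_comp _ _ n _ _ => n
  | unit_comp n _ => n
  | comp_unit l _ => l
  | assoc _ _ _ _ _ N _ _ _ _ => N

/-- The morphism `dom X e ⟶ F (dom Y e)` induced by morphisms `X l ⟶ F (Y l)`. -/
def domLax (F : C' ⥤ C) [F.LaxMonoidal] {X : ℕ+ → C} {Y : ℕ+ → C'}
    (θ : ∀ l, X l ⟶ F.obj (Y l)) : (e : OperadAxiom) → (dom X e ⟶ F.obj (dom Y e))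
  | act_one l => θ l
  | act_mul (l := l) _ _ => θ l
  | comp_act l m _ σ _ _ => tensorLax F (θ l) (tensLax F (fun i => θ (m (σ i))))
  | act_comp l m _ _ _ => tensorLax F (θ l) (tensLax F (fun i => θ (m i)))
  | unit_comp n _ => tensorLax F (Functor.LaxMonoidal.ε F) (tensLax F (fun _ : Fin 1 => θ n))
  | comp_unit l _ => tensorLax F (θ l) (Functor.LaxMonoidal.ε F)
  | assoc l m _ _ n _ _ _ _ _ =>
    tensorLax F (tensorLax F (θ l) (tensLax F (fun i => θ (m i))))
      (tensLax F (fun k => θ (n k)))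

variable [SymmetricCategory C] [SymmetricCategory C']

/-- The left-hand side of the axiom. -/
def lhs (R : PreOperad C) : (e : OperadAxiom) → (dom R.obj e ⟶ R.obj (cod e))
  | act_one l => R.act (1 : Equiv.Perm (Fin l))
  | act_mul σ τ => R.act (σ * τ)
  | comp_act l m n σ _ h' =>
    (R.act σ ▷ tens (fun i => R.obj (m (σ i)))) ≫ R.comp l (fun i => m (σ i)) n h'
  | act_comp l m n h τ => (R.obj l ◁ tensMap (fun i => R.act (τ i))) ≫ R.comp l m n h
  | unit_comp n h => (R.unit ▷ tens (fun _ : Fin 1 => R.obj n)) ≫ R.comp 1 (fun _ => n) n h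
  | comp_unit l h =>
    (R.obj l ◁ tensOnUnits (fun _ => R.unit) (List.finRange l)) ≫ R.comp l (fun _ => 1) l h
  | assoc l m M hM n N hN _ _ _ => (R.comp l m M hM ▷ tens (fun k => R.obj (n k))) ≫ R.comp M n N hN

/-- The right-hand side of the axiom. -/
def rhs (R : PreOperad C) : (e : OperadAxiom) → (dom R.obj e ⟶ R.obj (cod e))
  | act_one l => 𝟙 (R.obj l)
  | act_mul σ τ => R.act σ ≫ R.act τ
  | comp_act l m n σ h h' =>
    (R.obj l ◁ (tensPerm (fun i => R.obj (m i)) σ).hom) ≫ R.comp l m n h ≫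
      R.act (blockPerm m σ h h')
  | act_comp l m n h τ => R.comp l m n h ≫ R.act (sumPerm m h τ)
  | unit_comp n _ =>
    (λ_ (tens (fun _ : Fin 1 => R.obj n))).hom ≫ (tensOne (fun _ => R.obj n)).hom
  | comp_unit l _ => (ρ_ (R.obj l)).hom
  | assoc l m _ hM n N _ N' hN' h =>
    tensShuffle (blocks m hM) (R.obj l) (fun i => R.obj (m i)) (fun k => R.obj (n k)) ≫
      (R.obj l ◁ tensMap (fun i =>
        R.comp (m i) (fun j => n (blocks m hM ⟨i, j⟩)) (N' i) (hN' i))) ≫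
      R.comp l N' N h

variable {F : C' ⥤ C} [F.LaxBraided] {R : PreOperad C} {O : PreOperad C'}
  {θ : ∀ l, R.obj l ⟶ F.obj (O.obj l)}

/-- Each side of an axiom is a composite of structure morphisms, whose squares are given by `h`, and
of structural morphisms, whose squares were established for any such `F`. The comparison morphisms
at the ends depend only on the axiom, so this square can be compared with `sq_rhs`. -/
lemma sq_lhs (h : IsLaxHom F R O θ) (e : OperadAxiom) :
    Sq F (lhs R e) (lhs O e) (domLax F θ e) (θ (cod e)) :=
  match e with
  | act_one _ => h.act _
  | act_mul _ _ => h.act _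
  | comp_act _ _ _ σ _ _ => ((h.act σ).whiskerRight _).comp (h.comp _ _ _ _)
  | act_comp _ _ _ _ τ =>
    ((sq_tensOnMap _ (fun i => h.act (τ i)) _).whiskerLeft _).comp (h.comp _ _ _ _)
  | unit_comp _ _ => (h.unit.whiskerRight _).comp (h.comp _ _ _ _)
  | comp_unit _ _ => ((sq_tensOnUnits _ (fun _ => h.unit) _).whiskerLeft _).comp (h.comp _ _ _ _)
  | assoc _ _ _ _ _ _ _ _ _ _ => ((h.comp _ _ _ _).whiskerRight _).comp (h.comp _ _ _ _)

lemma sq_rhs (h : IsLaxHom F R O θ) (e : OperadAxiom) :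
    Sq F (rhs R e) (rhs O e) (domLax F θ e) (θ (cod e)) :=
  match e with
  | act_one _ => Sq.id _
  | act_mul _ _ => (h.act _).comp (h.act _)
  | comp_act _ m _ σ _ _ =>
    ((sq_tensPerm (fun i => θ (m i)) σ).whiskerLeft _).comp ((h.comp _ _ _ _).comp (h.act _))
  | act_comp _ _ _ _ _ => (h.comp _ _ _ _).comp (h.act _)
  | unit_comp n _ => (Sq.leftUnitor _).comp (sq_tensOne (fun _ => θ n))
  | comp_unit _ _ => Sq.rightUnitor _
  | assoc _ m _ hM n _ _ _ _ _ =>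
    (sq_tensShuffle (blocks m hM) _ (fun i => θ (m i)) (fun k => θ (n k))).comp
      (((sq_tensOnMap _ (fun _ => h.comp _ _ _ _) _).whiskerLeft _).comp (h.comp _ _ _ _))

end OperadAxiom

/-- The axioms of algebras over an operad. -/
inductive AlgebraAxiom : Type
  | equivariant {l : ℕ+} (σ : Equiv.Perm (Fin l))
  | unit_act
  | assoc (l : ℕ+) (m : Fin l → ℕ+) (M : ℕ+) (hM : ∑ i, (m i : ℕ) = M)

namespace AlgebraAxiom

/-- The source of the two morphisms which the axiom identifies. -/
def dom (X : ℕ+ → C) (A : C) : AlgebraAxiom → C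
  | equivariant (l := l) _ => X l ⊗ tens (fun _ : Fin l => A)
  | unit_act => 𝟙_ C ⊗ tens (fun _ : Fin 1 => A)
  | assoc l m M _ => (X l ⊗ tens (fun i => X (m i))) ⊗ tens (fun _ : Fin M => A)

/-- The morphism `dom X A e ⟶ F (dom Y B e)` induced by morphisms `X l ⟶ F (Y l)` and
`A ⟶ F B`. -/
def domLax (F : C' ⥤ C) [F.LaxMonoidal] {X : ℕ+ → C} {Y : ℕ+ → C'} {A : C} {B : C'}
    (θ : ∀ l, X l ⟶ F.obj (Y l)) (θ' : A ⟶ F.obj B) :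
    (e : AlgebraAxiom) → (dom X A e ⟶ F.obj (dom Y B e))
  | equivariant (l := l) _ => tensorLax F (θ l) (tensLax F (fun _ : Fin l => θ'))
  | unit_act => tensorLax F (Functor.LaxMonoidal.ε F) (tensLax F (fun _ : Fin 1 => θ'))
  | assoc l m M _ =>
    tensorLax F (tensorLax F (θ l) (tensLax F (fun i => θ (m i))))
      (tensLax F (fun _ : Fin M => θ'))

variable [SymmetricCategory C] [SymmetricCategory C']

/-- The left-hand side of the axiom. -/
def lhs (R : PreOperad C) (A : PreAlgebra R.obj) :
    (e : AlgebraAxiom) → (dom R.obj A.obj e ⟶ A.obj)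
  | equivariant (l := l) σ => (R.act σ ▷ tens (fun _ : Fin l => A.obj)) ≫ A.act l
  | unit_act => (R.unit ▷ tens (fun _ : Fin 1 => A.obj)) ≫ A.act 1
  | assoc l m M hM => (R.comp l m M hM ▷ tens (fun _ : Fin M => A.obj)) ≫ A.act M

/-- The right-hand side of the axiom. -/
def rhs (R : PreOperad C) (A : PreAlgebra R.obj) :
    (e : AlgebraAxiom) → (dom R.obj A.obj e ⟶ A.obj)
  | equivariant (l := l) σ =>
    (R.obj l ◁ (tensPerm (fun _ : Fin l => A.obj) σ).hom) ≫ A.act l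
  | unit_act => (λ_ (tens (fun _ : Fin 1 => A.obj))).hom ≫ (tensOne (fun _ => A.obj)).hom
  | assoc l m _ hM =>
    tensShuffle (blocks m hM) (R.obj l) (fun i => R.obj (m i)) (fun _ => A.obj) ≫
      (R.obj l ◁ tensMap (fun i => A.act (m i))) ≫ A.act l

variable {F : C' ⥤ C} [F.LaxBraided] {R : PreOperad C} {O : PreOperad C'}
  {θ : ∀ l, R.obj l ⟶ F.obj (O.obj l)} {A : PreAlgebra R.obj} {B : PreAlgebra O.obj}
  {θ' : A.obj ⟶ F.obj B.obj}

lemma sq_lhs (h : IsLaxHom F R O θ) (h' : IsLaxAlgHom F A B θ θ') (e : AlgebraAxiom) :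
    Sq F (lhs R A e) (lhs O B e) (domLax F θ θ' e) θ' :=
  match e with
  | equivariant σ => ((h.act σ).whiskerRight _).comp (h' _)
  | unit_act => (h.unit.whiskerRight _).comp (h' _)
  | assoc _ _ _ _ => ((h.comp _ _ _ _).whiskerRight _).comp (h' _)

lemma sq_rhs (h' : IsLaxAlgHom F A B θ θ') (e : AlgebraAxiom) :
    Sq F (rhs R A e) (rhs O B e) (domLax F θ θ' e) θ' :=
  match e with
  | equivariant σ => ((sq_tensPerm (fun _ => θ') σ).whiskerLeft _).comp (h' _)
  | unit_act => (Sq.leftUnitor _).comp (sq_tensOne (fun _ => θ'))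
  | assoc _ m _ hM =>
    (sq_tensShuffle (blocks m hM) _ (fun i => θ (m i)) (fun _ => θ')).comp
      (((sq_tensOnMap _ (fun _ => h' _) _).whiskerLeft _).comp (h' _))

end AlgebraAxiom

section Morphisms

/-- Along the identity functor, lax morphisms are ordinary morphisms of operads, because the Künneth
and unit morphisms are identities. -/
lemma isLaxHom_id_iff {R Q : PreOperad C} (f : ∀ l, R.obj l ⟶ Q.obj l) :
    IsLaxHom (𝟭 C) R Q f ↔
      (∀ {l : ℕ+} (σ : Equiv.Perm (Fin l)), R.act σ ≫ f l = f l ≫ Q.act σ) ∧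
      (∀ (l : ℕ+) (m : Fin l → ℕ+) (n : ℕ+) (h : ∑ i, (m i : ℕ) = n),
        R.comp l m n h ≫ f n = (f l ⊗ₘ tensMap (fun i => f (m i))) ≫ Q.comp l m n h) ∧
      R.unit ≫ f 1 = Q.unit := by
  have key (l : ℕ+) (m : Fin l → ℕ+) :
      tensorLax (𝟭 C) (f l) (tensLax (𝟭 C) (fun i => f (m i))) =
        (f l ⊗ₘ tensMap (fun i => f (m i))) := by
    rw [tensorLax_id, tensLax_id]
  have hε : Functor.LaxMonoidal.ε (𝟭 C) ≫ Q.unit = Q.unit := Category.id_comp _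
  constructor
  · intro h
    refine ⟨fun σ => h.act σ, fun l m n hn => ?_, Eq.trans h.unit hε⟩
    have e := h.comp l m n hn
    rw [key] at e
    exact e
  · rintro ⟨h, h', h''⟩
    refine ⟨fun σ => h σ, Eq.trans h'' hε.symm, fun l m n hn => ?_⟩
    rw [key]
    exact h' l m n hn

lemma isLaxAlgHom_id_iff {X Y : ℕ+ → C} {A : PreAlgebra X} {B : PreAlgebra Y}
    (f : ∀ l, X l ⟶ Y l) (f' : A.obj ⟶ B.obj) :
    IsLaxAlgHom (𝟭 C) A B f f' ↔
      ∀ l, A.act l ≫ f' = (f l ⊗ₘ tensMap (fun _ => f')) ≫ B.act l := by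
  refine forall_congr' fun l => ?_
  rw [tensorLax_id, tensLax_id]
  rfl

end Morphisms

/-! ### Tensor-stable classes of jointly epimorphic families. -/

section EpiClass

variable {κ : Type*}

/-- A class, stable by tensor products, of families of morphisms `X k ⟶ F k Y` which are jointly
epimorphic. -/
structure EpiClass (F : κ → C' ⥤ C) [∀ k, (F k).LaxMonoidal] where
  mem {X : κ → C} {Y : C'} (x : ∀ k, X k ⟶ (F k).obj Y) : Prop
  unit : mem (fun k => Functor.LaxMonoidal.ε (F k))
  tensor {X X' : κ → C} {Y Y' : C'} {x : ∀ k, X k ⟶ (F k).obj Y} {x' : ∀ k, X' k ⟶ (F k).obj Y'} :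
    mem x → mem x' → mem (fun k => tensorLax (F k) (x k) (x' k))
  ext {X : κ → C} {Y : C'} {x : ∀ k, X k ⟶ (F k).obj Y} : mem x → ∀ {Z : C'} (f g : Y ⟶ Z),
    (∀ k, x k ≫ (F k).map f = x k ≫ (F k).map g) → f = g

namespace EpiClass

variable {F : κ → C' ⥤ C} [∀ k, (F k).LaxMonoidal] (S : EpiClass F)

lemma tensOn {ι : Type*} {X : κ → ι → C} {Y : ι → C'} {x : ∀ k i, X k i ⟶ (F k).obj (Y i)}
    (h : ∀ i, S.mem (fun k => x k i)) (s : List ι) :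
    S.mem (fun k => tensOnLax (F k) (x k) s) := by
  induction s with
  | nil => exact S.unit
  | cons a s ih => exact S.tensor (h a) ih

/-- The source of every axiom is an iterated tensor product of components and units, so stability
under tensor products suffices. -/
lemma operadDomLax {X : κ → ℕ+ → C} {Y : ℕ+ → C'} {x : ∀ k i, X k i ⟶ (F k).obj (Y i)}
    (h : ∀ i, S.mem (fun k => x k i)) (e : OperadAxiom) :
    S.mem (fun k => OperadAxiom.domLax (F k) (x k) e) :=
  match e with
  | .act_one _ => h _
  | .act_mul _ _ => h _
  | .comp_act _ _ _ _ _ _ => S.tensor (h _) (S.tensOn (fun _ => h _) _)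
  | .act_comp _ _ _ _ _ => S.tensor (h _) (S.tensOn (fun _ => h _) _)
  | .unit_comp _ _ => S.tensor S.unit (S.tensOn (fun _ => h _) _)
  | .comp_unit _ _ => S.tensor (h _) S.unit
  | .assoc _ _ _ _ _ _ _ _ _ _ =>
    S.tensor (S.tensor (h _) (S.tensOn (fun _ => h _) _)) (S.tensOn (fun _ => h _) _)

lemma algebraDomLax {X : κ → ℕ+ → C} {Y : ℕ+ → C'} {x : ∀ k i, X k i ⟶ (F k).obj (Y i)}
    {A : κ → C} {B : C'} {a : ∀ k, A k ⟶ (F k).obj B}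
    (h : ∀ i, S.mem (fun k => x k i)) (h' : S.mem a) (e : AlgebraAxiom) :
    S.mem (fun k => AlgebraAxiom.domLax (F k) (x k) (a k) e) :=
  match e with
  | .equivariant _ => S.tensor (h _) (S.tensOn (fun _ => h') _)
  | .unit_act => S.tensor S.unit (S.tensOn (fun _ => h') _)
  | .assoc _ _ _ _ =>
    S.tensor (S.tensor (h _) (S.tensOn (fun _ => h _) _)) (S.tensOn (fun _ => h') _)

end EpiClass

end EpiClass

variable [SymmetricCategory C] [SymmetricCategory C']

/-- A raw operad satisfies the axioms of operads. -/
def PreOperad.IsOperad (R : PreOperad C) : Prop :=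
  ∀ e : OperadAxiom, e.lhs R = e.rhs R

/-- A raw algebra satisfies the axioms of algebras. -/
def PreAlgebra.IsAlgebra (R : PreOperad C) (A : PreAlgebra R.obj) : Prop :=
  ∀ e : AlgebraAxiom, e.lhs R A = e.rhs R A

/-- The operad given by a raw operad which satisfies the axioms. -/
def PreOperad.toOperad (R : PreOperad C) (h : R.IsOperad) : Operad C where
  obj := R.obj
  act := R.act
  comp := R.comp
  unit := R.unit
  act_one l := h (.act_one l)
  act_mul σ τ := h (.act_mul σ τ)
  comp_act l m n σ hn hn' := h (.comp_act l m n σ hn hn')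
  act_comp l m n hn τ := h (.act_comp l m n hn τ)
  unit_comp n hn := h (.unit_comp n hn)
  comp_unit l hl := h (.comp_unit l hl)
  assoc l m M hM n N hN N' hN' hN'' := h (.assoc l m M hM n N hN N' hN' hN'')

/-- The structure morphisms of an operad. -/
def Operad.toPre (P : Operad C) : PreOperad C where
  obj := P.obj
  act := P.act
  comp := P.comp
  unit := P.unit

lemma Operad.isOperad (P : Operad C) : P.toPre.IsOperad
  | .act_one l => P.act_one l
  | .act_mul σ τ => P.act_mul σ τ
  | .comp_act l m n σ hn hn' => P.comp_act l m n σ hn hn'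
  | .act_comp l m n hn τ => P.act_comp l m n hn τ
  | .unit_comp n hn => P.unit_comp n hn
  | .comp_unit l hl => P.comp_unit l hl
  | .assoc l m M hM n N hN N' hN' hN'' => P.assoc l m M hM n N hN N' hN' hN''

/-- The algebra given by a raw algebra which satisfies the axioms. -/
def PreAlgebra.toAlgebra (P : Operad C) (A : PreAlgebra P.obj)
    (h : PreAlgebra.IsAlgebra P.toPre A) : P.Algebra where
  obj := A.obj
  act := A.act
  equivariant σ := h (.equivariant σ)
  unit_act := h .unit_act
  assoc l m M hM := h (.assoc l m M hM)

/-- The structure morphisms of an algebra. -/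
def Operad.Algebra.toPre {P : Operad C} (A : P.Algebra) : PreAlgebra P.obj where
  obj := A.obj
  act := A.act

lemma Operad.Algebra.isAlgebra {P : Operad C} (A : P.Algebra) :
    PreAlgebra.IsAlgebra P.toPre A.toPre
  | .equivariant σ => A.equivariant σ
  | .unit_act => A.unit_act
  | .assoc l m M hM => A.assoc l m M hM

/-! ### Transfer of the axioms along lax morphisms. -/

section Transfer

variable {κ : Type*}

/-- Jointly monomorphic families of lax morphisms to operads detect operads. -/
lemma PreOperad.IsOperad.of_mono {F : C' ⥤ C} [F.LaxBraided] {R : PreOperad C}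
    {O : κ → PreOperad C'} {θ : ∀ k l, R.obj l ⟶ F.obj ((O k).obj l)}
    (h : ∀ k, IsLaxHom F R (O k) (θ k)) (hO : ∀ k, (O k).IsOperad)
    (hθ : ∀ (l : ℕ+) (Z : C) (f g : Z ⟶ R.obj l), (∀ k, f ≫ θ k l = g ≫ θ k l) → f = g) :
    R.IsOperad := fun e =>
  -- After composition with `θ k`, both sides of the axiom for `R` become images under `F` of the
  -- two sides for `O k`, which coincide.
  hθ _ _ _ _ fun k => (OperadAxiom.sq_lhs (h k) e).eq (by
    rw [hO k e]
    exact OperadAxiom.sq_rhs (h k) e)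

/-- Monomorphic families of lax morphisms to algebras detect algebras. -/
lemma PreAlgebra.IsAlgebra.of_mono {F : C' ⥤ C} [F.LaxBraided] {R : PreOperad C}
    {O : κ → PreOperad C'} {θ : ∀ k l, R.obj l ⟶ F.obj ((O k).obj l)}
    (h : ∀ k, IsLaxHom F R (O k) (θ k)) {A : PreAlgebra R.obj} {B : ∀ k, PreAlgebra (O k).obj}
    {θ' : ∀ k, A.obj ⟶ F.obj (B k).obj} (h' : ∀ k, IsLaxAlgHom F A (B k) (θ k) (θ' k))
    (hB : ∀ k, IsAlgebra (O k) (B k))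
    (hθ : ∀ (Z : C) (f g : Z ⟶ A.obj), (∀ k, f ≫ θ' k = g ≫ θ' k) → f = g) :
    IsAlgebra R A := fun e =>
  hθ _ _ _ fun k => (AlgebraAxiom.sq_lhs (h k) (h' k) e).eq (by
    rw [hB k e]
    exact AlgebraAxiom.sq_rhs (h' k) e)

namespace EpiClass

variable {F : κ → C' ⥤ C} [∀ k, (F k).LaxBraided] (S : EpiClass F)

/-- Dually to the monic case, the two sides for `O` agree after precomposition with the family on
the source of the axiom. That family is a tensor product of the `θ`, which explains why joint
epimorphy alone is not enough and a tensor-stable class is required. -/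
lemma isOperad {R : κ → PreOperad C} {O : PreOperad C'}
    {θ : ∀ k l, (R k).obj l ⟶ (F k).obj (O.obj l)} (h : ∀ k, IsLaxHom (F k) (R k) O (θ k))
    (hR : ∀ k, (R k).IsOperad) (hθ : ∀ l, S.mem (fun k => θ k l)) : O.IsOperad := fun e =>
  S.ext (S.operadDomLax hθ e) _ _ fun k => by
    rw [← OperadAxiom.sq_lhs (h k) e, ← OperadAxiom.sq_rhs (h k) e, hR k e]

lemma isAlgebra {R : κ → PreOperad C} {O : PreOperad C'}
    {θ : ∀ k l, (R k).obj l ⟶ (F k).obj (O.obj l)} (h : ∀ k, IsLaxHom (F k) (R k) O (θ k))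
    {A : ∀ k, PreAlgebra (R k).obj} {B : PreAlgebra O.obj} {θ' : ∀ k, (A k).obj ⟶ (F k).obj B.obj}
    (h' : ∀ k, IsLaxAlgHom (F k) (A k) B (θ k) (θ' k))
    (hA : ∀ k, PreAlgebra.IsAlgebra (R k) (A k))
    (hθ : ∀ l, S.mem (fun k => θ k l)) (hθ' : S.mem θ') :
    PreAlgebra.IsAlgebra O B := fun e =>
  S.ext (S.algebraDomLax hθ hθ' e) _ _ fun k => by
    rw [← AlgebraAxiom.sq_lhs (h k) (h' k) e, ← AlgebraAxiom.sq_rhs (h' k) e, hA k e]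

end EpiClass

end Transfer

/-- A morphism of operads from a morphism of raw operads. -/
def Operad.Hom.ofLax {P Q : Operad C} (f : ∀ l, P.obj l ⟶ Q.obj l)
    (h : IsLaxHom (𝟭 C) P.toPre Q.toPre f) : P ⟶ Q where
  app := f
  act_app := ((isLaxHom_id_iff _).1 h).1
  comp_app := ((isLaxHom_id_iff _).1 h).2.1
  unit_app := ((isLaxHom_id_iff _).1 h).2.2

lemma Operad.Hom.isLaxHom {P Q : Operad C} (f : P ⟶ Q) :
    IsLaxHom (𝟭 C) P.toPre Q.toPre f.app :=
  (isLaxHom_id_iff _).2 ⟨f.act_app, f.comp_app, f.unit_app⟩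

end Raw

end OperadDescent


namespace OperadDescent

noncomputable section

/-! ### Images of operads by symmetric monoidal functors -/

section Image

variable {C : Type u} [Category.{v} C] [MonoidalCategory C]
  {C' : Type u'} [Category.{v'} C'] [MonoidalCategory C']
  {C'' : Type u''} [Category.{v''} C''] [MonoidalCategory C'']

/-- The image of a raw operad by a lax monoidal functor. -/
def PreOperad.map (O : PreOperad C') (F : C' ⥤ C) [F.LaxMonoidal] : PreOperad C where
  obj l := F.obj (O.obj l)
  act σ := F.map (O.act σ)
  comp l m n h :=
    tensorLax F (𝟙 (F.obj (O.obj l))) (tensLax F (fun i => 𝟙 (F.obj (O.obj (m i))))) ≫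
      F.map (O.comp l m n h)
  unit := Functor.LaxMonoidal.ε F ≫ F.map O.unit

lemma PreOperad.map_isLaxHom (O : PreOperad C') (F : C' ⥤ C) [F.LaxMonoidal] :
    IsLaxHom F (O.map F) O (fun l => 𝟙 (F.obj (O.obj l))) where
  act _ := (Category.comp_id _).trans (Category.id_comp _).symm
  unit := Category.comp_id _
  comp _ _ _ _ := Category.comp_id _

/-- The image of a raw algebra by a lax monoidal functor. -/
def PreAlgebra.map {X : ℕ+ → C'} (A : PreAlgebra X) (F : C' ⥤ C) [F.LaxMonoidal] :
    PreAlgebra (fun l => F.obj (X l)) where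
  obj := F.obj A.obj
  act l := tensorLax F (𝟙 (F.obj (X l))) (tensLax F (fun _ => 𝟙 (F.obj A.obj))) ≫ F.map (A.act l)

lemma PreAlgebra.map_isLaxAlgHom {X : ℕ+ → C'} (A : PreAlgebra X) (F : C' ⥤ C)
    [F.LaxMonoidal] :
    IsLaxAlgHom F (A.map F) A (fun l => 𝟙 (F.obj (X l))) (𝟙 (F.obj A.obj)) :=
  fun _ => Category.comp_id _

variable [SymmetricCategory C] [SymmetricCategory C'] [SymmetricCategory C'']

/-- The functor induced on operads by a symmetric monoidal functor. -/
def Operad.mapFunctor (F : C' ⥤ C) [F.LaxBraided] : Operad C' ⥤ Operad C where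
  -- The one-element family of identities is a jointly monic lax family from the image to `O`.
  obj O := (O.toPre.map F).toOperad (.of_mono (κ := Unit) (fun _ => O.toPre.map_isLaxHom F)
    (fun _ => O.isOperad) fun l Z f g h => (cancel_mono (𝟙 (F.obj (O.obj l)))).1 (h ()))
  map {O Q} f := Operad.Hom.ofLax (fun l => F.map (f.app l)) ((isLaxHom_id_iff _).2
    ⟨fun σ => (F.map_comp _ _).symm.trans
      ((congrArg F.map (f.act_app σ)).trans (F.map_comp _ _)),
    fun l m n h => by
      have h' := congrArg F.map (f.comp_app l m n h)
      -- Naturality of the iterated Künneth morphism with respect to the components of `f`.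
      have h'' := (Sq.map F (f.app l)).tensor
        (sq_tensOnMap _ (fun i => Sq.map F (f.app (m i))) (List.finRange l))
      simp only [Functor.map_comp] at h'
      change (tensorLax F _ _ ≫ F.map (O.comp l m n h)) ≫ F.map (f.app n) =
        _ ≫ tensorLax F _ _ ≫ F.map (Q.comp l m n h)
      rw [Category.assoc, h', ← Category.assoc]
      exact (congrArg (· ≫ F.map (Q.comp l m n h)) (Eq.symm h'')).trans (Category.assoc _ _ _),
    (Category.assoc _ _ _).trans
      (congrArg (_ ≫ ·) ((F.map_comp _ _).symm.trans (congrArg F.map f.unit_app)))⟩)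
  map_id O := Operad.Hom.ext (funext fun l => F.map_id _)
  map_comp f g := Operad.Hom.ext (funext fun l => F.map_comp _ _)

/-- A morphism of pairs of an operad and an algebra from a morphism of raw operads and algebras. -/
def OperadAlgebra.Hom.ofLax {P Q : OperadAlgebra C} (f : P.operad ⟶ Q.operad)
    (f' : P.algebra.obj ⟶ Q.algebra.obj)
    (h : IsLaxAlgHom (𝟭 C) P.algebra.toPre Q.algebra.toPre f.app f') : P ⟶ Q where
  operadHom := f
  hom := f'
  act_hom := (isLaxAlgHom_id_iff _ _).1 h

lemma OperadAlgebra.Hom.isLaxAlgHom {P Q : OperadAlgebra C} (f : P ⟶ Q) :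
    IsLaxAlgHom (𝟭 C) P.algebra.toPre Q.algebra.toPre f.operadHom.app f.hom :=
  (isLaxAlgHom_id_iff _ _).2 f.act_hom

/-- The functor induced on pairs of an operad and an algebra by a symmetric monoidal functor. -/
def OperadAlgebra.mapFunctor (F : C' ⥤ C) [F.LaxBraided] :
    OperadAlgebra C' ⥤ OperadAlgebra C where
  obj A :=
    { operad := (Operad.mapFunctor F).obj A.operad
      algebra := (A.algebra.toPre.map F).toAlgebra ((Operad.mapFunctor F).obj A.operad)
        (.of_mono (κ := Unit) (fun _ => A.operad.toPre.map_isLaxHom F)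
          (fun _ => A.algebra.toPre.map_isLaxAlgHom F) (fun _ => A.algebra.isAlgebra)
          fun Z f g h => (cancel_mono (𝟙 (F.obj A.algebra.obj))).1 (h ())) }
  map {A B} f := OperadAlgebra.Hom.ofLax ((Operad.mapFunctor F).map f.operadHom) (F.map f.hom)
    ((isLaxAlgHom_id_iff _ _).2 fun l => by
      have h' := congrArg F.map (f.act_hom l)
      have h'' := (Sq.map F (f.operadHom.app l)).tensor
        (sq_tensOnMap _ (fun _ => Sq.map F f.hom) (List.finRange l))
      simp only [Functor.map_comp] at h'
      change (tensorLax F _ _ ≫ F.map (A.algebra.act l)) ≫ F.map f.hom =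
        _ ≫ tensorLax F _ _ ≫ F.map (B.algebra.act l)
      rw [Category.assoc, h', ← Category.assoc]
      exact (congrArg (· ≫ F.map (B.algebra.act l)) (Eq.symm h'')).trans (Category.assoc _ _ _))
  map_id A := OperadAlgebra.Hom.ext ((Operad.mapFunctor F).map_id _) (F.map_id _)
  map_comp f g := OperadAlgebra.Hom.ext ((Operad.mapFunctor F).map_comp _ _) (F.map_comp _ _)

end Image

/-! ### Operads in categories of functors -/

section Evaluation

variable {K : Type u'} [Category.{v'} K] {C : Type u} [Category.{v} C] [MonoidalCategory C]

instance evaluationLaxMonoidal (k : K) : ((evaluation K C).obj k).LaxMonoidal where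
  ε := 𝟙 (𝟙_ C)
  μ X Y := 𝟙 (X.obj k ⊗ Y.obj k)

instance evaluationLaxBraided [SymmetricCategory C] (k : K) :
    ((evaluation K C).obj k).LaxBraided where
  braided _ _ := (Category.id_comp _).trans (Category.comp_id _).symm

lemma tensorLax_evaluation (k : K) {X Y : C} {X' Y' : K ⥤ C} (x : X ⟶ X'.obj k)
    (y : Y ⟶ Y'.obj k) : tensorLax ((evaluation K C).obj k) x y = x ⊗ₘ y :=
  Category.comp_id _

/-- The Künneth morphisms of an evaluation functor are identities. Its iterated version is therefore
the pointwise identification used in `cosComp`, read backwards. -/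
lemma tensOnLax_evaluation (k : K) {ι : Type*} (X : ι → K ⥤ C) (s : List ι) :
    tensOnLax ((evaluation K C).obj k) (fun i => 𝟙 ((X i).obj k)) s =
      (tensOnEval X k s).inv := by
  induction s with
  | nil => rfl
  | cons a s ih =>
    refine (tensorLax_evaluation k _ _).trans ?_
    rw [ih]
    rfl

lemma tensLax_evaluation (k : K) {n : ℕ} (X : Fin n → K ⥤ C) :
    tensLax ((evaluation K C).obj k) (fun i => 𝟙 ((X i).obj k)) = (tensEval X k).inv :=
  tensOnLax_evaluation k X _

lemma tensorLax_tensLax_evaluation (k : K) {n : ℕ} (A : K ⥤ C) (X : Fin n → K ⥤ C) :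
    tensorLax ((evaluation K C).obj k) (𝟙 (A.obj k))
        (tensLax ((evaluation K C).obj k) fun i => 𝟙 ((X i).obj k)) =
      A.obj k ◁ (tensEval X k).inv :=
  (tensorLax_evaluation k _ _).trans
    ((id_tensorHom _ _).trans (congrArg (A.obj k ◁ ·) (tensLax_evaluation k X)))

lemma tensOnMap_evaluation {ι : Type*} {X Y : ι → K ⥤ C} (f : ∀ i, X i ⟶ Y i) (k : K)
    (s : List ι) : (tensOnMap f s).app k ≫ (tensOnEval Y k s).hom =
      (tensOnEval X k s).hom ≫ tensOnMap (fun i => (f i).app k) s := by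
  induction s with
  | nil => rfl
  | cons a s ih =>
    change ((f a).app k ⊗ₘ (tensOnMap f s).app k) ≫ (𝟙 _ ⊗ₘ (tensOnEval Y k s).hom) =
      (𝟙 _ ⊗ₘ (tensOnEval X k s).hom) ≫ ((f a).app k ⊗ₘ tensOnMap (fun i => (f i).app k) s)
    rw [tensorHom_comp_tensorHom, tensorHom_comp_tensorHom, ih, Category.id_comp, Category.comp_id]

/-- The families of isomorphisms to the values of functors. -/
def evaluationEpiClass : EpiClass (fun k : K => (evaluation K C).obj k) where
  mem x := ∀ k, IsIso (x k)
  unit k := inferInstanceAs (IsIso (𝟙 (𝟙_ C)))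
  tensor {X X' Y Y' x x'} h h' k := by
    have := h k
    have := h' k
    change IsIso (tensorLax _ (x k) (x' k))
    rw [tensorLax_evaluation k (x k) (x' k)]
    exact (asIso (x k) ⊗ᵢ asIso (x' k)).isIso_hom
  ext {X Y x} h Z f g e := by
    ext k
    have := h k
    exact (cancel_epi (x k)).1 (e k)

end Evaluation

section Cosimplicial

variable {C : Type u} [Category.{v} C] [MonoidalCategory C] [SymmetricCategory C]

/-- The raw operad of cosimplicial objects defined by a cosimplicial operad. -/
def cosPre (F : SimplexCategory ⥤ Operad C) : PreOperad (SimplexCategory ⥤ C) where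
  obj := cosArity F
  act := cosAct F
  comp := cosComp F
  unit := cosUnit F

/-- The identification `tensEval` built into `cosComp` cancels against the Künneth morphism of the
evaluation. -/
lemma cosPre_isLaxHom (F : SimplexCategory ⥤ Operad C) (k : SimplexCategory) :
    IsLaxHom ((evaluation _ C).obj k) (F.obj k).toPre (cosPre F)
      (fun l => 𝟙 ((F.obj k).obj l)) where
  act _ := (Category.comp_id _).trans (Category.id_comp _).symm
  unit := (Category.comp_id _).trans (Category.id_comp _).symm
  comp l m n h := by
    refine (Category.comp_id _).trans (Eq.trans ?_ (congrArg (· ≫ (cosComp F l m n h).app k)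
      (tensorLax_tensLax_evaluation k (cosArity F l) (fun i => cosArity F (m i))).symm))
    exact (whiskerLeft_inv_hom_assoc ((F.obj k).obj l)
      (tensEval (fun i => cosArity F (m i)) k) ((F.obj k).comp l m n h)).symm

/-- The operad of cosimplicial objects defined by a cosimplicial operad. -/
def cosOperad : (SimplexCategory ⥤ Operad C) ⥤ Operad (SimplexCategory ⥤ C) where
  -- The comparison with the value in each degree is an identity, so the axioms can be checked
  -- degree by degree.
  obj F := (cosPre F).toOperad (evaluationEpiClass.isOperad (cosPre_isLaxHom F)
    (fun k => (F.obj k).isOperad) (fun l k => inferInstanceAs (IsIso (𝟙 ((F.obj k).obj l)))))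
  map {F G} f :=
    { app := fun l => Functor.whiskerRight f (Operad.arity C l)
      act_app := fun σ => by
        ext k
        exact (f.app k).act_app σ
      comp_app := fun l m n h => by
        ext k
        have e := tensOnMap_evaluation
          (fun i => Functor.whiskerRight f (Operad.arity C (m i))) k (List.finRange l)
        have e' := (f.app k).comp_app l m n h
        exact (evalAct_naturality e e').symm
      unit_app := by
        ext k
        exact (f.app k).unit_app }
  map_id F := Operad.Hom.ext (funext fun l => by ext k; rfl)
  map_comp f g := Operad.Hom.ext (funext fun l => by ext k; rfl)

/-- The raw algebra in cosimplicial objects defined by a cosimplicial algebra. -/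
def cosPreAlgebra (F : SimplexCategory ⥤ OperadAlgebra C) :
    PreAlgebra (cosPre (F ⋙ OperadAlgebra.toOperad C)).obj where
  obj := F ⋙ OperadAlgebra.forget C
  act := cosAlgAct F

lemma cosPreAlgebra_isLaxAlgHom (F : SimplexCategory ⥤ OperadAlgebra C) (k : SimplexCategory) :
    IsLaxAlgHom ((evaluation _ C).obj k) (F.obj k).algebra.toPre (cosPreAlgebra F)
      (fun l => 𝟙 ((F.obj k).operad.obj l)) (𝟙 (F.obj k).algebra.obj) := fun l => by
  refine (Category.comp_id _).trans (Eq.trans ?_ (congrArg (· ≫ (cosAlgAct F l).app k)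
    (tensorLax_tensLax_evaluation k (cosArity (F ⋙ OperadAlgebra.toOperad C) l)
      (fun _ => F ⋙ OperadAlgebra.forget C)).symm))
  exact (whiskerLeft_inv_hom_assoc ((F.obj k).operad.obj l)
    (tensEval (fun _ => F ⋙ OperadAlgebra.forget C) k) ((F.obj k).algebra.act l)).symm

/-- The pair of an operad and an algebra in cosimplicial objects defined by a cosimplicial pair. -/
def cosOperadAlgebra :
    (SimplexCategory ⥤ OperadAlgebra C) ⥤ OperadAlgebra (SimplexCategory ⥤ C) where
  obj F :=
    { operad := cosOperad.obj (F ⋙ OperadAlgebra.toOperad C)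
      algebra := (cosPreAlgebra F).toAlgebra (cosOperad.obj (F ⋙ OperadAlgebra.toOperad C))
        (evaluationEpiClass.isAlgebra (cosPre_isLaxHom (F ⋙ OperadAlgebra.toOperad C))
          (cosPreAlgebra_isLaxAlgHom F) (fun k => (F.obj k).algebra.isAlgebra)
          (fun l k => inferInstanceAs (IsIso (𝟙 ((F.obj k).operad.obj l))))
          (fun k => inferInstanceAs (IsIso (𝟙 (F.obj k).algebra.obj)))) }
  map {F G} f :=
    { operadHom := cosOperad.map (Functor.whiskerRight f _)
      hom := Functor.whiskerRight f (OperadAlgebra.forget C)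
      act_hom := fun l => by
        ext k
        have e := tensOnMap_evaluation
          (fun _ : Fin l => Functor.whiskerRight f (OperadAlgebra.forget C)) k (List.finRange l)
        have e' := (f.app k).act_hom l
        exact (evalAct_naturality e e').symm }
  map_id F := OperadAlgebra.Hom.ext (cosOperad.map_id _) (by ext k; rfl)
  map_comp f g := OperadAlgebra.Hom.ext (Operad.Hom.ext (funext fun l => by ext k; rfl))
    (by ext k; rfl)

end Cosimplicial

end

end OperadDescent


namespace OperadDescent

noncomputable section

/-! ### Simple operads and algebras -/

section Simple

variable {C : Type u} [Category.{v} C] [MonoidalCategory C]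

/-- In degree `k` the functor `inner s` is `s` applied to the object of degree `k`, and likewise for
its Künneth morphisms; only the bracketing by `tensOnEval` has to be matched. -/
lemma sq_tensOnEval (s : (SimplexCategory ⥤ C) ⥤ C) [s.LaxMonoidal] {ι : Type*}
    (X : ι → SimplexCategory ⥤ SimplexCategory ⥤ C) (k : SimplexCategory) (t : List ι) :
    Sq s (tensOnEval (fun i => X i ⋙ s) k t).hom (tensOnEval X k t).hom
      ((tensOnLax (inner s) (fun i => 𝟙 (X i ⋙ s)) t).app k)
      (tensOnLax s (fun i => 𝟙 (s.obj ((X i).obj k))) t) := by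
  induction t with
  | nil => exact Sq.id _
  | cons a t ih => exact (Sq.id (𝟙 (s.obj ((X a).obj k)))).tensor ih

lemma tensorHom_comp_of_eq {A T T₁ T₂ T₃ : C} {t : T ⟶ T₁} {e₁ : T₁ ⟶ T₂} {e₂ : T₂ ⟶ T₃}
    {e : T ⟶ T₃} (h : t ≫ e₁ ≫ e₂ = e) :
    ((𝟙 A ⊗ₘ t) ≫ 𝟙 _) ≫ (𝟙 A ⊗ₘ e₁) ≫ (𝟙 A ⊗ₘ e₂) = 𝟙 A ⊗ₘ e := by
  simp [← h]

/-- The lax structure of `diag` consists of identities, so evaluating at `k` in each variable in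
turn agrees with evaluating the diagonals at `k`. -/
lemma tensOnLax_diag {ι : Type*} (X : ι → SimplexCategory ⥤ SimplexCategory ⥤ C)
    (k : SimplexCategory) (t : List ι) :
    (tensOnLax (diag C) (fun i => 𝟙 ((diag C).obj (X i))) t).app k ≫
      (tensOnEval X k t).hom.app k ≫ (tensOnEval (fun i => (X i).obj k) k t).hom =
      (tensOnEval (fun i => (diag C).obj (X i)) k t).hom := by
  induction t with
  | nil => exact (Category.id_comp _).trans (Category.id_comp _)
  | cons a t ih =>
    exact tensorHom_comp_of_eq ih

lemma tensOnLax_cst {ι : Type*} (X : ι → C) (k : SimplexCategory) (t : List ι) :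
    (tensOnLax (cst C) (fun i => 𝟙 ((cst C).obj (X i))) t).app k =
      (tensOnEval (fun i => (cst C).obj (X i)) k t).hom := by
  induction t with
  | nil => rfl
  | cons a t ih =>
    change (𝟙 (X a) ⊗ₘ (tensOnLax (cst C) _ t).app k) ≫ 𝟙 _ = 𝟙 _ ⊗ₘ (tensOnEval _ k t).hom
    rw [ih]
    exact Category.comp_id _

lemma whiskerLeft_comp_of_eq₃ {A B T T₁ T₂ T₃ : C} {t : T ⟶ T₁} {e₁ : T₁ ⟶ T₂} {e₂ : T₂ ⟶ T₃}
    {e : T ⟶ T₃} (h : t ≫ e₁ ≫ e₂ = e) (c : A ⊗ T₃ ⟶ B) :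
    ((A ◁ e) ≫ c) ≫ 𝟙 B = ((𝟙 A ⊗ₘ t) ≫ 𝟙 _) ≫ (A ◁ e₁) ≫ (A ◁ e₂) ≫ c := by
  simp [← h]

lemma whiskerLeft_comp_of_eq {A B T T₁ : C} {t e : T ⟶ T₁} (h : t = e) (c : A ⊗ T₁ ⟶ B) :
    ((A ◁ e) ≫ c) ≫ 𝟙 B = ((𝟙 A ⊗ₘ t) ≫ 𝟙 _) ≫ c := by
  simp [← h]

variable [SymmetricCategory C]

section Functor

variable (s : (SimplexCategory ⥤ C) ⥤ C) [s.LaxBraided]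

/-- The simple functor on operads. -/
abbrev operadSimple : (SimplexCategory ⥤ Operad C) ⥤ Operad C :=
  cosOperad ⋙ Operad.mapFunctor s

/-- The simple functor on pairs of an operad and an algebra. -/
abbrev operadAlgebraSimple : (SimplexCategory ⥤ OperadAlgebra C) ⥤ OperadAlgebra C :=
  cosOperadAlgebra ⋙ OperadAlgebra.mapFunctor s

lemma operadSimple_isLaxHom (F : SimplexCategory ⥤ Operad C) :
    IsLaxHom s ((operadSimple s).obj F).toPre (cosPre F) (fun l => 𝟙 (s.obj (cosArity F l))) :=
  (cosPre F).map_isLaxHom s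

lemma operadAlgebraSimple_isLaxAlgHom (F : SimplexCategory ⥤ OperadAlgebra C) :
    IsLaxAlgHom s ((operadAlgebraSimple s).obj F).algebra.toPre (cosPreAlgebra F)
      (fun l => 𝟙 (s.obj (cosArity (F ⋙ OperadAlgebra.toOperad C) l)))
      (𝟙 (s.obj (F ⋙ OperadAlgebra.forget C))) :=
  (cosPreAlgebra F).map_isLaxAlgHom s

/-- Together with `diag_isLaxHom` and `cst_isLaxHom`, this expresses the source and the targets of
`μ` and `λ` through lax morphisms to one and the same operad in bicosimplicial objects (for `μ`) or
in `C` (for `λ`). -/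
lemma inner_isLaxHom (Z : SimplexCategory ⥤ SimplexCategory ⥤ Operad C) :
    IsLaxHom (inner s) (cosPre (Z ⋙ operadSimple s)) (cosPre (Z ⋙ cosOperad))
      (fun l => 𝟙 ((inner s).obj (cosArity (Z ⋙ cosOperad) l))) where
  act σ := (Category.comp_id _).trans (Category.id_comp _).symm
  unit := by
    ext k
    exact (operadSimple_isLaxHom s (Z.obj k)).unit
  comp l m n h := by
    ext k
    exact Sq.comp ((sq_tensOnEval s (fun i => cosArity (Z ⋙ cosOperad) (m i)) k _).whiskerLeft
      (𝟙 _)) ((operadSimple_isLaxHom s (Z.obj k)).comp l m n h)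

lemma inner_isLaxAlgHom (Z : SimplexCategory ⥤ SimplexCategory ⥤ OperadAlgebra C) :
    IsLaxAlgHom (inner s) (cosPreAlgebra (Z ⋙ operadAlgebraSimple s))
      (cosPreAlgebra (Z ⋙ cosOperadAlgebra))
      (fun l => 𝟙 ((inner s).obj
        (cosArity ((Z ⋙ cosOperadAlgebra) ⋙ OperadAlgebra.toOperad _) l)))
      (𝟙 ((inner s).obj ((Z ⋙ cosOperadAlgebra) ⋙ OperadAlgebra.forget _))) := fun l => by
  ext k
  exact Sq.comp ((sq_tensOnEval s
    (fun _ : Fin l => (Z ⋙ cosOperadAlgebra) ⋙ OperadAlgebra.forget _) k _).whiskerLeft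
    (𝟙 _)) (operadAlgebraSimple_isLaxAlgHom s (Z.obj k) l)

end Functor

lemma diag_isLaxHom (Z : SimplexCategory ⥤ SimplexCategory ⥤ Operad C) :
    IsLaxHom (diag C) (cosPre ((diag (Operad C)).obj Z)) (cosPre (Z ⋙ cosOperad))
      (fun l => 𝟙 ((diag C).obj (cosArity (Z ⋙ cosOperad) l))) where
  act σ := (Category.comp_id _).trans (Category.id_comp _).symm
  unit := (Category.comp_id _).trans (by ext k; exact (Category.id_comp _).symm)
  comp l m n h := by
    ext k
    exact whiskerLeft_comp_of_eq₃
      (tensOnLax_diag (fun i => cosArity (Z ⋙ cosOperad) (m i)) k (List.finRange l)) _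

lemma diag_isLaxAlgHom (Z : SimplexCategory ⥤ SimplexCategory ⥤ OperadAlgebra C) :
    IsLaxAlgHom (diag C) (cosPreAlgebra ((diag (OperadAlgebra C)).obj Z))
      (cosPreAlgebra (Z ⋙ cosOperadAlgebra))
      (fun l => 𝟙 ((diag C).obj
        (cosArity ((Z ⋙ cosOperadAlgebra) ⋙ OperadAlgebra.toOperad _) l)))
      (𝟙 ((diag C).obj ((Z ⋙ cosOperadAlgebra) ⋙ OperadAlgebra.forget _))) := fun l => by
  ext k
  exact whiskerLeft_comp_of_eq₃ (tensOnLax_diag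
    (fun _ => (Z ⋙ cosOperadAlgebra) ⋙ OperadAlgebra.forget _) k (List.finRange l)) _

lemma cst_isLaxHom (A : Operad C) :
    IsLaxHom (cst C) (cosPre ((cst (Operad C)).obj A)) A.toPre
      (fun l => 𝟙 ((cst C).obj (A.obj l))) where
  act σ := (Category.comp_id _).trans (Category.id_comp _).symm
  unit := (Category.comp_id _).trans (by ext k; exact (Category.id_comp _).symm)
  comp l m n h := by
    ext k
    exact whiskerLeft_comp_of_eq (tensOnLax_cst (fun i => A.obj (m i)) k (List.finRange l)) _

lemma cst_isLaxAlgHom (A : OperadAlgebra C) :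
    IsLaxAlgHom (cst C) (cosPreAlgebra ((cst (OperadAlgebra C)).obj A)) A.algebra.toPre
      (fun l => 𝟙 ((cst C).obj (A.operad.obj l))) (𝟙 ((cst C).obj A.algebra.obj)) := fun l => by
  ext k
  exact whiskerLeft_comp_of_eq (tensOnLax_cst (fun _ => A.algebra.obj) k (List.finRange l)) _

lemma id_isLaxHom (A : Operad C) : IsLaxHom (𝟭 C) A.toPre A.toPre (fun l => 𝟙 (A.obj l)) :=
  Operad.Hom.isLaxHom (𝟙 A)

lemma id_isLaxAlgHom (A : OperadAlgebra C) :
    IsLaxAlgHom (𝟭 C) A.algebra.toPre A.algebra.toPre (fun l => 𝟙 (A.operad.obj l))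
      (𝟙 A.algebra.obj) :=
  OperadAlgebra.Hom.isLaxAlgHom (𝟙 A)

/-! ### The transformations `μ` and `λ` on operads and on pairs. -/

section Triple

lemma comp_id_map (s : (SimplexCategory ⥤ C) ⥤ C) {X Y : SimplexCategory ⥤ C}
    (f : s.obj X ⟶ s.obj Y) :
    f ≫ 𝟙 (s.obj Y) ≫ s.map (𝟙 Y) = (𝟙 (s.obj X) ≫ s.map (𝟙 X)) ≫ f := by
  simp

lemma comp_id_map_of_eq (s : (SimplexCategory ⥤ C) ⥤ C) {Y : C} (X : SimplexCategory ⥤ C)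
    (f : Y ⟶ s.obj X) : f ≫ 𝟙 (s.obj X) ≫ s.map (𝟙 X) = 𝟙 Y ≫ f := by
  simp

lemma eq_of_comp_id_map (s : (SimplexCategory ⥤ C) ⥤ C) (X : SimplexCategory ⥤ C) (V : C)
    (a b : V ⟶ s.obj X)
    (h : Unit → a ≫ 𝟙 (s.obj X) ≫ s.map (𝟙 X) = b ≫ 𝟙 (s.obj X) ≫ s.map (𝟙 X)) : a = b := by
  simpa using h ()

variable (T : DescentTriple C) [T.simple.LaxBraided] [NatTrans.IsMonoidal T.mu]
  [NatTrans.IsMonoidal T.lam]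

/-- The source is lax over the bicosimplicial operad along `inner s ⋙ s`, hence along `diag ⋙ s` by
the monoidal transformation `μ`. The target is lax over it along `diag ⋙ s` through identities.
These are monic, so `μ` is compatible with the operad structures. -/
lemma operad_mu_isLaxHom (Z : SimplexCategory ⥤ SimplexCategory ⥤ Operad C) :
    IsLaxHom (𝟭 C) ((operadSimple T.simple).obj (Z ⋙ operadSimple T.simple)).toPre
      ((operadSimple T.simple).obj ((diag (Operad C)).obj Z)).toPre
      (fun l => T.mu.app (cosArity (Z ⋙ cosOperad) l)) :=
  IsLaxHom.cancel (fun _ => eq_of_comp_id_map T.simple _)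
    (fun _ => ((operadSimple_isLaxHom T.simple (Z ⋙ operadSimple T.simple)).trans
      (inner_isLaxHom T.simple Z)).natTrans T.mu)
    (fun _ => (operadSimple_isLaxHom T.simple ((diag (Operad C)).obj Z)).trans (diag_isLaxHom Z))
    _ (fun _ _ => comp_id_map T.simple _)

/-- The same argument with `λ`, from the identity functor to `cst ⋙ s`. -/
lemma operad_lam_isLaxHom (A : Operad C) :
    IsLaxHom (𝟭 C) A.toPre ((operadSimple T.simple).obj ((cst (Operad C)).obj A)).toPre
      (fun l => T.lam.app (A.obj l)) :=
  IsLaxHom.cancel (fun _ => eq_of_comp_id_map T.simple _)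
    (fun _ => (id_isLaxHom A).natTrans T.lam)
    (fun _ => (operadSimple_isLaxHom T.simple ((cst (Operad C)).obj A)).trans (cst_isLaxHom A)) _
    (fun _ l => comp_id_map_of_eq T.simple ((cst C).obj (A.obj l)) (T.lam.app (A.obj l)))

lemma operadAlgebra_mu_isLaxAlgHom
    (Z : SimplexCategory ⥤ SimplexCategory ⥤ OperadAlgebra C) :
    IsLaxAlgHom (𝟭 C)
      ((operadAlgebraSimple T.simple).obj (Z ⋙ operadAlgebraSimple T.simple)).algebra.toPre
      ((operadAlgebraSimple T.simple).obj ((diag (OperadAlgebra C)).obj Z)).algebra.toPre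
      (fun l => T.mu.app (cosArity ((Z ⋙ cosOperadAlgebra) ⋙ OperadAlgebra.toOperad _) l))
      (T.mu.app ((Z ⋙ cosOperadAlgebra) ⋙ OperadAlgebra.forget _)) :=
  IsLaxAlgHom.cancel (eq_of_comp_id_map T.simple _)
    (fun _ => ((operadAlgebraSimple_isLaxAlgHom T.simple (Z ⋙ operadAlgebraSimple T.simple)).trans
      (inner_isLaxAlgHom T.simple Z)).natTrans T.mu)
    (fun _ => (operadAlgebraSimple_isLaxAlgHom T.simple ((diag (OperadAlgebra C)).obj Z)).trans
      (diag_isLaxAlgHom Z))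
    _ _ (fun _ _ => comp_id_map T.simple _) (fun _ => comp_id_map T.simple _)

lemma operadAlgebra_lam_isLaxAlgHom (A : OperadAlgebra C) :
    IsLaxAlgHom (𝟭 C) A.algebra.toPre
      ((operadAlgebraSimple T.simple).obj ((cst (OperadAlgebra C)).obj A)).algebra.toPre
      (fun l => T.lam.app (A.operad.obj l)) (T.lam.app A.algebra.obj) :=
  IsLaxAlgHom.cancel (eq_of_comp_id_map T.simple _)
    (fun _ => (id_isLaxAlgHom A).natTrans T.lam)
    (fun _ => (operadAlgebraSimple_isLaxAlgHom T.simple ((cst (OperadAlgebra C)).obj A)).trans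
      (cst_isLaxAlgHom A)) _ _
    (fun _ l => comp_id_map_of_eq T.simple ((cst C).obj (A.operad.obj l)) _)
    (fun _ => comp_id_map_of_eq T.simple ((cst C).obj A.algebra.obj) _)

/-- The triple on operads. -/
def operadTriple : DescentTriple (Operad C) where
  simple := operadSimple T.simple
  mu :=
    { app := fun Z => Operad.Hom.ofLax _ (operad_mu_isLaxHom T Z)
      naturality := fun Z Z' f => Operad.Hom.ext (funext fun l => T.mu.naturality
        (Functor.whiskerRight (Functor.whiskerRight f cosOperad) (Operad.arity _ l))) }
  lam :=
    { app := fun A => Operad.Hom.ofLax _ (operad_lam_isLaxHom T A)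
      naturality := fun A B f => Operad.Hom.ext (funext fun l => T.lam.naturality (f.app l)) }

/-- The triple on pairs of an operad and an algebra. -/
def operadAlgebraTriple : DescentTriple (OperadAlgebra C) where
  simple := operadAlgebraSimple T.simple
  mu :=
    { app := fun Z => OperadAlgebra.Hom.ofLax
        ((operadTriple T).mu.app
          (Z ⋙ (Functor.whiskeringRight _ _ _).obj (OperadAlgebra.toOperad C)))
        _ (operadAlgebra_mu_isLaxAlgHom T Z)
      naturality := fun Z Z' f => OperadAlgebra.Hom.ext
        ((operadTriple T).mu.naturality (Functor.whiskerRight f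
          ((Functor.whiskeringRight _ _ _).obj (OperadAlgebra.toOperad C))))
        (T.mu.naturality (Functor.whiskerRight f
          ((Functor.whiskeringRight _ _ _).obj (OperadAlgebra.forget C)))) }
  lam :=
    { app := fun A => OperadAlgebra.Hom.ofLax ((operadTriple T).lam.app A.operad) _
        (operadAlgebra_lam_isLaxAlgHom T A)
      naturality := fun A B f => OperadAlgebra.Hom.ext
        ((operadTriple T).lam.naturality f.operadHom) (T.lam.naturality f.hom) }

end Triple

end Simple

end

end OperadDescent


namespace OperadDescent

noncomputable section

/-! ### Algebras over a fixed operad -/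

section Pullback

variable {C : Type u} [Category.{v} C] [MonoidalCategory C] [SymmetricCategory C]

lemma whiskerRight_comp_id {A A' B B' : C} {l : ℕ} (f : A ⟶ A')
    (c : A' ⊗ tens (fun _ : Fin l => B) ⟶ B') :
    ((f ▷ tens (fun _ : Fin l => B)) ≫ c) ≫ 𝟙 B' = (f ⊗ₘ tensMap (fun _ => 𝟙 B)) ≫ c := by
  rw [tensMap_id, tensorHom_id, Category.comp_id]

/-- The reciprocal image of an algebra along a morphism of operads. -/
def Operad.Algebra.pullback {P Q : Operad C} (f : P ⟶ Q) (B : Q.Algebra) : P.Algebra :=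
  PreAlgebra.toAlgebra P
    { obj := B.obj
      act := fun l => (f.app l ▷ tens (fun _ : Fin l => B.obj)) ≫ B.act l }
    (.of_mono (κ := Unit) (fun _ => Operad.Hom.isLaxHom f) (B := fun _ => B.toPre)
      (θ' := fun _ => 𝟙 B.obj)
      (fun _ => (isLaxAlgHom_id_iff _ _).2 fun l => whiskerRight_comp_id (f.app l) (B.act l))
      (fun _ => B.isAlgebra) fun Z f g h => (cancel_mono (𝟙 B.obj)).1 (h ()))

/-- The canonical morphism from the reciprocal image of an algebra. -/
def Operad.Algebra.pullbackHom {P Q : Operad C} (f : P ⟶ Q) (B : Q.Algebra) :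
    (⟨P, B.pullback f⟩ : OperadAlgebra C) ⟶ ⟨Q, B⟩ where
  operadHom := f
  hom := 𝟙 B.obj
  act_hom l := whiskerRight_comp_id (f.app l) (B.act l)

/-- A morphism of pairs above `f` is a morphism to the reciprocal image along `f`. -/
def Operad.Algebra.toPullback {P Q : Operad C} {f : P ⟶ Q} {A : P.Algebra} {B : Q.Algebra}
    (g : (⟨P, A⟩ : OperadAlgebra C) ⟶ ⟨Q, B⟩) (hg : g.operadHom = f) (h : A.obj ⟶ B.obj)
    (hh : g.hom = h) : A ⟶ B.pullback f where
  hom := h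
  act_hom l := by
    subst hg hh
    refine (g.act_hom l).trans ?_
    rw [tensorHom_def', Category.assoc]
    rfl

/-- The pair defined by an algebra over `P`. -/
def Operad.Algebra.toPair (P : Operad C) : P.Algebra ⥤ OperadAlgebra C where
  obj A := ⟨P, A⟩
  map f :=
    { operadHom := 𝟙 P
      hom := f.hom
      act_hom := fun l => (f.act_hom l).trans (congrArg (· ≫ _) (id_tensorHom _ _).symm) }
  map_comp _ _ := OperadAlgebra.Hom.ext (Category.comp_id _).symm rfl

variable (T : DescentTriple C) [T.simple.LaxBraided] [NatTrans.IsMonoidal T.mu]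
  [NatTrans.IsMonoidal T.lam] (P : Operad C)

/-- The simple object of a cosimplicial algebra over `P`. -/
def algebraSimpleObj (F : SimplexCategory ⥤ P.Algebra) : P.Algebra :=
  Operad.Algebra.pullback ((operadTriple T).lam.app P)
    ((operadAlgebraSimple T.simple).obj (F ⋙ Operad.Algebra.toPair P)).algebra

/-- The canonical morphism from the simple object of a cosimplicial algebra over `P`. -/
def algebraSimpleHom (F : SimplexCategory ⥤ P.Algebra) :
    (⟨P, algebraSimpleObj T P F⟩ : OperadAlgebra C) ⟶
      (operadAlgebraSimple T.simple).obj (F ⋙ Operad.Algebra.toPair P) :=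
  Operad.Algebra.pullbackHom _ _

/-- The simple functor on algebras over `P`. -/
def algebraSimple : (SimplexCategory ⥤ P.Algebra) ⥤ P.Algebra where
  obj := algebraSimpleObj T P
  map {F G} f := Operad.Algebra.toPullback
    (algebraSimpleHom T P F ≫
      (operadAlgebraSimple T.simple).map (Functor.whiskerRight f (Operad.Algebra.toPair P)))
    -- On operads `f` is the identity of `P` in every degree, so the composite lies above `λ_P` and
    -- factors through the pullback along it.
    (Operad.Hom.ext (funext fun l =>
      (congrArg (T.lam.app (P.obj l) ≫ ·) (T.simple.map_id _)).trans (Category.comp_id _)))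
    (T.simple.map (Functor.whiskerRight f (Operad.Algebra.forget P))) (Category.id_comp _)
  map_id F := Operad.Algebra.Hom.ext (T.simple.map_id _)
  map_comp f g := Operad.Algebra.Hom.ext (T.simple.map_comp
    (Functor.whiskerRight f (Operad.Algebra.forget P))
    (Functor.whiskerRight g (Operad.Algebra.forget P)))

/-- The comparison between the pairs given by the simple algebras over `P` and the simple pairs. -/
def algebraSimpleNatTrans : algebraSimple T P ⋙ Operad.Algebra.toPair P ⟶
    (Functor.whiskeringRight _ _ _).obj (Operad.Algebra.toPair P) ⋙
      operadAlgebraSimple T.simple where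
  app F := algebraSimpleHom T P F
  naturality F G f := OperadAlgebra.Hom.ext
    (Operad.Hom.ext (funext fun l => (Category.id_comp _).trans
      ((congrArg (T.lam.app (P.obj l) ≫ ·) (T.simple.map_id _)).trans (Category.comp_id _)).symm))
    ((Category.comp_id _).trans (Category.id_comp _).symm)

/-- The iterated simple algebra over `P` of a bicosimplicial algebra, with values in the simple pair
of the diagonal. -/
def algebraMuPair (Z : SimplexCategory ⥤ SimplexCategory ⥤ P.Algebra) :
    (⟨P, algebraSimpleObj T P (Z ⋙ algebraSimple T P)⟩ : OperadAlgebra C) ⟶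
      (operadAlgebraSimple T.simple).obj ((diag _).obj Z ⋙ Operad.Algebra.toPair P) :=
  algebraSimpleHom T P (Z ⋙ algebraSimple T P) ≫
    (operadAlgebraSimple T.simple).map (Functor.whiskerLeft Z (algebraSimpleNatTrans T P)) ≫
    (operadAlgebraTriple T).mu.app
      (Z ⋙ (Functor.whiskeringRight _ _ _).obj (Operad.Algebra.toPair P)) ≫
    (operadAlgebraSimple T.simple).map (diagCompIso (Operad.Algebra.toPair P) Z).inv

-- On operads the composite is `λ_P` followed by `s(λ_P)` and `μ`. The last two compose to the
-- identity by the inner compatibility of `λ` and `μ` for the constant cosimplicial object at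
-- `P(l)`.
variable {T} in
lemma algebraMuPair_operadHom (hT : T.IsNormalized)
    (Z : SimplexCategory ⥤ SimplexCategory ⥤ P.Algebra) :
    (algebraMuPair T P Z).operadHom = (operadTriple T).lam.app P :=
  Operad.Hom.ext (funext fun l =>
    (congrArg (T.lam.app (P.obj l) ≫ ·) (hT.inner ((cst C).obj (P.obj l)))).trans
      (Category.comp_id _))

lemma algebraMuPair_hom (Z : SimplexCategory ⥤ SimplexCategory ⥤ P.Algebra) :
    (algebraMuPair T P Z).hom = T.mu.app
      (Z ⋙ (Functor.whiskeringRight _ _ _).obj (Operad.Algebra.forget P)) := by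
  have h : ∀ {X : C} {X₁ X₂ X₃ : SimplexCategory ⥤ C} (f : T.simple.obj X₁ ⟶ T.simple.obj X₂),
      𝟙 _ ≫ T.simple.map (𝟙 X₁) ≫ f ≫ T.simple.map (𝟙 X₂) = f := by
    simp
  -- The objects `X` and `X₃` do not occur in the identity `h`; the values given here are arbitrary.
  exact h (X := P.obj 1) (X₃ := (cst C).obj (P.obj 1)) _

/-- The triple on algebras over `P`. -/
def algebraTriple (hT : T.IsNormalized) : DescentTriple P.Algebra where
  simple := algebraSimple T P
  mu :=
    -- A morphism of pairs above `λ_P` is a morphism of `P`-algebras to the pullback along `λ_P`,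
    -- which is the simple algebra of the diagonal.
    { app := fun Z => Operad.Algebra.toPullback (algebraMuPair T P Z)
        (algebraMuPair_operadHom P hT Z) _ (algebraMuPair_hom T P Z)
      naturality := fun Z Z' f => Operad.Algebra.Hom.ext (T.mu.naturality (Functor.whiskerRight f
        ((Functor.whiskeringRight _ _ _).obj (Operad.Algebra.forget P)))) }
  lam :=
    { app := fun A => Operad.Algebra.toPullback
        ((operadAlgebraTriple T).lam.app ((Operad.Algebra.toPair P).obj A)) rfl
        (T.lam.app A.obj) rfl
      naturality := fun A B f => Operad.Algebra.Hom.ext (T.lam.naturality f.hom) }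

end Pullback

/-! ### Comparison of the new triples with the triple on `C`, and the induced structures. -/

section Lift

variable {C : Type u} [Category.{v} C] [MonoidalCategory C] [SymmetricCategory C]

lemma id_comp_map_id (s : (SimplexCategory ⥤ C) ⥤ C) {Y : C} (X : SimplexCategory ⥤ C)
    (f : Y ⟶ s.obj X) : f ≫ 𝟙 _ ≫ s.map (𝟙 X) = f := by
  simp

lemma id_comp_map_id' (s : (SimplexCategory ⥤ C) ⥤ C) {X Y : SimplexCategory ⥤ C}
    (f : s.obj X ⟶ s.obj Y) :
    f ≫ 𝟙 (s.obj Y) ≫ s.map (𝟙 Y) = 𝟙 (s.obj X) ≫ s.map (𝟙 X) ≫ f := by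
  simp

lemma whiskerRight_comp_tensorHom {X Y Z W V : C} (f : X ⟶ Y) (g : Z ⟶ W) (h : Y ⊗ W ⟶ V) :
    (f ▷ Z) ≫ (𝟙 Y ⊗ₘ g) ≫ h = (f ⊗ₘ g) ≫ h := by
  rw [id_tensorHom, MonoidalCategory.tensorHom_def, Category.assoc]

variable (T : DescentTriple C) [T.simple.LaxBraided] [NatTrans.IsMonoidal T.mu]
  [NatTrans.IsMonoidal T.lam]

/-- The triple on operads is computed arity-wise. -/
def operadLift (l : ℕ+) : TripleLift (Operad.arity C l) (operadTriple T) T where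
  iso := Iso.refl _
  mu Z := id_comp_map_id' T.simple
    (T.mu.app (Z ⋙ (Functor.whiskeringRight _ _ _).obj (Operad.arity C l)))
  lam A := id_comp_map_id T.simple ((cst C).obj (A.obj l)) (T.lam.app (A.obj l))

/-- The triple on pairs is computed arity-wise on operads. -/
def operadAlgebraLift (l : ℕ+) :
    TripleLift (OperadAlgebra.toOperad C ⋙ Operad.arity C l) (operadAlgebraTriple T) T where
  iso := Iso.refl _
  mu Z := id_comp_map_id' T.simple
    (T.mu.app (Z ⋙ (Functor.whiskeringRight _ _ _).obj (OperadAlgebra.toOperad C ⋙ Operad.arity C l)))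
  lam A := id_comp_map_id T.simple ((cst C).obj (A.operad.obj l)) (T.lam.app (A.operad.obj l))

/-- The triple on pairs is computed on the underlying objects of algebras. -/
def operadAlgebraLift' :
    TripleLift (OperadAlgebra.forget C) (operadAlgebraTriple T) T where
  iso := Iso.refl _
  mu Z := id_comp_map_id' T.simple
    (T.mu.app (Z ⋙ (Functor.whiskeringRight _ _ _).obj (OperadAlgebra.forget C)))
  lam A := id_comp_map_id T.simple ((cst C).obj A.algebra.obj) (T.lam.app A.algebra.obj)

/-- The triple on algebras over `P` is computed on underlying objects. -/
def algebraLift (P : Operad C) (hT : T.IsNormalized) :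
    TripleLift (Operad.Algebra.forget P) (algebraTriple T P hT) T where
  iso := Iso.refl _
  mu Z := id_comp_map_id' T.simple
    (T.mu.app (Z ⋙ (Functor.whiskeringRight _ _ _).obj (Operad.Algebra.forget P)))
  lam A := id_comp_map_id T.simple ((cst C).obj A.obj) (T.lam.app A.obj)

lemma operad_isSimple (F : SimplexCategory ⥤ Operad C) :
    IsSimpleOperad F T.simple ((operadTriple T).simple.obj F)
      (fun l => (operadLift T l).hom F) := by
  have h := operadSimple_isLaxHom T.simple F
  exact ⟨fun σ => h.act σ, h.unit, fun l m n hn =>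
    Eq.trans (h.comp l m n hn) (Category.assoc _ _ _)⟩

lemma operadAlgebra_isSimple (F : SimplexCategory ⥤ OperadAlgebra C) :
    IsSimpleOperadAlgebra F T.simple ((operadAlgebraTriple T).simple.obj F)
      (fun l => (operadAlgebraLift T l).hom F) ((operadAlgebraLift' T).hom F) where
  operad := operad_isSimple T (F ⋙ OperadAlgebra.toOperad C)
  act l := Eq.trans (operadAlgebraSimple_isLaxAlgHom T.simple F l) (Category.assoc _ _ _)

lemma algebra_isSimple (P : Operad C) (hT : T.IsNormalized) (F : SimplexCategory ⥤ P.Algebra) :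
    IsSimpleAlgebra F T ((algebraTriple T P hT).simple.obj F) ((algebraLift T P hT).hom F) where
  act l := by
    refine Eq.trans (Category.comp_id _) (Eq.trans (congrArg ((T.lam.app (P.obj l) ▷ _) ≫ ·)
      (Category.assoc _ _ _)) ?_)
    exact whiskerRight_comp_tensorHom _ _ _

end Lift

end

end OperadDescent


namespace OperadDescent

/-! ### Filtered colimits preserved by tensor products -/

section StableColimit

variable {C : Type u} [Category.{v} C] [MonoidalCategory C] {J : Type u'} [Category.{v'} J]

/-- The morphisms `ι j : G j ⟶ X` exhibit `X` as the colimit of the functor with values `G j` and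
transition morphisms `t f`, and this colimit is preserved by the functors `Z ⊗ -`. -/
structure StableColimit (G : J → C) (t : ∀ {j j' : J}, (j ⟶ j') → (G j ⟶ G j')) (X : C)
    (ι : ∀ j, G j ⟶ X) : Prop where
  t_comp : ∀ {j j' j'' : J} (f : j ⟶ j') (g : j' ⟶ j''), t (f ≫ g) = t f ≫ t g
  w : ∀ {j j' : J} (f : j ⟶ j'), t f ≫ ι j' = ι j
  ext : ∀ {Z Y : C} (f g : Z ⊗ X ⟶ Y), (∀ j, (Z ◁ ι j) ≫ f = (Z ◁ ι j) ≫ g) → f = g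
  desc : ∀ {Z Y : C} (y : ∀ j, Z ⊗ G j ⟶ Y),
    (∀ {j j' : J} (f : j ⟶ j'), (Z ◁ t f) ≫ y j' = y j) →
      ∃ g : Z ⊗ X ⟶ Y, ∀ j, (Z ◁ ι j) ≫ g = y j

namespace StableColimit

section

variable {G : J → C} {t : ∀ {j j' : J}, (j ⟶ j') → (G j ⟶ G j')} {X : C} {ι : ∀ j, G j ⟶ X}
  (h : StableColimit G t X ι)

include h

/-- The case `Z = 𝟙_ C`: a stable colimit is in particular a colimit. -/
lemma ext₀ {Y : C} (f g : X ⟶ Y) (e : ∀ j, ι j ≫ f = ι j ≫ g) : f = g := by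
  rw [← cancel_epi (λ_ X).hom]
  refine h.ext _ _ fun j => ?_
  rw [leftUnitor_naturality_assoc, leftUnitor_naturality_assoc, e]

lemma desc₀ {Y : C} (y : ∀ j, G j ⟶ Y) (hy : ∀ {j j' : J} (f : j ⟶ j'), t f ≫ y j' = y j) :
    ∃ g : X ⟶ Y, ∀ j, ι j ≫ g = y j := by
  obtain ⟨g, hg⟩ := h.desc (Z := 𝟙_ C) (fun j => (λ_ (G j)).hom ≫ y j) fun f => by
    rw [leftUnitor_naturality_assoc, hy]
  refine ⟨(λ_ X).inv ≫ g, fun j => ?_⟩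
  rw [leftUnitor_inv_naturality_assoc, hg, Iso.inv_hom_id_assoc]

lemma ext₂ {Z B Y : C} (f g : Z ⊗ B ⊗ X ⟶ Y)
    (e : ∀ j, (Z ◁ B ◁ ι j) ≫ f = (Z ◁ B ◁ ι j) ≫ g) : f = g := by
  rw [← cancel_epi (α_ Z B X).hom]
  refine h.ext _ _ fun j => ?_
  rw [associator_naturality_right_assoc, associator_naturality_right_assoc, e]

lemma desc₂ {Z B Y : C} (y : ∀ j, Z ⊗ B ⊗ G j ⟶ Y)
    (hy : ∀ {j j' : J} (f : j ⟶ j'), (Z ◁ B ◁ t f) ≫ y j' = y j) :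
    ∃ g : Z ⊗ B ⊗ X ⟶ Y, ∀ j, (Z ◁ B ◁ ι j) ≫ g = y j := by
  obtain ⟨g, hg⟩ := h.desc (Z := Z ⊗ B) (fun j => (α_ Z B (G j)).hom ≫ y j) fun f => by
    rw [associator_naturality_right_assoc, hy]
  refine ⟨(α_ Z B X).inv ≫ g, fun j => ?_⟩
  rw [associator_inv_naturality_right_assoc, hg, Iso.inv_hom_id_assoc]

variable [SymmetricCategory C]

/-- The symmetry carries the colimit variable to the last position, where `ext₂` applies. -/
lemma ext₁ {Z B Y : C} (f g : Z ⊗ X ⊗ B ⟶ Y)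
    (e : ∀ j, (Z ◁ (ι j ▷ B)) ≫ f = (Z ◁ (ι j ▷ B)) ≫ g) : f = g := by
  rw [← cancel_epi (Z ◁ (β_ B X).hom)]
  refine h.ext₂ _ _ fun j => ?_
  rw [← whiskerLeft_comp_assoc, ← whiskerLeft_comp_assoc,
    BraidedCategory.braiding_naturality_right, whiskerLeft_comp_assoc, whiskerLeft_comp_assoc, e]

lemma desc₁ {Z B Y : C} (y : ∀ j, Z ⊗ G j ⊗ B ⟶ Y)
    (hy : ∀ {j j' : J} (f : j ⟶ j'), (Z ◁ (t f ▷ B)) ≫ y j' = y j) :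
    ∃ g : Z ⊗ X ⊗ B ⟶ Y, ∀ j, (Z ◁ (ι j ▷ B)) ≫ g = y j := by
  obtain ⟨g, hg⟩ := h.desc₂ (Z := Z) (B := B) (fun j => (Z ◁ (β_ B (G j)).hom) ≫ y j) fun f => by
    rw [← whiskerLeft_comp_assoc, BraidedCategory.braiding_naturality_right,
      whiskerLeft_comp_assoc, hy]
  refine ⟨(Z ◁ (β_ X B).hom) ≫ g, fun j => ?_⟩
  rw [← whiskerLeft_comp_assoc, BraidedCategory.braiding_naturality_left,
    whiskerLeft_comp_assoc, hg, ← whiskerLeft_comp_assoc, SymmetricCategory.symmetry,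
    whiskerLeft_id, Category.id_comp]

end

variable [IsFiltered J]

/-- A filtered category is nonempty and connected. This is used for the unit object, and for the
constant diagram at a fixed operad. -/
lemma const (A : C) :
    StableColimit (J := J) (fun _ => A) (fun _ => 𝟙 A) A (fun _ => 𝟙 A) where
  t_comp _ _ := (Category.comp_id _).symm
  w _ := Category.comp_id _
  ext f g e := by
    have : Nonempty J := IsFiltered.nonempty
    simpa using e (Classical.arbitrary J)
  desc y hy := by
    have : Nonempty J := IsFiltered.nonempty
    refine ⟨y (Classical.arbitrary J), fun j => ?_⟩
    have e₁ := hy (IsFiltered.leftToMax j (Classical.arbitrary J))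
    have e₂ := hy (IsFiltered.rightToMax j (Classical.arbitrary J))
    simp only [whiskerLeft_id, Category.id_comp] at e₁ e₂ ⊢
    rw [← e₁, ← e₂]

variable [SymmetricCategory C]

/-- The tensor product is a colimit over pairs of indices, taken one variable at a time;
filteredness makes the diagonal indices sufficient. -/
lemma tensor {G : J → C} {t : ∀ {j j' : J}, (j ⟶ j') → (G j ⟶ G j')} {X : C} {ι : ∀ j, G j ⟶ X}
    {G' : J → C} {t' : ∀ {j j' : J}, (j ⟶ j') → (G' j ⟶ G' j')} {X' : C} {ι' : ∀ j, G' j ⟶ X'}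
    (h : StableColimit G t X ι) (h' : StableColimit G' t' X' ι') :
    StableColimit (fun j => G j ⊗ G' j) (fun f => t f ⊗ₘ t' f) (X ⊗ X')
      (fun j => ι j ⊗ₘ ι' j) where
  t_comp f g := by rw [h.t_comp, h'.t_comp, tensorHom_comp_tensorHom]
  w f := by rw [tensorHom_comp_tensorHom, h.w, h'.w]
  ext {Z Y} f g e := by
    refine h'.ext₂ _ _ fun j' => h.ext₁ _ _ fun j => ?_
    -- Equality at the pair `(j, j')` follows from equality at a diagonal index dominating both.
    have e' := congrArg (fun a => (Z ◁ (t (IsFiltered.leftToMax j j') ⊗ₘ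
      t' (IsFiltered.rightToMax j j'))) ≫ a) (e (IsFiltered.max j j'))
    simp only [← whiskerLeft_comp_assoc, tensorHom_comp_tensorHom, h.w, h'.w] at e'
    simpa only [← whiskerLeft_comp_assoc, ← MonoidalCategory.tensorHom_def] using e'
  desc {Z Y} y hy := by
    -- The given diagonal family is extended to all pairs of indices through a chosen upper bound.
    let u (j j' : J) : Z ⊗ G j ⊗ G' j' ⟶ Y :=
      (Z ◁ (t (IsFiltered.leftToMax j j') ⊗ₘ t' (IsFiltered.rightToMax j j'))) ≫
        y (IsFiltered.max j j')
    -- Any other upper bound and any other arrows give the same morphism: `IsFiltered.bowtie`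
    -- equalises both pairs of arrows further on.
    have hu {j j' k : J} (a : j ⟶ k) (b : j' ⟶ k) : u j j' = (Z ◁ (t a ⊗ₘ t' b)) ≫ y k := by
      obtain ⟨s, α, β, e₁, e₂⟩ := IsFiltered.bowtie (IsFiltered.leftToMax j j') a
        (IsFiltered.rightToMax j j') b
      simp only [u]
      rw [← hy α, ← hy β, ← whiskerLeft_comp_assoc, ← whiskerLeft_comp_assoc,
        tensorHom_comp_tensorHom, tensorHom_comp_tensorHom, ← h.t_comp, ← h.t_comp, ← h'.t_comp,
        ← h'.t_comp, e₁, e₂]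
    have hu₁ {j₁ j₂ j' : J} (f : j₁ ⟶ j₂) : (Z ◁ (t f ▷ G' j')) ≫ u j₂ j' = u j₁ j' := by
      rw [hu (f ≫ IsFiltered.leftToMax j₂ j') (IsFiltered.rightToMax j₂ j'),
        ← whiskerLeft_comp_assoc, ← tensorHom_id, tensorHom_comp_tensorHom, ← h.t_comp,
        Category.id_comp]
    have hu₂ {j j₁ j₂ : J} (f : j₁ ⟶ j₂) : (Z ◁ (G j ◁ t' f)) ≫ u j j₂ = u j j₁ := by
      rw [hu (IsFiltered.leftToMax j j₂) (f ≫ IsFiltered.rightToMax j j₂),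
        ← whiskerLeft_comp_assoc, ← id_tensorHom (G j) (t' f), tensorHom_comp_tensorHom, ← h'.t_comp,
        Category.id_comp]
    -- The second variable is descended with `j` fixed; compatibility of the results in `j` then
    -- permits descent in the first variable.
    choose v hv using fun j => h'.desc₂ (Z := Z) (B := G j) (u j) hu₂
    obtain ⟨g, hg⟩ := h.desc₁ (Z := Z) (B := X') v fun {j₁ j₂} f => h'.ext₂ _ _ fun j' => by
      rw [hv, ← whiskerLeft_comp_assoc, whisker_exchange, whiskerLeft_comp_assoc, hv, hu₁]
    refine ⟨g, fun j => ?_⟩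
    -- The two arrows from `j` to its upper bound are chosen equal, so that the diagonal
    -- compatibility `hy` returns `y j`.
    rw [tensorHom_def', whiskerLeft_comp_assoc, hg, hv, hu (IsFiltered.leftToMax j j) (IsFiltered.leftToMax j j),
      hy]

lemma tensOn {κ : Type*} {G : κ → J → C} {t : ∀ i {j j' : J}, (j ⟶ j') → (G i j ⟶ G i j')}
    {X : κ → C} {ι : ∀ i j, G i j ⟶ X i} (h : ∀ i, StableColimit (G i) (t i) (X i) (ι i))
    (s : List κ) : StableColimit (fun j => tensOn (fun i => G i j) s)
      (fun f => tensOnMap (fun i => t i f) s) (tensOn X s)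
      (fun j => tensOnMap (fun i => ι i j) s) := by
  induction s with
  | nil => exact const (𝟙_ C)
  | cons a s ih => exact (h a).tensor ih

end StableColimit

/-- The families of morphisms which are stable filtered colimits. -/
def stableColimitEpiClass (C : Type u) [Category.{v} C] [MonoidalCategory C]
    [SymmetricCategory C] (J : Type u') [Category.{v'} J] [IsFiltered J] :
    EpiClass (fun _ : J => 𝟭 C) where
  -- The transition morphisms are existentially quantified because an `EpiClass` only sees the
  -- family of inclusions.
  mem {X Y} x := ∃ t : ∀ {j j' : J}, (j ⟶ j') → (X j ⟶ X j'), StableColimit X t Y x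
  unit := ⟨_, .const (𝟙_ C)⟩
  tensor := by
    rintro X X' Y Y' x x' ⟨t, h⟩ ⟨t', h'⟩
    refine ⟨fun f => t f ⊗ₘ t' f, ?_⟩
    simp only [tensorLax_id]
    exact h.tensor h'
  ext := by
    rintro X Y x ⟨t, h⟩ Z f g e
    exact h.ext₀ f g e

end StableColimit

end OperadDescent


namespace OperadDescent

noncomputable section

/-! ### Limits of operads and algebras -/

section Limits

variable {C : Type u} [Category.{v} C] {J : Type u'} [Category.{v'} J]

/-- The cone given by a compatible family of morphisms. -/
def familyCone (G : J ⥤ C) {V : C} (y : ∀ j, V ⟶ G.obj j)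
    (hy : ∀ {j j' : J} (f : j ⟶ j'), y j ≫ G.map f = y j') : Cone G where
  pt := V
  π := { app := y
         naturality := fun _ _ f => (Category.id_comp _).trans (hy f).symm }

lemma comp_comp_of_eq {A B A' K K' : C} {a : A ⟶ B} {b : B ⟶ A'} {c : A ⟶ A'} {k : B ⟶ K}
    {k' : A' ⟶ K'} {r : K ⟶ K'} (e : a ≫ b = c) (h : k ≫ r = b ≫ k') : (a ≫ k) ≫ r = c ≫ k' := by
  rw [Category.assoc, h, ← e, Category.assoc]

variable [MonoidalCategory C]

/-- This checks that the operations on the terms of a diagram, applied to a cone, form a cone again.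
-/
lemma tensorHom_tensMap_comp {l : ℕ} {A B A' K K' : C} {X Y Z : Fin l → C} {a : A ⟶ B}
    {b : B ⟶ A'} {c : A ⟶ A'} {x : ∀ i, X i ⟶ Y i} {y : ∀ i, Y i ⟶ Z i} {z : ∀ i, X i ⟶ Z i}
    {k : B ⊗ tens Y ⟶ K} {k' : A' ⊗ tens Z ⟶ K'} {r : K ⟶ K'} (e : a ≫ b = c)
    (e' : ∀ i, x i ≫ y i = z i) (h : k ≫ r = (b ⊗ₘ tensMap y) ≫ k') :
    ((a ⊗ₘ tensMap x) ≫ k) ≫ r = (c ⊗ₘ tensMap z) ≫ k' := by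
  obtain rfl : (fun i => x i ≫ y i) = z := funext e'
  rw [Category.assoc, h, tensMap_comp, ← e, tensorHom_comp_tensorHom_assoc]

variable [SymmetricCategory C]

section Operad

variable {F : J ⥤ Operad C} (c : ∀ l, Cone (F ⋙ Operad.arity C l)) (hc : ∀ l, IsLimit (c l))

/-- The raw operad structure on the limits of the components. -/
def Operad.limitPre : PreOperad C where
  obj l := (c l).pt
  act {l} σ := (hc l).lift (familyCone (F ⋙ Operad.arity C l)
    (fun j => (c l).π.app j ≫ (F.obj j).act σ)
    fun {j j'} f => comp_comp_of_eq ((c l).w f) ((F.map f).act_app σ))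
  comp l m n h := (hc n).lift (familyCone (F ⋙ Operad.arity C n)
    (fun j => ((c l).π.app j ⊗ₘ tensMap (fun i => (c (m i)).π.app j)) ≫ (F.obj j).comp l m n h)
    fun {j j'} f => tensorHom_tensMap_comp ((c l).w f) (fun i => (c (m i)).w f)
      ((F.map f).comp_app l m n h))
  unit := (hc 1).lift (familyCone (F ⋙ Operad.arity C 1) (fun j => (F.obj j).unit)
    fun f => (F.map f).unit_app)

lemma Operad.limitPre_isLaxHom (j : J) :
    IsLaxHom (𝟭 C) (Operad.limitPre c hc) (F.obj j).toPre (fun l => (c l).π.app j) :=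
  (isLaxHom_id_iff _).2 ⟨fun σ => (hc _).fac _ j, fun l m n h => (hc n).fac _ j, (hc 1).fac _ j⟩

/-- The limit of a diagram of operads with given limits of components. -/
def Operad.limitCone : Cone F where
  pt := (Operad.limitPre c hc).toOperad (.of_mono (Operad.limitPre_isLaxHom c hc)
    (fun j => (F.obj j).isOperad) fun l _ _ _ h => (hc l).hom_ext h)
  π :=
    { app := fun j => Operad.Hom.ofLax (fun l => (c l).π.app j) (Operad.limitPre_isLaxHom c hc j)
      naturality := fun _ _ f => Operad.Hom.ext (funext fun l => (c l).π.naturality f) }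

/-- The limit of a diagram of operads is computed on components. -/
def Operad.limitConeIsLimit : IsLimit (Operad.limitCone c hc) where
  lift s := Operad.Hom.ofLax (fun l => (hc l).lift ((Operad.arity C l).mapCone s))
    (.cancel (fun l _ _ _ h => (hc l).hom_ext h) (fun j => (s.π.app j).isLaxHom)
      (Operad.limitPre_isLaxHom c hc) _ fun j l => (hc l).fac _ j)
  fac s j := Operad.Hom.ext (funext fun l => (hc l).fac _ j)
  uniq s m hm := Operad.Hom.ext (funext fun l => (hc l).uniq ((Operad.arity C l).mapCone s) _
    fun j => congrArg (fun f => Operad.Hom.app f l) (hm j))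

end Operad

section Algebra

variable {F : J ⥤ OperadAlgebra C} (p : Cone (F ⋙ OperadAlgebra.toOperad C))
  (c : Cone (F ⋙ OperadAlgebra.forget C)) (hc : IsLimit c)

/-- The raw algebra structure, over an operad `p.pt`, on the limit of the underlying objects. -/
def OperadAlgebra.limitPre : PreAlgebra p.pt.obj where
  obj := c.pt
  act l := hc.lift (familyCone (F ⋙ OperadAlgebra.forget C)
    (fun j => ((p.π.app j).app l ⊗ₘ tensMap (fun _ => c.π.app j)) ≫ (F.obj j).algebra.act l)
    fun {j j'} f => tensorHom_tensMap_comp (congrArg (fun f => Operad.Hom.app f l) (p.w f))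
      (fun _ => c.w f) ((F.map f).act_hom l))

lemma OperadAlgebra.limitPre_isLaxAlgHom (j : J) :
    IsLaxAlgHom (𝟭 C) (OperadAlgebra.limitPre p c hc) (F.obj j).algebra.toPre
      (p.π.app j).app (c.π.app j) :=
  (isLaxAlgHom_id_iff _ _).2 fun _ => hc.fac _ j

/-- The cone of pairs with a given cone of operads and a given limit of the underlying objects of
the algebras. -/
def OperadAlgebra.limitCone : Cone F where
  pt := ⟨p.pt, (OperadAlgebra.limitPre p c hc).toAlgebra p.pt (.of_mono
    (fun j => (p.π.app j).isLaxHom) (OperadAlgebra.limitPre_isLaxAlgHom p c hc)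
    (fun j => (F.obj j).algebra.isAlgebra) fun _ _ _ h => hc.hom_ext h)⟩
  π :=
    { app := fun j => OperadAlgebra.Hom.ofLax (p.π.app j) (c.π.app j)
        (OperadAlgebra.limitPre_isLaxAlgHom p c hc j)
      naturality := fun _ _ f => OperadAlgebra.Hom.ext (p.π.naturality f) (c.π.naturality f) }

/-- The morphism of pairs given by a morphism of operads to `p.pt` and by the universal property
of the limit of the underlying objects. -/
def OperadAlgebra.limitLift (s : Cone F) (u : s.pt.operad ⟶ p.pt)
    (hu : ∀ j, u ≫ p.π.app j = (s.π.app j).operadHom) :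
    s.pt ⟶ (OperadAlgebra.limitCone p c hc).pt :=
  OperadAlgebra.Hom.ofLax u (hc.lift ((OperadAlgebra.forget C).mapCone s))
    (.cancel (fun _ _ _ h => hc.hom_ext h) (fun j => (s.π.app j).isLaxAlgHom)
      (OperadAlgebra.limitPre_isLaxAlgHom p c hc) _ _
      (fun j l => congrArg (fun f => Operad.Hom.app f l) (hu j)) fun j => hc.fac _ j)

/-- The limit of a diagram of pairs is computed on components. -/
def OperadAlgebra.limitConeIsLimit (hp : IsLimit p) : IsLimit (OperadAlgebra.limitCone p c hc) where
  lift s := OperadAlgebra.limitLift p c hc s (hp.lift ((OperadAlgebra.toOperad C).mapCone s))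
    fun j => hp.fac _ j
  fac s j := OperadAlgebra.Hom.ext (hp.fac _ j) (hc.fac _ j)
  uniq s m hm := OperadAlgebra.Hom.ext
    (hp.uniq ((OperadAlgebra.toOperad C).mapCone s) _
      fun j => congrArg OperadAlgebra.Hom.operadHom (hm j))
    (hc.uniq ((OperadAlgebra.forget C).mapCone s) _ fun j => congrArg OperadAlgebra.Hom.hom (hm j))

end Algebra

section FixedOperad

variable {O : Operad C}

/-- The morphism of `O`-algebras given by a morphism of pairs above the identity of `O`. -/
def Operad.Algebra.homOfPair {A B : O.Algebra} (g : (⟨O, A⟩ : OperadAlgebra C) ⟶ ⟨O, B⟩)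
    (hg : g.operadHom = 𝟙 O) : A ⟶ B where
  hom := g.hom
  act_hom l := (g.act_hom l).trans (by
    rw [hg]
    exact congrArg (· ≫ B.act l) (id_tensorHom _ _))

variable {F : J ⥤ O.Algebra} (c : Cone (F ⋙ Operad.Algebra.forget O)) (hc : IsLimit c)

/-- The constant cone of operads given by a diagram of `O`-algebras. -/
def Operad.Algebra.constCone (F : J ⥤ O.Algebra) :
    Cone ((F ⋙ Operad.Algebra.toPair O) ⋙ OperadAlgebra.toOperad C) where
  pt := O
  π := { app := fun _ => 𝟙 O }

/-- The limit of a diagram of `O`-algebras with given limit of underlying objects. -/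
def Operad.Algebra.limitCone : Cone F where
  pt := (OperadAlgebra.limitCone (Operad.Algebra.constCone F) c hc).pt.algebra
  π :=
    { app := fun j => Operad.Algebra.homOfPair
        ((OperadAlgebra.limitCone (Operad.Algebra.constCone F) c hc).π.app j) rfl
      naturality := fun _ _ f => Operad.Algebra.Hom.ext (c.π.naturality f) }

/-- The limit of a diagram of `O`-algebras is computed on underlying objects. -/
def Operad.Algebra.limitConeIsLimit : IsLimit (Operad.Algebra.limitCone c hc) where
  -- The constant cone at `O` need not be a limit of operads. For `O`-algebras the operad part of
  -- the lift is prescribed to be `𝟙 O`, so only the limit of underlying objects is used.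
  lift s := Operad.Algebra.homOfPair (OperadAlgebra.limitLift (Operad.Algebra.constCone F) c hc
    ((Operad.Algebra.toPair O).mapCone s) (𝟙 O) fun _ => Category.id_comp _) rfl
  fac s j := Operad.Algebra.Hom.ext (hc.fac _ j)
  uniq s m hm := Operad.Algebra.Hom.ext (hc.uniq ((Operad.Algebra.forget O).mapCone s) _
    fun j => congrArg Operad.Algebra.Hom.hom (hm j))

end FixedOperad

end Limits

end

end OperadDescent


namespace OperadDescent

noncomputable section

/-! ### Filtered colimits of operads and algebras -/

section Colimits

variable {C : Type u} [Category.{v} C] [MonoidalCategory C] {J : Type u'} [Category.{v'} J]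

namespace StableColimit

variable {G : J → C} {t : ∀ {j j' : J}, (j ⟶ j') → (G j ⟶ G j')} {X : C} {ι : ∀ j, G j ⟶ X}
  (h : StableColimit G t X ι)

/-- The compatible families of morphisms from the objects of the diagram. -/
def Family (G : J → C) (t : ∀ {j j' : J}, (j ⟶ j') → (G j ⟶ G j')) (Y : C) :=
  {y : ∀ j, G j ⟶ Y // ∀ {j j' : J} (f : j ⟶ j'), t f ≫ y j' = y j}

variable {Y : C} (y : Family G t Y)

/-- The morphism given by the universal property of a colimit. -/
def descHom : X ⟶ Y := (h.desc₀ y.1 y.2).choose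

lemma fac (j : J) : ι j ≫ h.descHom y = y.1 j := (h.desc₀ y.1 y.2).choose_spec j

lemma uniq (m : X ⟶ Y) (hm : ∀ j, ι j ≫ m = y.1 j) : m = h.descHom y :=
  h.ext₀ _ _ fun j => (hm j).trans (h.fac y j).symm

end StableColimit

lemma comp_comp_of_eq' {A B K K' L : C} {a : A ⟶ B} {k : A ⟶ K} {k' : B ⟶ K'} {r : K ⟶ K'}
    {i : K ⟶ L} {i' : K' ⟶ L} (h : k ≫ r = a ≫ k') (e : r ≫ i' = i) : a ≫ k' ≫ i' = k ≫ i := by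
  rw [← Category.assoc, ← h, Category.assoc, e]

lemma comp_eq_comp_of_eq {A K M : C} {a : A ⟶ K} {r : K ⟶ M} {i : A ⟶ M} {k : A ⟶ A}
    {k' : K ⟶ K} {k'' : M ⟶ M} (e : a ≫ r = i) (h : k ≫ a = a ≫ k') (h' : k ≫ i = i ≫ k'') :
    a ≫ k' ≫ r = a ≫ r ≫ k'' := by
  rw [← Category.assoc, ← h, Category.assoc, e, h', ← e, Category.assoc]

variable [SymmetricCategory C] [IsFiltered J]

lemma StableColimit.tensorTens {l : ℕ} {A : J → C} {a : ∀ {j j' : J}, (j ⟶ j') → (A j ⟶ A j')}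
    {B : C} {b : ∀ j, A j ⟶ B} (h : StableColimit A a B b) {G : Fin l → J → C}
    {t : ∀ i {j j' : J}, (j ⟶ j') → (G i j ⟶ G i j')} {X : Fin l → C} {ι : ∀ i j, G i j ⟶ X i}
    (h' : ∀ i, StableColimit (G i) (t i) (X i) (ι i)) :
    StableColimit (fun j => A j ⊗ tens (fun i => G i j))
      (fun f => a f ⊗ₘ tensMap (fun i => t i f)) (B ⊗ tens X)
      (fun j => b j ⊗ₘ tensMap (fun i => ι i j)) :=
  h.tensor (.tensOn h' _)

/-- A morphism from a stable colimit is compatible with operations if its composites with the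
canonical morphisms are compatible with the operations. -/
lemma StableColimit.comp_eq {l : ℕ} {A : J → C} {a : ∀ {j j' : J}, (j ⟶ j') → (A j ⟶ A j')}
    {B : C} {b : ∀ j, A j ⟶ B} (h : StableColimit A a B b) {G : Fin l → J → C}
    {t : ∀ i {j j' : J}, (j ⟶ j') → (G i j ⟶ G i j')} {X : Fin l → C} {ι : ∀ i j, G i j ⟶ X i}
    (h' : ∀ i, StableColimit (G i) (t i) (X i) (ι i)) {K : J → C} {L M B' : C} {X' : Fin l → C}
    {k : ∀ j, A j ⊗ tens (fun i => G i j) ⟶ K j} {k' : B ⊗ tens X ⟶ L}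
    {k'' : B' ⊗ tens X' ⟶ M} {r : ∀ j, K j ⟶ L} {g : L ⟶ M} {r' : ∀ j, K j ⟶ M} {b' : B ⟶ B'}
    {x' : ∀ i, X i ⟶ X' i} {b'' : ∀ j, A j ⟶ B'} {x'' : ∀ j i, G i j ⟶ X' i}
    (eb : ∀ j, b j ≫ b' = b'' j) (ex : ∀ j i, ι i j ≫ x' i = x'' j i) (er : ∀ j, r j ≫ g = r' j)
    (e : ∀ j, k j ≫ r j = (b j ⊗ₘ tensMap (fun i => ι i j)) ≫ k')
    (e' : ∀ j, k j ≫ r' j = (b'' j ⊗ₘ tensMap (x'' j)) ≫ k'') :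
    k' ≫ g = (b' ⊗ₘ tensMap x') ≫ k'' :=
  (h.tensorTens h').ext₀ _ _ fun j => by
    have ex' : (fun i => ι i j ≫ x' i) = x'' j := funext (ex j)
    rw [← Category.assoc, ← e, Category.assoc, er, e', ← eb, ← ex', tensMap_comp,
      ← tensorHom_comp_tensorHom_assoc]

section Operad

variable {F : J ⥤ Operad C} (c : ∀ l, Cocone (F ⋙ Operad.arity C l))
  (hc : ∀ l, StableColimit (fun j => (F.obj j).obj l) (fun f => (F.map f).app l) (c l).pt
    (fun j => (c l).ι.app j))

/-- The raw operad structure on the stable filtered colimits of the components. -/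
def Operad.colimitPre : PreOperad C where
  obj l := (c l).pt
  act {l} σ := (hc l).descHom
    ⟨fun j => (F.obj j).act σ ≫ (c l).ι.app j,
      fun f => comp_comp_of_eq' ((F.map f).act_app σ) ((c l).w f)⟩
  -- Stability of the component colimits under tensor products is what permits the composition to be
  -- defined stagewise.
  comp l m n h := ((hc l).tensorTens (fun i => hc (m i))).descHom
    ⟨fun j => (F.obj j).comp l m n h ≫ (c n).ι.app j,
      fun f => comp_comp_of_eq' ((F.map f).comp_app l m n h) ((c n).w f)⟩
  -- The unit object is regarded as the colimit of its constant diagram.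
  unit := (StableColimit.const (J := J) (𝟙_ C)).descHom
    ⟨fun j => (F.obj j).unit ≫ (c 1).ι.app j,
      fun f => comp_comp_of_eq' ((F.map f).unit_app.trans (Category.id_comp _).symm) ((c 1).w f)⟩

lemma Operad.colimitPre_isLaxHom (j : J) :
    IsLaxHom (𝟭 C) (F.obj j).toPre (Operad.colimitPre c hc) (fun l => (c l).ι.app j) :=
  (isLaxHom_id_iff _).2 ⟨fun _ => Eq.symm ((hc _).fac _ j),
    fun l m _ _ => Eq.symm (((hc l).tensorTens (fun i => hc (m i))).fac _ j),
    Eq.symm ((Category.id_comp _).symm.trans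
      ((StableColimit.const (J := J) (𝟙_ C)).fac _ j))⟩

/-- The filtered colimit of a diagram of operads with given stable colimits of components. -/
def Operad.colimitCocone : Cocone F where
  pt := (Operad.colimitPre c hc).toOperad ((stableColimitEpiClass C J).isOperad
    (Operad.colimitPre_isLaxHom c hc) (fun j => (F.obj j).isOperad) fun l => ⟨_, hc l⟩)
  ι :=
    { app := fun j => Operad.Hom.ofLax (fun l => (c l).ι.app j)
        (Operad.colimitPre_isLaxHom c hc j)
      naturality := fun _ _ f => Operad.Hom.ext (funext fun l => (c l).ι.naturality f) }

/-- The filtered colimit of a diagram of operads is computed on components. -/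
def Operad.colimitCoconeIsColimit : IsColimit (Operad.colimitCocone c hc) where
  desc s :=
    { app := fun l => (hc l).descHom ⟨fun j => (s.ι.app j).app l,
        fun f => congrArg (fun f => Operad.Hom.app f l) (s.w f)⟩
      act_app := fun σ => (hc _).ext₀ _ _ fun j => comp_eq_comp_of_eq
          ((hc _).fac _ j) (((Operad.colimitCocone c hc).ι.app j).act_app σ)
          ((s.ι.app j).act_app σ)
      comp_app := fun l m n h => (hc l).comp_eq (fun i => hc (m i)) (fun j => (hc l).fac _ j)
        (fun j i => (hc (m i)).fac _ j) (fun j => (hc n).fac _ j)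
        (fun j => ((Operad.colimitCocone c hc).ι.app j).comp_app l m n h)
        (fun j => (s.ι.app j).comp_app l m n h)
      unit_app := by
        -- Compatibility with units can be read off at any single index.
        obtain ⟨j⟩ : Nonempty J := IsFiltered.nonempty
        refine Eq.trans ?_ (s.ι.app j).unit_app
        refine (congrArg (· ≫ _) ((Operad.colimitCocone c hc).ι.app j).unit_app).symm.trans ?_
        exact (Category.assoc _ _ _).trans (congrArg ((F.obj j).unit ≫ ·) ((hc 1).fac _ j)) }
  fac s j := Operad.Hom.ext (funext fun l => (hc l).fac _ j)
  uniq s m hm := Operad.Hom.ext (funext fun l => (hc l).uniq _ _ fun j =>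
    congrArg (fun f => Operad.Hom.app f l) (hm j))

end Operad

section Algebra

variable {F : J ⥤ OperadAlgebra C} (p : Cocone (F ⋙ OperadAlgebra.toOperad C))
  (hp : ∀ l, StableColimit (fun j => (F.obj j).operad.obj l)
    (fun f => (F.map f).operadHom.app l) (p.pt.obj l) (fun j => (p.ι.app j).app l))
  (c : Cocone (F ⋙ OperadAlgebra.forget C))
  (hc : StableColimit (fun j => (F.obj j).algebra.obj) (fun f => (F.map f).hom) c.pt
    (fun j => c.ι.app j))

/-- The raw algebra structure, over a stable colimit of operads, on the stable colimit of the
underlying objects. -/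
def OperadAlgebra.colimitPre : PreAlgebra p.pt.obj where
  obj := c.pt
  act l := ((hp l).tensorTens (fun _ => hc)).descHom
    ⟨fun j => (F.obj j).algebra.act l ≫ c.ι.app j,
      fun f => comp_comp_of_eq' ((F.map f).act_hom l) (c.w f)⟩

lemma OperadAlgebra.colimitPre_isLaxAlgHom (j : J) :
    IsLaxAlgHom (𝟭 C) (F.obj j).algebra.toPre (OperadAlgebra.colimitPre p hp c hc)
      (p.ι.app j).app (c.ι.app j) :=
  (isLaxAlgHom_id_iff _ _).2 fun l => Eq.symm (((hp l).tensorTens (fun _ => hc)).fac _ j)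

/-- The cocone of pairs with a given cocone of operads and a given stable colimit of the underlying
objects of the algebras. -/
def OperadAlgebra.colimitCocone : Cocone F where
  pt := ⟨p.pt, (OperadAlgebra.colimitPre p hp c hc).toAlgebra p.pt
    ((stableColimitEpiClass C J).isAlgebra (fun j => (p.ι.app j).isLaxHom)
      (OperadAlgebra.colimitPre_isLaxAlgHom p hp c hc) (fun j => (F.obj j).algebra.isAlgebra)
      (fun l => ⟨_, hp l⟩) ⟨_, hc⟩)⟩
  ι :=
    { app := fun j => OperadAlgebra.Hom.ofLax (p.ι.app j) (c.ι.app j)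
        (OperadAlgebra.colimitPre_isLaxAlgHom p hp c hc j)
      naturality := fun _ _ f => OperadAlgebra.Hom.ext (p.ι.naturality f) (c.ι.naturality f) }

/-- The morphism of pairs given by a morphism of operads from `p.pt` and by the universal property
of the colimit of the underlying objects. -/
def OperadAlgebra.colimitDesc (s : Cocone F) (u : p.pt ⟶ s.pt.operad)
    (hu : ∀ j, p.ι.app j ≫ u = (s.ι.app j).operadHom) :
    (OperadAlgebra.colimitCocone p hp c hc).pt ⟶ s.pt where
  operadHom := u
  hom := hc.descHom
    ⟨fun j => (s.ι.app j).hom,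
      fun f => congrArg OperadAlgebra.Hom.hom (s.w f)⟩
  act_hom l := (hp l).comp_eq (fun _ => hc) (fun j => congrArg (fun f => Operad.Hom.app f l) (hu j))
    (fun j _ => hc.fac _ j) (fun j => hc.fac _ j)
    (fun j => ((OperadAlgebra.colimitCocone p hp c hc).ι.app j).act_hom l)
    (fun j => (s.ι.app j).act_hom l)

/-- The filtered colimit of a diagram of pairs is computed on components. -/
def OperadAlgebra.colimitCoconeIsColimit (hp' : IsColimit p) :
    IsColimit (OperadAlgebra.colimitCocone p hp c hc) where
  desc s := OperadAlgebra.colimitDesc p hp c hc s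
    (hp'.desc ((OperadAlgebra.toOperad C).mapCocone s)) fun j => hp'.fac _ j
  fac s j := OperadAlgebra.Hom.ext (hp'.fac _ j) (hc.fac _ j)
  uniq s m hm := OperadAlgebra.Hom.ext
    (hp'.uniq ((OperadAlgebra.toOperad C).mapCocone s) _
      fun j => congrArg OperadAlgebra.Hom.operadHom (hm j))
    (hc.uniq _ _ fun j => congrArg OperadAlgebra.Hom.hom (hm j))

end Algebra

section FixedOperad

variable {O : Operad C} {F : J ⥤ O.Algebra} (c : Cocone (F ⋙ Operad.Algebra.forget O))
  (hc : StableColimit (fun j => (F.obj j).obj) (fun f => (F.map f).hom) c.pt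
    (fun j => c.ι.app j))

/-- The constant cocone of operads given by a diagram of `O`-algebras. -/
def Operad.Algebra.constCocone (F : J ⥤ O.Algebra) :
    Cocone ((F ⋙ Operad.Algebra.toPair O) ⋙ OperadAlgebra.toOperad C) where
  pt := O
  ι := { app := fun _ => 𝟙 O }

/-- The filtered colimit of a diagram of `O`-algebras with given stable colimit of underlying
objects. -/
def Operad.Algebra.colimitCocone : Cocone F where
  pt := (OperadAlgebra.colimitCocone (Operad.Algebra.constCocone F) (fun l => .const (O.obj l))
    c hc).pt.algebra
  ι :=
    { app := fun j => Operad.Algebra.homOfPair ((OperadAlgebra.colimitCocone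
        (Operad.Algebra.constCocone F) (fun l => .const (O.obj l)) c hc).ι.app j) rfl
      naturality := fun _ _ f => Operad.Algebra.Hom.ext (c.ι.naturality f) }

/-- The filtered colimit of a diagram of `O`-algebras is computed on underlying objects. -/
def Operad.Algebra.colimitCoconeIsColimit : IsColimit (Operad.Algebra.colimitCocone c hc) where
  desc s := Operad.Algebra.homOfPair (OperadAlgebra.colimitDesc (Operad.Algebra.constCocone F)
    (fun l => .const (O.obj l)) c hc ((Operad.Algebra.toPair O).mapCocone s) (𝟙 O)
    fun _ => Category.id_comp _) rfl
  fac s j := Operad.Algebra.Hom.ext (hc.fac _ j)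
  uniq s m hm := Operad.Algebra.Hom.ext (hc.uniq _ _ fun j =>
    congrArg Operad.Algebra.Hom.hom (hm j))

end FixedOperad

end Colimits

end

end OperadDescent


namespace OperadDescent

noncomputable section

/-! ### Limits and filtered colimits of operads and algebras in a full subcategory -/

section Families

variable {ι : Type*} {E : Type u'} [Category.{v'} E] {D : Type u} [Category.{v} D]
  {J : Type u''} [Category.{v''} J]

/-- The limits of shape `J` exist in `E` and are computed through the functors `V i`. -/
structure ComputesLimits (V : ι → E ⥤ D) (J : Type u'') [Category.{v''} J] : Prop where
  hasLimits : HasLimitsOfShape J E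
  preservesLimits (i : ι) : PreservesLimitsOfShape J (V i)

/-- The colimits of shape `J` exist in `E` and are computed through the functors `V i`. -/
structure ComputesColimits (V : ι → E ⥤ D) (J : Type u'') [Category.{v''} J] : Prop where
  hasColimits : HasColimitsOfShape J E
  preservesColimits (i : ι) : PreservesColimitsOfShape J (V i)

/-- Limit cones being unique up to isomorphism, one limit cone of each diagram with limit images
gives both existence and preservation. -/
lemma ComputesLimits.of_exists {V : ι → E ⥤ D}
    (h : ∀ F : J ⥤ E, ∃ c : Cone F, Nonempty (IsLimit c) ∧
      ∀ i, Nonempty (IsLimit ((V i).mapCone c))) : ComputesLimits V J where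
  hasLimits := ⟨fun F => by
    obtain ⟨c, ⟨hc⟩, _⟩ := h F
    exact ⟨⟨c, hc⟩⟩⟩
  preservesLimits i := ⟨fun {F} => by
    obtain ⟨c, ⟨hc⟩, h'⟩ := h F
    exact preservesLimit_of_preserves_limit_cone hc (h' i).some⟩

lemma ComputesColimits.of_exists {V : ι → E ⥤ D}
    (h : ∀ F : J ⥤ E, ∃ c : Cocone F, Nonempty (IsColimit c) ∧
      ∀ i, Nonempty (IsColimit ((V i).mapCocone c))) : ComputesColimits V J where
  hasColimits := ⟨fun F => by
    obtain ⟨c, ⟨hc⟩, _⟩ := h F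
    exact ⟨⟨c, hc⟩⟩⟩
  preservesColimits i := ⟨fun {F} => by
    obtain ⟨c, ⟨hc⟩, h'⟩ := h F
    exact preservesColimit_of_preserves_colimit_cocone hc (h' i).some⟩

variable {Q : ObjectProperty E} {F : J ⥤ Q.FullSubcategory}

/-- A cone in the ambient category whose point is in the full subcategory. -/
def fullCone (c : Cone (F ⋙ Q.ι)) (h : Q c.pt) : Cone F where
  pt := ⟨c.pt, h⟩
  π :=
    { app := fun j => Q.homMk (c.π.app j)
      naturality := fun _ _ f => Q.hom_ext (c.π.naturality f) }

/-- A limit in the ambient category which is in the full subcategory is a limit there. -/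
def fullConeIsLimit {c : Cone (F ⋙ Q.ι)} (hc : IsLimit c) (h : Q c.pt) :
    IsLimit (fullCone c h) :=
  isLimitOfReflects Q.ι hc

/-- A cocone in the ambient category whose point is in the full subcategory. -/
def fullCocone (c : Cocone (F ⋙ Q.ι)) (h : Q c.pt) : Cocone F where
  pt := ⟨c.pt, h⟩
  ι :=
    { app := fun j => Q.homMk (c.ι.app j)
      naturality := fun _ _ f => Q.hom_ext (c.ι.naturality f) }

/-- A colimit in the ambient category which is in the full subcategory is a colimit there. -/
def fullCoconeIsColimit {c : Cocone (F ⋙ Q.ι)} (hc : IsColimit c) (h : Q c.pt) :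
    IsColimit (fullCocone c h) :=
  isColimitOfReflects Q.ι hc

end Families

section Subcategory

variable {C : Type u} [Category.{v} C] [MonoidalCategory C] [SymmetricCategory C]
  (P : ObjectProperty C) (J : Type u') [Category.{v'} J]

/-- The components of a pair of an operad and an algebra: the arities of the operad and the
underlying object of the algebra. -/
def algComponent : Option ℕ+ → (Alg P ⥤ P.FullSubcategory)
  | none => algForget P
  | some l => algOperad P ⋙ opArity P l

section Limits

variable [HasLimitsOfShape J P.FullSubcategory] [PreservesLimitsOfShape J P.ι]

/-- The limits of the components are formed in the full subcategory and remain limits in `C`. The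
operad built on them has its components in the subcategory, and its limit cone restricts arity-wise
to the chosen cones. -/
lemma op_computesLimits : ComputesLimits (opArity P) J := .of_exists fun F => by
  let d (l : ℕ+) := limit.cone (F ⋙ opArity P l)
  let c := Operad.limitCone (F := F ⋙ (opIn P).ι) (fun l => P.ι.mapCone (d l))
    fun l => isLimitOfPreserves P.ι (limit.isLimit _)
  have hc : IsLimit c := Operad.limitConeIsLimit _ _
  exact ⟨fullCone c fun l => (d l).pt.property, ⟨fullConeIsLimit hc _⟩,
    fun l => ⟨limit.isLimit (F ⋙ opArity P l)⟩⟩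

lemma alg_computesLimits : ComputesLimits (algComponent P) J := .of_exists fun F => by
  let d (l : ℕ+) := limit.cone (F ⋙ algOperad P ⋙ opArity P l)
  let p := Operad.limitCone (F := (F ⋙ (algIn P).ι) ⋙ OperadAlgebra.toOperad C)
    (fun l => P.ι.mapCone (d l)) fun l => isLimitOfPreserves P.ι (limit.isLimit _)
  have hp : IsLimit p := Operad.limitConeIsLimit _ _
  let d' := limit.cone (F ⋙ algForget P)
  let c := OperadAlgebra.limitCone (F := F ⋙ (algIn P).ι) p (P.ι.mapCone d')
    (isLimitOfPreserves P.ι (limit.isLimit _))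
  have hc : IsLimit c := OperadAlgebra.limitConeIsLimit _ _ _ hp
  refine ⟨fullCone c ⟨fun l => (d l).pt.property, d'.pt.property⟩, ⟨fullConeIsLimit hc _⟩, ?_⟩
  rintro (_ | l)
  · exact ⟨limit.isLimit (F ⋙ algForget P)⟩
  · exact ⟨limit.isLimit (F ⋙ algOperad P ⋙ opArity P l)⟩

lemma algOver_computesLimits (O : Operad C) :
    ComputesLimits (fun _ : Unit => algOverForget P O) J := .of_exists fun F => by
  let d := limit.cone (F ⋙ algOverForget P O)
  let c := Operad.Algebra.limitCone (F := F ⋙ (algOverIn P O).ι) (P.ι.mapCone d)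
    (isLimitOfPreserves P.ι (limit.isLimit _))
  have hc : IsLimit c := Operad.Algebra.limitConeIsLimit _ _
  exact ⟨fullCone c d.pt.property, ⟨fullConeIsLimit hc _⟩,
    fun _ => ⟨limit.isLimit (F ⋙ algOverForget P O)⟩⟩

end Limits

section Colimits

-- The preservation hypothesis for each `Z` says that `Z ⊗ -` sends the colimit cocone to a colimit
-- cocone in `C`; this supplies `ext` and `desc`.
variable {P J} in
lemma StableColimit.of_preserves (h : ∀ A : C, PreservesColimitsOfShape J (P.ι ⋙ tensorLeft A))
    {G : J ⥤ P.FullSubcategory} {d : Cocone G} (hd : IsColimit d) :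
    StableColimit (fun j => (G.obj j).obj) (fun f => (G.map f).hom) d.pt.obj
      (fun j => (d.ι.app j).hom) where
  t_comp f g := congrArg P.ι.map (G.map_comp f g)
  w f := congrArg P.ι.map (d.w f)
  ext {Z Y} f g e := by
    have := h Z
    exact (isColimitOfPreserves (P.ι ⋙ tensorLeft Z) hd).hom_ext e
  desc {Z Y} y hy := by
    have := h Z
    exact ⟨(isColimitOfPreserves (P.ι ⋙ tensorLeft Z) hd).desc
      { pt := Y
        ι := { app := y
               naturality := fun _ _ f => (hy f).trans (Category.comp_id _).symm } },
      fun j => (isColimitOfPreserves (P.ι ⋙ tensorLeft Z) hd).fac _ j⟩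

variable [IsFiltered J] [HasColimitsOfShape J P.FullSubcategory]
  (h : ∀ A : C, PreservesColimitsOfShape J (P.ι ⋙ tensorLeft A))

include h

lemma op_computesColimits : ComputesColimits (opArity P) J := .of_exists fun F => by
  let d (l : ℕ+) := colimit.cocone (F ⋙ opArity P l)
  let c := Operad.colimitCocone (F := F ⋙ (opIn P).ι) (fun l => P.ι.mapCocone (d l))
    fun l => .of_preserves h (colimit.isColimit (F ⋙ opArity P l))
  have hc : IsColimit c := Operad.colimitCoconeIsColimit _ _
  exact ⟨fullCocone c fun l => (d l).pt.property, ⟨fullCoconeIsColimit hc _⟩,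
    fun l => ⟨colimit.isColimit (F ⋙ opArity P l)⟩⟩

lemma alg_computesColimits : ComputesColimits (algComponent P) J := .of_exists fun F => by
  let d (l : ℕ+) := colimit.cocone (F ⋙ algOperad P ⋙ opArity P l)
  have hd (l : ℕ+) :=
    StableColimit.of_preserves h (colimit.isColimit (F ⋙ algOperad P ⋙ opArity P l))
  let p := Operad.colimitCocone (F := (F ⋙ (algIn P).ι) ⋙ OperadAlgebra.toOperad C)
    (fun l => P.ι.mapCocone (d l)) hd
  have hp : IsColimit p := Operad.colimitCoconeIsColimit _ _
  let d' := colimit.cocone (F ⋙ algForget P)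
  let c := OperadAlgebra.colimitCocone (F := F ⋙ (algIn P).ι) p hd (P.ι.mapCocone d')
    (.of_preserves h (colimit.isColimit (F ⋙ algForget P)))
  have hc : IsColimit c := OperadAlgebra.colimitCoconeIsColimit _ _ _ _ hp
  refine ⟨fullCocone c ⟨fun l => (d l).pt.property, d'.pt.property⟩,
    ⟨fullCoconeIsColimit hc _⟩, ?_⟩
  rintro (_ | l)
  · exact ⟨colimit.isColimit (F ⋙ algForget P)⟩
  · exact ⟨colimit.isColimit (F ⋙ algOperad P ⋙ opArity P l)⟩

lemma algOver_computesColimits (O : Operad C) :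
    ComputesColimits (fun _ : Unit => algOverForget P O) J := .of_exists fun F => by
  let d := colimit.cocone (F ⋙ algOverForget P O)
  let c := Operad.Algebra.colimitCocone (F := F ⋙ (algOverIn P O).ι) (P.ι.mapCocone d)
    (.of_preserves h (colimit.isColimit (F ⋙ algOverForget P O)))
  have hc : IsColimit c := Operad.Algebra.colimitCoconeIsColimit _ _
  exact ⟨fullCocone c d.pt.property, ⟨fullCoconeIsColimit hc _⟩,
    fun _ => ⟨colimit.isColimit (F ⋙ algOverForget P O)⟩⟩

end Colimits

end Subcategory

end

end OperadDescent


namespace OperadDescent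

noncomputable section

/-! ### Lifts of descent triples -/

section TripleLift

variable {E : Type u'} [Category.{v'} E] {D : Type u} [Category.{v} D]

namespace TripleLift

/-- The restriction of a lift to a full subcategory of the source. -/
def restrictSource {U : E ⥤ D} {T' : DescentTriple E} {T : DescentTriple D}
    (θ : TripleLift U T' T) (Q : ObjectProperty E)
    (h : ∀ X : SimplexCategory ⥤ E, (∀ n, Q (X.obj n)) → Q (T'.simple.obj X)) :
    TripleLift (Q.ι ⋙ U) (T'.restrict Q h) T where
  iso := NatIso.ofComponents (fun F => θ.iso.app (F ⋙ Q.ι))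
    fun f => θ.iso.hom.naturality (Functor.whiskerRight f Q.ι)
  mu Z := θ.mu (Z ⋙ (Functor.whiskeringRight SimplexCategory _ _).obj Q.ι)
  lam A := by
    refine Eq.trans ?_ (θ.lam A.obj)
    -- The identification of the constant object with its restriction is the identity in each
    -- degree, so it disappears once moved through `θ.iso`.
    have h := θ.iso.hom.naturality (Functor.constComp SimplexCategory A Q.ι).inv
    change U.map (T'.lam.app A.obj ≫ T'.simple.map (Functor.constComp SimplexCategory A Q.ι).inv) ≫
      θ.iso.hom.app ((cst _).obj A ⋙ Q.ι) ≫ _ = _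
    rw [U.map_comp, Category.assoc]
    refine congrArg (_ ≫ ·) ?_
    refine Eq.trans (Category.assoc _ _ _).symm (Eq.trans (congrArg (· ≫ _) h) ?_)
    refine Eq.trans (Category.assoc _ _ _) (congrArg (_ ≫ ·) ?_)
    refine Eq.trans (T.simple.map_comp _ _).symm (congrArg T.simple.map ?_)
    ext n
    exact (congrArg (· ≫ _) (U.map_id _)).trans (Category.comp_id _)

/-- A lift with values in a full subcategory of the target. -/
def restrictTarget {P : ObjectProperty D} {V : E ⥤ P.FullSubcategory} {T' : DescentTriple E}
    {T : DescentTriple D} (θ : TripleLift (V ⋙ P.ι) T' T)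
    (h : ∀ X : SimplexCategory ⥤ D, (∀ n, P (X.obj n)) → P (T.simple.obj X)) :
    TripleLift V T' (T.restrict P h) where
  iso := NatIso.ofComponents (fun F => P.fullyFaithfulι.preimageIso (θ.iso.app F))
    fun f => P.hom_ext (θ.iso.hom.naturality f)
  mu Z := P.hom_ext (θ.mu Z)
  lam A := P.hom_ext (by
    change (V.map (T'.lam.app A)).hom ≫ θ.iso.hom.app ((cst E).obj A) ≫ _ =
      T.lam.app (V.obj A).obj ≫ T.simple.map (Functor.constComp SimplexCategory (V.obj A) P.ι).inv
    have h := θ.lam A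
    change (V.map (T'.lam.app A)).hom ≫ _ = T.lam.app (V.obj A).obj at h
    rw [← h, Category.assoc, Category.assoc]
    refine congrArg (_ ≫ ·) (congrArg (_ ≫ ·) ?_)
    refine Eq.trans (congrArg T.simple.map ?_) (T.simple.map_comp _ _)
    ext n
    exact (Category.comp_id _).symm)

variable {U : E ⥤ D} {T' : DescentTriple E} {T : DescentTriple D} (θ : TripleLift U T' T)

instance isIso_hom (F : SimplexCategory ⥤ E) : IsIso (θ.hom F) :=
  inferInstanceAs (IsIso (θ.iso.hom.app F))

lemma hom_naturality {F G : SimplexCategory ⥤ E} (f : F ⟶ G) :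
    U.map (T'.simple.map f) ≫ θ.hom G =
      θ.hom F ≫ T.simple.map (Functor.whiskerRight f U) :=
  θ.iso.hom.naturality f

/-- The identification of diagonals is moved to the right, so that `θ` can be pushed past `μ'` in a
longer composite. -/
lemma mu_hom (Z : SimplexCategory ⥤ SimplexCategory ⥤ E) :
    U.map (T'.mu.app Z) ≫ θ.hom ((diag E).obj Z) =
      θ.hom (Z ⋙ T'.simple) ≫ T.simple.map (Functor.whiskerLeft Z θ.iso.hom) ≫
        T.mu.app (Z ⋙ (Functor.whiskeringRight SimplexCategory E D).obj U) ≫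
        T.simple.map (diagCompIso U Z).inv := by
  have key {A B A' B' : D} {X : SimplexCategory ⥤ D} {X' : SimplexCategory ⥤ D} (e : X ≅ X')
      (f : A ⟶ B) (g : B ⟶ T.simple.obj X) (f' : A ⟶ A') (g' : A' ⟶ B')
      (h' : B' ⟶ T.simple.obj X') (h : f ≫ g ≫ T.simple.map e.hom = f' ≫ g' ≫ h') :
      f ≫ g = f' ≫ g' ≫ h' ≫ T.simple.map e.inv := by
    rw [← cancel_mono (T.simple.map e.hom)]
    simp [h, ← Functor.map_comp]
  exact key _ _ _ _ _ _ (θ.mu Z)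

lemma lam_hom (A : E) :
    U.map (T'.lam.app A) ≫ θ.hom ((cst E).obj A) =
      T.lam.app (U.obj A) ≫ T.simple.map (Functor.constComp SimplexCategory A U).inv := by
  have key {A B : D} {X : SimplexCategory ⥤ D} {X' : SimplexCategory ⥤ D} (e : X ≅ X')
      (f : A ⟶ B) (g : B ⟶ T.simple.obj X)
      (h' : A ⟶ T.simple.obj X') (h : f ≫ g ≫ T.simple.map e.hom = h') :
      f ≫ g = h' ≫ T.simple.map e.inv := by
    rw [← cancel_mono (T.simple.map e.hom)]
    simp [h, ← Functor.map_comp]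
  exact key _ _ _ _ (θ.lam A)

/-- The isomorphism `θ.hom X` conjugates the composite for `T'` into the composite for `T`, which is
the identity. Naturality of `λ` at `θ.hom X` and of `μ` at the identification `e` absorb the
intermediate isomorphisms. -/
lemma outer {U : E ⥤ D} {T' : DescentTriple E} {T : DescentTriple D} (θ : TripleLift U T' T)
    (hT : T.IsNormalized) (X : SimplexCategory ⥤ E) :
    U.map (T'.lam.app (T'.simple.obj X) ≫
      T'.simple.map (Functor.constComp SimplexCategory X T'.simple).inv ≫
      T'.mu.app ((Functor.const SimplexCategory).obj X) ≫
      T'.simple.map (diagConstIso X).hom) = 𝟙 (U.obj (T'.simple.obj X)) := by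
  let e : (Functor.const SimplexCategory).obj X ⋙
      (Functor.whiskeringRight SimplexCategory E D).obj U ≅
      (Functor.const SimplexCategory).obj (X ⋙ U) := Functor.constComp _ _ _
  -- The diagram chase is isolated for arbitrary morphisms: composing with the isomorphism `t` lets
  -- it slide through one factor at a time.
  have key {A B : D} (t : A ⟶ B) [IsIso t] {A₁ A₂ A₃ B₁ B₂ B₃ A₁' A₂' A₃' : D} {l₀ : A ⟶ A₁'}
      {c₀ : A₁' ⟶ A₂'} {m₀ : A₂' ⟶ A₃'} {d₀ : A₃' ⟶ A} {t₁ : A₁' ⟶ A₁} {t₂ : A₂' ⟶ A₂}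
      {t₃ : A₃' ⟶ A₃} {l : A ⟶ B₁} {a₁ : B₁ ⟶ A₁} {a₂ : A₁ ⟶ A₂} {a₃ : A₂ ⟶ B₂} {m : B₂ ⟶ B₃}
      {b₁ : B₃ ⟶ A₃} {b₂ : A₃ ⟶ B} {W₁ W₂ W₃ : D} {c₁ : B₁ ⟶ W₁} {l' : B ⟶ W₁} {c₂ : W₁ ⟶ W₂}
      {c₃ : W₂ ⟶ B₂} {m' : W₂ ⟶ W₃} {d : W₃ ⟶ B₃} {f : W₃ ⟶ B}
      (h₁ : l₀ ≫ t₁ = l ≫ a₁) (h₂ : c₀ ≫ t₂ = t₁ ≫ a₂) (h₃ : m₀ ≫ t₃ = t₂ ≫ a₃ ≫ m ≫ b₁)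
      (h₄ : d₀ ≫ t = t₃ ≫ b₂) (ha : a₁ ≫ a₂ ≫ a₃ = c₁ ≫ c₂ ≫ c₃) (hb : c₃ ≫ m = m' ≫ d)
      (hc : d ≫ b₁ ≫ b₂ = f) (hd : l ≫ c₁ = t ≫ l') (hn : l' ≫ c₂ ≫ m' ≫ f = 𝟙 B) :
      l₀ ≫ c₀ ≫ m₀ ≫ d₀ = 𝟙 A := by
    rw [← cancel_mono t]
    simp only [Category.assoc]
    rw [h₄, reassoc_of% h₃, reassoc_of% h₂, reassoc_of% h₁, reassoc_of% ha, reassoc_of% hb, hc,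
      reassoc_of% hd, hn, Category.comp_id, Category.id_comp]
  rw [U.map_comp, U.map_comp, U.map_comp]
  refine key (θ.hom X) (θ.lam_hom _) (θ.hom_naturality _) (θ.mu_hom _) (θ.hom_naturality _)
    (c₁ := T.simple.map ((cst D).map (θ.hom X)))
    (c₂ := T.simple.map (Functor.constComp SimplexCategory (X ⋙ U) T.simple).inv)
    (c₃ := T.simple.map (Functor.whiskerRight e.inv T.simple)) ?_
    (T.mu.naturality e.inv) (f := T.simple.map (diagConstIso (X ⋙ U)).hom) ?_
    (T.lam.naturality (θ.hom X)).symm (hT.outer (X ⋙ U))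
  · refine ((T.simple.map_comp _ _).trans (congrArg (_ ≫ ·) (T.simple.map_comp _ _))).symm.trans
      ((congrArg T.simple.map ?_).trans
        ((T.simple.map_comp _ _).trans (congrArg (_ ≫ ·) (T.simple.map_comp _ _))))
    ext n
    change 𝟙 _ ≫ U.map (𝟙 _) ≫ θ.hom X = θ.hom X ≫ 𝟙 _ ≫ T.simple.map (𝟙 _)
    rw [U.map_id, T.simple.map_id, Category.id_comp, Category.id_comp, Category.id_comp]
    exact (Category.comp_id _).symm
  · refine ((T.simple.map_comp _ _).trans (congrArg (_ ≫ ·) (T.simple.map_comp _ _))).symm.trans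
      (congrArg T.simple.map ?_)
    ext n
    exact (Category.id_comp _).trans ((Category.id_comp _).trans (U.map_id _))

/-- The same conjugation, with the degreewise version of `lam_hom` in place of the naturality of `λ`
at `θ.hom X`. -/
lemma inner {U : E ⥤ D} {T' : DescentTriple E} {T : DescentTriple D} (θ : TripleLift U T' T)
    (hT : T.IsNormalized) (X : SimplexCategory ⥤ E) :
    U.map (T'.simple.map (Functor.whiskerLeft X T'.lam) ≫ T'.mu.app (X ⋙ cst E) ≫
      T'.simple.map (diagCompConstIso X).hom) = 𝟙 (U.obj (T'.simple.obj X)) := by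
  let e : (X ⋙ cst E) ⋙ (Functor.whiskeringRight SimplexCategory E D).obj U ≅
      (X ⋙ U) ⋙ cst D :=
    NatIso.ofComponents (fun n => Functor.constComp SimplexCategory (X.obj n) U)
  have key {A B : D} (t : A ⟶ B) [IsIso t] {A₂ A₃ B₂ B₃ A₂' A₃' : D}
      {c₀ : A ⟶ A₂'} {m₀ : A₂' ⟶ A₃'} {d₀ : A₃' ⟶ A} {t₂ : A₂' ⟶ A₂}
      {t₃ : A₃' ⟶ A₃} {a₂ : B ⟶ A₂} {a₃ : A₂ ⟶ B₂} {m : B₂ ⟶ B₃}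
      {b₁ : B₃ ⟶ A₃} {b₂ : A₃ ⟶ B} {W₂ W₃ : D} {c₂ : B ⟶ W₂}
      {c₃ : W₂ ⟶ B₂} {m' : W₂ ⟶ W₃} {d : W₃ ⟶ B₃} {f : W₃ ⟶ B}
      (h₂ : c₀ ≫ t₂ = t ≫ a₂) (h₃ : m₀ ≫ t₃ = t₂ ≫ a₃ ≫ m ≫ b₁)
      (h₄ : d₀ ≫ t = t₃ ≫ b₂) (ha : a₂ ≫ a₃ = c₂ ≫ c₃) (hb : c₃ ≫ m = m' ≫ d)
      (hc : d ≫ b₁ ≫ b₂ = f) (hn : c₂ ≫ m' ≫ f = 𝟙 B) :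
      c₀ ≫ m₀ ≫ d₀ = 𝟙 A := by
    rw [← cancel_mono t]
    simp only [Category.assoc]
    rw [h₄, reassoc_of% h₃, reassoc_of% h₂, reassoc_of% ha, reassoc_of% hb, hc,
      hn, Category.comp_id, Category.id_comp]
  rw [U.map_comp, U.map_comp]
  refine key (θ.hom X) (θ.hom_naturality _) (θ.mu_hom _) (θ.hom_naturality _)
    (c₂ := T.simple.map (Functor.whiskerLeft (X ⋙ U) T.lam))
    (c₃ := T.simple.map (Functor.whiskerRight e.inv T.simple)) ?_
    (T.mu.naturality e.inv) (f := T.simple.map (diagCompConstIso (X ⋙ U)).hom) ?_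
    (hT.inner (X ⋙ U))
  · refine (T.simple.map_comp _ _).symm.trans
      ((congrArg T.simple.map ?_).trans (T.simple.map_comp _ _))
    ext n
    exact θ.lam_hom (X.obj n)
  · refine ((T.simple.map_comp _ _).trans (congrArg (_ ≫ ·) (T.simple.map_comp _ _))).symm.trans
      (congrArg T.simple.map ?_)
    ext n
    exact (Category.id_comp _).trans ((Category.id_comp _).trans (U.map_id _))

end TripleLift

end TripleLift

end

end OperadDescent


namespace OperadDescent

noncomputable section

/-! ### Transfer of descent structures along families of functors -/

section Transfer

variable {E : Type u'} [Category.{v'} E] {D : Type u} [Category.{v} D]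

lemma IsDescent.mem_iff {T : DescentTriple D} {W : MorphismProperty D} (h : IsDescent T W)
    {A B : D} (f : A ⟶ B) : W f ↔ IsIso (W.Q.map f) :=
  ⟨W.Q_inverts f, h.saturated f⟩

/-- By saturation the equivalences are the inverse image of the isomorphisms of the localization. -/
lemma IsDescent.respectsIso {T : DescentTriple D} {W : MorphismProperty D} (h : IsDescent T W) :
    W.RespectsIso := by
  have e : W = (MorphismProperty.isomorphisms W.Localization).inverseImage W.Q := by
    ext A B f
    exact h.mem_iff f
  rw [e]
  infer_instance

/-- The class of morphisms sent to `W` by all the functors of a family. -/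
def familyInverseImage {ι : Type*} (V : ι → E ⥤ D) (W : MorphismProperty D) :
    MorphismProperty E :=
  fun _ _ f => ∀ i, W ((V i).map f)

section Family

variable {ι : Type*} {V : ι → E ⥤ D} {W : MorphismProperty D}

lemma familyInverseImage_saturated
    (hW : ∀ {A B : D} (f : A ⟶ B), IsIso (W.Q.map f) → W f) {A B : E} (f : A ⟶ B)
    (hf : IsIso ((familyInverseImage V W).Q.map f)) : familyInverseImage V W f := fun i => by
  -- Hence `V i ⋙ W.Q` factors through the localization of `E`, and `f`, being invertible there,
  -- becomes invertible in `D[W⁻¹]`; saturation of `W` then applies.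
  have h : (familyInverseImage V W).IsInvertedBy (V i ⋙ W.Q) := fun _ _ g hg => W.Q_inverts _ (hg i)
  apply hW
  exact (NatIso.isIso_map_iff (Localization.fac (V i ⋙ W.Q) h (familyInverseImage V W).Q) f).1
    (inferInstanceAs (IsIso ((Localization.lift (V i ⋙ W.Q) h _).map
      ((familyInverseImage V W).Q.map f))))

lemma familyInverseImage_isStableUnderLimitsOfShape {J : Type u''} [Category.{v''} J]
    (hV : ComputesLimits V J) (hW : W.IsStableUnderLimitsOfShape J) :
    (familyInverseImage V W).IsStableUnderLimitsOfShape J where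
  condition X₁ X₂ c₁ c₂ h₁ h₂ f hf φ hφ i := by
    have := hV.preservesLimits i
    refine hW.condition _ _ _ _ (isLimitOfPreserves (V i) h₁) (isLimitOfPreserves (V i) h₂)
      (Functor.whiskerRight f (V i)) (fun j => hf j i) _ fun j => ?_
    exact ((V i).map_comp _ _).symm.trans ((congrArg (V i).map (hφ j)).trans ((V i).map_comp _ _))

lemma familyInverseImage_isStableUnderColimitsOfShape {J : Type u''} [Category.{v''} J]
    (hV : ComputesColimits V J) (hW : W.IsStableUnderColimitsOfShape J) :
    (familyInverseImage V W).IsStableUnderColimitsOfShape J where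
  condition X₁ X₂ c₁ c₂ h₁ h₂ f hf φ hφ i := by
    have := hV.preservesColimits i
    refine hW.condition _ _ _ _ (isColimitOfPreserves (V i) h₁) (isColimitOfPreserves (V i) h₂)
      (Functor.whiskerRight f (V i)) (fun j => hf j i) _ fun j => ?_
    exact ((V i).map_comp _ _).symm.trans ((congrArg (V i).map (hφ j)).trans ((V i).map_comp _ _))

lemma ComputesLimits.of_equivalence {J : Type*} [Category* J] {J' : Type*} [Category* J']
    (hV : ComputesLimits V J) (e : J ≌ J') : ComputesLimits V J' where
  hasLimits := by
    have := hV.hasLimits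
    exact hasLimitsOfShape_of_equivalence e
  preservesLimits i := by
    have := hV.preservesLimits i
    exact preservesLimitsOfShape_of_equiv e (V i)

lemma ComputesLimits.finite (hV : ∀ I : Type w, ComputesLimits V (Discrete I)) (I : Type*)
    [Finite I] : ComputesLimits V (Discrete I) := by
  -- A finite index type in any universe is replaced by a copy of `Fin n` in universe `w`, where
  -- products are known to be computed.
  obtain ⟨n, ⟨e⟩⟩ := Finite.exists_equiv_fin I
  exact (hV (ULift (Fin n))).of_equivalence (Discrete.equivalence (Equiv.ulift.trans e.symm))

end Family

lemma mem_iff_of_square {W : MorphismProperty D} [W.RespectsIso] {A B A' B' : D} {f : A ⟶ B} {g : A' ⟶ B'} {a : A ⟶ A'} {b : B ⟶ B'}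
    [IsIso a] [IsIso b] (h : f ≫ b = a ≫ g) : W f ↔ W g :=
  W.arrow_mk_iso_iff (Arrow.isoMk (asIso a) (asIso b) h.symm)

section Power

variable (V : E ⥤ D)

/-- The powers of `A` are preserved by a functor which preserves finite products. -/
def powerIso [HasFiniteProducts E] [HasFiniteProducts D]
    [∀ k n : SimplexCategory, PreservesLimitsOfShape (Discrete (n ⟶ k)) V]
    (A : E) (k : SimplexCategory) : power A k ⋙ V ≅ power (V.obj A) k :=
  NatIso.ofComponents (fun n => PreservesProduct.iso V fun _ : (n ⟶ k) => A) fun {n n'} f => by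
    dsimp [power]
    ext g
    simp

lemma powerIso_hom_app_π [HasFiniteProducts E] [HasFiniteProducts D]
    [∀ k n : SimplexCategory, PreservesLimitsOfShape (Discrete (n ⟶ k)) V]
    (A : E) (k n : SimplexCategory) (g : n ⟶ k) :
    (powerIso V A k).hom.app n ≫ Pi.π (fun _ : (n ⟶ k) => V.obj A) g =
      V.map (Pi.π (fun _ : (n ⟶ k) => A) g) :=
  piComparison_comp_π _ _ _

/-- Both sides are determined by the projections, where they are `V` of the projection indexed by `g
≫ d`. -/
lemma powerIso_hom [HasFiniteProducts E] [HasFiniteProducts D]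
    [∀ k n : SimplexCategory, PreservesLimitsOfShape (Discrete (n ⟶ k)) V]
    (A : E) {k k' : SimplexCategory} (d : k ⟶ k') :
    Functor.whiskerRight (powerMap A d) V ≫ (powerIso V A k).hom =
      (powerIso V A k').hom ≫ powerMap (V.obj A) d := by
  ext n
  refine Pi.hom_ext _ _ fun g => ?_
  have h := powerIso_hom_app_π V A k n g
  have h' := powerIso_hom_app_π V A k' n (g ≫ d)
  refine (Category.assoc _ _ _).trans ((congrArg (_ ≫ ·) h).trans ?_)
  refine (V.map_comp _ _).symm.trans ((congrArg V.map (Pi.lift_π _ _)).trans (h'.symm.trans ?_))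
  refine Eq.trans ?_ (Category.assoc _ _ _).symm
  exact congrArg (_ ≫ ·) (Pi.lift_π (fun g => Pi.π (fun _ => V.obj A) (g ≫ d)) g).symm

lemma map_prodLift_comp [HasFiniteProducts E] [HasFiniteProducts D]
    [PreservesLimitsOfShape (Discrete WalkingPair) V] {S A B : E} (a : S ⟶ A) (b : S ⟶ B)
    {A' B' : D} (t : V.obj A ⟶ A') (t' : V.obj B ⟶ B') :
    V.map (prod.lift a b) ≫ (PreservesLimitPair.iso V A B).hom ≫ prod.map t t' =
      prod.lift (V.map a ≫ t) (V.map b ≫ t') := by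
  ext
  · rw [Category.assoc, Category.assoc, prod.map_fst, PreservesLimitPair.iso_hom,
      prodComparison_fst_assoc, ← V.map_comp_assoc, prod.lift_fst, prod.lift_fst]
  · rw [Category.assoc, Category.assoc, prod.map_snd, PreservesLimitPair.iso_hom,
      prodComparison_snd_assoc, ← V.map_comp_assoc, prod.lift_snd, prod.lift_snd]

end Power

section Square

variable {V : E ⥤ D} {T' : DescentTriple E} {T : DescentTriple D} (θ : TripleLift V T' T)
  {W : MorphismProperty D} [W.RespectsIso]

include θ

/-- The square in `TripleLift.mu` has invertible vertical sides, so its two horizontal arrows are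
isomorphic. The following lemmas proceed in the same way for the other descent axioms. -/
lemma mem_map_mu_iff (Z : SimplexCategory ⥤ SimplexCategory ⥤ E) :
    W (V.map (T'.mu.app Z)) ↔
      W (T.mu.app (Z ⋙ (Functor.whiskeringRight SimplexCategory E D).obj V)) := by
  have : IsIso (θ.hom ((diag E).obj Z) ≫ T.simple.map (diagCompIso V Z).hom) := inferInstance
  have : IsIso (T.simple.map (Functor.whiskerLeft Z θ.iso.hom)) := inferInstance
  have : IsIso (θ.hom (Z ⋙ T'.simple) ≫ T.simple.map (Functor.whiskerLeft Z θ.iso.hom)) :=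
    IsIso.comp_isIso
  exact mem_iff_of_square ((θ.mu Z).trans (Category.assoc _ _ _).symm)

lemma mem_map_lam_iff (A : E) : W (V.map (T'.lam.app A)) ↔ W (T.lam.app (V.obj A)) := by
  have : IsIso (θ.hom ((cst E).obj A) ≫
    T.simple.map (Functor.constComp SimplexCategory A V).hom) := inferInstance
  exact mem_iff_of_square (a := 𝟙 _) ((θ.lam A).trans (Category.id_comp _).symm)

lemma mem_map_simple_iff {X Y : SimplexCategory ⥤ E} (f : X ⟶ Y) :
    W (V.map (T'.simple.map f)) ↔ W (T.simple.map (Functor.whiskerRight f V)) :=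
  mem_iff_of_square (θ.hom_naturality f)

lemma mem_map_powerMap_iff [HasFiniteProducts E] [HasFiniteProducts D]
    [∀ k n : SimplexCategory, PreservesLimitsOfShape (Discrete (n ⟶ k)) V]
    (A : E) {k k' : SimplexCategory} (d : k ⟶ k') :
    W (V.map (T'.simple.map (powerMap A d))) ↔ W (T.simple.map (powerMap (V.obj A) d)) := by
  refine (mem_map_simple_iff θ _).trans (mem_iff_of_square
    (a := T.simple.map (powerIso V A k').hom) (b := T.simple.map (powerIso V A k).hom) ?_)
  rw [← T.simple.map_comp, powerIso_hom, T.simple.map_comp]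

lemma mem_map_additivity_iff [HasFiniteProducts E] [HasFiniteProducts D]
    [PreservesLimitsOfShape (Discrete WalkingPair) V] (X Y : SimplexCategory ⥤ E) :
    W (V.map (prod.lift (T'.simple.map (prod.fst : X ⨯ Y ⟶ X)) (T'.simple.map prod.snd))) ↔
      W (prod.lift (T.simple.map (prod.fst : (X ⋙ V) ⨯ (Y ⋙ V) ⟶ X ⋙ V))
        (T.simple.map prod.snd)) := by
  -- Products of cosimplicial objects are computed degreewise, so composition with `V` preserves
  -- them too.
  let G := (Functor.whiskeringRight SimplexCategory E D).obj V
  have h₁ : (PreservesLimitPair.iso G X Y).hom ≫ prod.fst = G.map prod.fst := by simp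
  have h₂ : (PreservesLimitPair.iso G X Y).hom ≫ prod.snd = G.map prod.snd := by simp
  refine mem_iff_of_square
    (a := θ.hom (X ⨯ Y) ≫ T.simple.map (PreservesLimitPair.iso G X Y).hom)
    (b := (PreservesLimitPair.iso V _ _).hom ≫ prod.map (θ.hom X) (θ.hom Y)) ?_
  rw [map_prodLift_comp, prod.comp_lift, θ.hom_naturality, θ.hom_naturality, Category.assoc,
    Category.assoc, ← T.simple.map_comp, ← T.simple.map_comp]
  exact congrArg₂ prod.lift (congrArg (_ ≫ ·) (congrArg T.simple.map h₁.symm))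
    (congrArg (_ ≫ ·) (congrArg T.simple.map h₂.symm))

end Square

section Descent

variable {ι : Type*} {V : ι → E ⥤ D} {T' : DescentTriple E} {T : DescentTriple D}
  (θ : ∀ i, TripleLift (V i) T' T) {W : MorphismProperty D}

-- Each axiom that some morphism be an equivalence is tested through the `V i`, by the preceding
-- comparisons. The compatibility of `λ` and `μ` is an equality of morphisms, and this is where
-- joint faithfulness is needed.
include θ in
lemma isDescent_familyInverseImage
    (hV : ∀ {A B : E} (f g : A ⟶ B), (∀ i, (V i).map f = (V i).map g) → f = g)
    (hL : ∀ I : Type w, ComputesLimits V (Discrete I)) (h : IsDescent T W) :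
    IsDescent T' (familyInverseImage V W) := by
  have := h.respectsIso
  have := h.hasFiniteProducts
  have : HasProducts.{w} E := fun I => (hL I).hasLimits
  have : HasFiniteProducts E := hasFiniteProducts_of_hasProducts.{w} E
  -- Needed for pairs, in additivity, and for the finite sets of simplices of `Δ[k]`, in acyclicity.
  have hp (i : ι) (I : Type) [Finite I] : PreservesLimitsOfShape (Discrete I) (V i) :=
    (ComputesLimits.finite hL I).preservesLimits i
  exact
    { saturated := familyInverseImage_saturated h.saturated
      products := ⟨fun I _ => familyInverseImage_isStableUnderLimitsOfShape
        (ComputesLimits.finite hL I) (h.products.isStableUnderProductsOfShape I)⟩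
      additivity := fun X Y i => (mem_map_additivity_iff (θ i) X Y).2 (h.additivity _ _)
      factorization := fun Z i => (mem_map_mu_iff (θ i) Z).2 (h.factorization _)
      normalization := fun A i => (mem_map_lam_iff (θ i) A).2 (h.normalization _)
      normalized := ⟨fun X => hV _ _ fun i => ((θ i).outer h.normalized X).trans
          ((V i).map_id _).symm,
        fun X => hV _ _ fun i => ((θ i).inner h.normalized X).trans ((V i).map_id _).symm⟩
      exactness := fun f hf i => (mem_map_simple_iff (θ i) f).2
        (h.exactness _ fun n => hf n i)
      acyclicity := fun A i => (mem_map_powerMap_iff (θ i) A _).2 (h.acyclicity _) }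

end Descent

/-! ### Comparison of stalks under a functor preserving filtered colimits. -/

section Stalks

variable {X : Type w} [SmallCategory X] {J : GrothendieckTopology X}
  [HasFilteredColimitsOfSize.{w, w} E] (Φ : GrothendieckTopology.Point.{w} J)

/-- The canonical morphism from the values at a neighbourhood of `Φ` to the stalks. -/
def toStalk (F : SimplexCategory ⥤ Xᵒᵖ ⥤ E) (e : Φ.fiber.Elementsᵒᵖ) :
    F.flip.obj ((CategoryOfElements.π Φ.fiber).op.obj e) ⟶ F ⋙ stalk E Φ where
  app k := colimit.ι ((CategoryOfElements.π Φ.fiber).op ⋙ F.obj k) e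
  naturality _ _ f := (ι_colimMap (Functor.whiskerLeft (CategoryOfElements.π Φ.fiber).op
    (F.map f)) e).symm

lemma ι_stalkComparison (s : (SimplexCategory ⥤ E) ⥤ E) (F : SimplexCategory ⥤ Xᵒᵖ ⥤ E)
    (e : Φ.fiber.Elementsᵒᵖ) :
    colimit.ι ((CategoryOfElements.π Φ.fiber).op ⋙ F.flip ⋙ s) e ≫ stalkComparison s Φ F =
      s.map (toStalk Φ F e) :=
  colimit.ι_desc _ _

variable [HasFilteredColimitsOfSize.{w, w} D] {V : E ⥤ D}
  [PreservesColimitsOfShape Φ.fiber.Elementsᵒᵖ V]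

/-- The stalks commute with a functor which preserves filtered colimits. -/
def stalkIso (F : SimplexCategory ⥤ Xᵒᵖ ⥤ E) :
    (F ⋙ stalk E Φ) ⋙ V ≅ (F ⋙ (Functor.whiskeringRight _ _ _).obj V) ⋙ stalk D Φ :=
  Functor.isoWhiskerLeft (F ⋙ (Functor.whiskeringLeft _ _ E).obj (CategoryOfElements.π Φ.fiber).op)
    (preservesColimitNatIso V)

lemma toStalk_stalkIso (F : SimplexCategory ⥤ Xᵒᵖ ⥤ E) (e : Φ.fiber.Elementsᵒᵖ) :
    Functor.whiskerRight (toStalk Φ F e) V ≫ (stalkIso Φ F).hom =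
      toStalk Φ (F ⋙ (Functor.whiskeringRight _ _ _).obj V) e := by
  ext k
  exact ι_preservesColimitIso_hom V ((CategoryOfElements.π Φ.fiber).op ⋙ F.obj k) e

variable {W : MorphismProperty D} [W.RespectsIso] {T' : DescentTriple E} {T : DescentTriple D}
  (θ : TripleLift V T' T)

-- Since `V` preserves the colimits defining stalks and commutes with the simple functors, it
-- carries one comparison morphism to the other up to isomorphism of arrows.
include θ in
lemma mem_map_stalkComparison_iff (F : SimplexCategory ⥤ Xᵒᵖ ⥤ E) :
    W (V.map (stalkComparison T'.simple Φ F)) ↔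
      W (stalkComparison T.simple Φ (F ⋙ (Functor.whiskeringRight _ _ _).obj V)) := by
  -- The isomorphism `a` first exchanges `V` with the colimit and then replaces `V s'` by `s V` on
  -- each neighbourhood.
  let π := (CategoryOfElements.π Φ.fiber).op
  let a : V.obj (colimit (π ⋙ F.flip ⋙ T'.simple)) ≅
      colimit (π ⋙ (F ⋙ (Functor.whiskeringRight _ _ _).obj V).flip ⋙ T.simple) :=
    preservesColimitIso V (π ⋙ F.flip ⋙ T'.simple) ≪≫ HasColimit.isoOfNatIso
      (F := (π ⋙ F.flip ⋙ T'.simple) ⋙ V)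
      (G := π ⋙ (F ⋙ (Functor.whiskeringRight _ _ _).obj V).flip ⋙ T.simple)
      (Functor.isoWhiskerLeft (π ⋙ F.flip) θ.iso)
  have ha (e : Φ.fiber.Elementsᵒᵖ) :
      V.map (colimit.ι (π ⋙ F.flip ⋙ T'.simple) e) ≫ a.hom =
        θ.hom (F.flip.obj (π.obj e)) ≫
          colimit.ι (π ⋙ (F ⋙ (Functor.whiskeringRight _ _ _).obj V).flip ⋙ T.simple) e := by
    refine (Category.assoc _ _ _).symm.trans ((congrArg (· ≫ _)
      (ι_preservesColimitIso_hom V (π ⋙ F.flip ⋙ T'.simple) e)).trans ?_)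
    exact HasColimit.isoOfNatIso_ι_hom _ _
  have key {A B A' B' R R' R'' : D} {f : A ⟶ B} {t : B ⟶ R'} {u : R' ⟶ B'} {b : A ⟶ A'}
      {g : A' ⟶ B'} {i : R ⟶ A} {i' : R'' ⟶ A'} {q : R ⟶ R''} {r : R ⟶ B} {p : R'' ⟶ R'}
      {p' : R'' ⟶ B'} (h₁ : i ≫ f = r) (h₂ : r ≫ t = q ≫ p) (h₃ : p ≫ u = p')
      (h₄ : i ≫ b = q ≫ i') (h₅ : i' ≫ g = p') : i ≫ f ≫ t ≫ u = i ≫ b ≫ g := by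
    rw [reassoc_of% h₁, reassoc_of% h₂, h₃, reassoc_of% h₄, h₅]
  refine W.arrow_mk_iso_iff (Arrow.isoMk a
    (asIso (θ.hom (F ⋙ stalk E Φ)) ≪≫ T.simple.mapIso (stalkIso Φ F)) (Eq.symm ?_))
  -- Both paths start from the image under `V` of a colimit, which is a colimit again, so they are
  -- compared on each neighbourhood `e`.
  refine (isColimitOfPreserves V (colimit.isColimit (π ⋙ F.flip ⋙ T'.simple))).hom_ext fun e => ?_
  exact key ((V.map_comp _ _).symm.trans (congrArg V.map (ι_stalkComparison Φ T'.simple F e)))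
    (θ.hom_naturality (toStalk Φ F e))
    ((T.simple.map_comp _ _).symm.trans (congrArg T.simple.map (toStalk_stalkIso Φ F e)))
    (ha e) (ι_stalkComparison Φ T.simple (F ⋙ (Functor.whiskeringRight _ _ _).obj V) e)

end Stalks

section Compatible

variable {X : Type w} [SmallCategory X] {J : GrothendieckTopology X}
  {Ξ : ObjectProperty (GrothendieckTopology.Point.{w} J)} {ι : Type*} {V : ι → E ⥤ D}
  {T' : DescentTriple E} {T : DescentTriple D} {W : MorphismProperty D}

/-- A descent structure, compatible with a site, is transferred along a jointly faithful family of
functors through which the products, the filtered colimits and the descent triple are computed. -/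
lemma isCompatible_familyInverseImage (θ : ∀ i, TripleLift (V i) T' T)
    (hV : ∀ {A B : E} (f g : A ⟶ B), (∀ i, (V i).map f = (V i).map g) → f = g)
    (hL : ∀ I : Type w, ComputesLimits V (Discrete I))
    (hC : ∀ (K : Type w) [SmallCategory K] [IsFiltered K], ComputesColimits V K)
    {S : ObjectProperty (Xᵒᵖ ⥤ D)} {S' : ObjectProperty (Xᵒᵖ ⥤ E)}
    (hS : ∀ (F : Xᵒᵖ ⥤ E), S' F → ∀ i, S (F ⋙ V i)) (h : IsCompatible Ξ T W S) :
    IsCompatible Ξ T' (familyInverseImage V W) S' := by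
  have := h.isDescent.respectsIso
  have := h.hasFilteredColimits
  have : HasFilteredColimitsOfSize.{w, w} E := ⟨fun K => (hC K).hasColimits⟩
  exact
    { isDescent := isDescent_familyInverseImage θ hV hL h.isDescent
      hasFilteredColimits := this
      hasProducts := fun I => (hL I).hasLimits
      filteredColimits_exact := ⟨fun K _ _ => familyInverseImage_isStableUnderColimitsOfShape (hC K)
        (h.filteredColimits_exact.isStableUnderColimitsOfShape K)⟩
      products_exact := fun I => familyInverseImage_isStableUnderLimitsOfShape (hL I)
        (h.products_exact I)
      stalks := fun F hF Φ hΦ i => by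
        -- The opposite category of neighbourhoods of a point is small and filtered.
        have := (hC Φ.fiber.Elementsᵒᵖ).preservesColimits i
        exact (mem_map_stalkComparison_iff Φ (θ i) F).2
          (h.stalks _ (fun k => hS _ (hF k) i) Φ hΦ) }

end Compatible

end Transfer

end

end OperadDescent


namespace OperadDescent

noncomputable section

/-! ### Descent structures on operads and algebras -/

section Main

variable {C : Type u} [Category.{v} C] [MonoidalCategory C] [SymmetricCategory C]
  {P : ObjectProperty C} (𝒟 : MonoidalDescentSubcategory C P)

instance : NatTrans.IsMonoidal 𝒟.triple.mu := 𝒟.mu_isMonoidal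

instance : NatTrans.IsMonoidal 𝒟.triple.lam := 𝒟.lam_isMonoidal

/-- The descent triple on operads in the full subcategory. -/
abbrev opTriple : DescentTriple (Op P) :=
  (operadTriple 𝒟.triple).restrict (opIn P) fun _ hX l => 𝒟.closed _ fun n => hX n l

/-- The descent triple on pairs of an operad and an algebra in the full subcategory. -/
abbrev algTriple : DescentTriple (Alg P) :=
  (operadAlgebraTriple 𝒟.triple).restrict (algIn P) fun _ hX =>
    ⟨fun l => 𝒟.closed _ fun n => (hX n).1 l, 𝒟.closed _ fun n => (hX n).2⟩

/-- The descent triple on algebras over `O` in the full subcategory. -/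
abbrev algOverTriple (O : Operad C) : DescentTriple (AlgOver P O) :=
  (algebraTriple 𝒟.triple O 𝒟.normalized).restrict (algOverIn P O) fun _ hX => 𝒟.closed _ hX

/-- The triple on operads is computed arity-wise. -/
def opLift (l : ℕ+) :
    TripleLift ((opIn P).ι ⋙ Operad.arity C l) (opTriple 𝒟) 𝒟.triple :=
  (operadLift 𝒟.triple l).restrictSource _ _

/-- The triple on pairs is computed arity-wise on operads. -/
def algLift (l : ℕ+) :
    TripleLift ((algIn P).ι ⋙ OperadAlgebra.toOperad C ⋙ Operad.arity C l) (algTriple 𝒟)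
      𝒟.triple :=
  (operadAlgebraLift 𝒟.triple l).restrictSource _ _

/-- The triple on pairs is computed on the underlying objects of algebras. -/
def algLift' :
    TripleLift ((algIn P).ι ⋙ OperadAlgebra.forget C) (algTriple 𝒟) 𝒟.triple :=
  (operadAlgebraLift' 𝒟.triple).restrictSource _ _

/-- The triple on algebras over `O` is computed on underlying objects. -/
def algOverLift (O : Operad C) :
    TripleLift ((algOverIn P O).ι ⋙ Operad.Algebra.forget O) (algOverTriple 𝒟 O) 𝒟.triple :=
  (algebraLift 𝒟.triple O 𝒟.normalized).restrictSource _ _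

/-- The triple on pairs is computed on components. -/
def algComponentLift : (i : Option ℕ+) →
    TripleLift (algComponent P i) (algTriple 𝒟) 𝒟.restricted
  | none => (algLift' 𝒟).restrictTarget (V := algForget P) 𝒟.closed
  | some l => (algLift 𝒟 l).restrictTarget (V := algOperad P ⋙ opArity P l) 𝒟.closed

lemma algEquiv_eq (W : MorphismProperty P.FullSubcategory) :
    algEquiv W = familyInverseImage (algComponent P) W := by
  ext A B f
  exact ⟨fun h i => match i with
    | none => h.2
    | some l => h.1 l, fun h => ⟨fun l => h (some l), h none⟩⟩

variable {X : Type w} [SmallCategory X] {J : GrothendieckTopology X}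
  {Ξ : ObjectProperty (GrothendieckTopology.Point.{w} J)}
  (h : IsCompatible Ξ 𝒟.restricted 𝒟.equiv
    (fun F : Xᵒᵖ ⥤ P.FullSubcategory => Presheaf.IsSheaf J F))
  (hprod : ∀ I : Type w, PreservesLimitsOfShape (Discrete I) P.ι)
  (htensor : ∀ A : C, PreservesFilteredColimitsOfSize.{w, w} (P.ι ⋙ tensorLeft A))

include h hprod htensor

/-- The arity functors are jointly faithful because a morphism of operads is determined by its
components. -/
lemma op_isCompatible : IsCompatible Ξ (opTriple 𝒟) (opEquiv 𝒟.equiv) (opSheaf P J) :=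
  isCompatible_familyInverseImage (V := opArity P)
    (fun l => (opLift 𝒟 l).restrictTarget (V := opArity P l) 𝒟.closed)
    (fun _ _ e => (opIn P).hom_ext (Operad.Hom.ext (funext fun l => congrArg P.ι.map (e l))))
    (fun I => have := h.hasProducts I; op_computesLimits P (Discrete I))
    (fun K _ _ => have := h.hasFilteredColimits.HasColimitsOfShape K
      op_computesColimits P K fun A => (htensor A).preserves_filtered_colimits K)
    (fun _ hF => hF) h

lemma alg_isCompatible : IsCompatible Ξ (algTriple 𝒟) (algEquiv 𝒟.equiv) (algSheaf P J) := by
  rw [algEquiv_eq]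
  exact isCompatible_familyInverseImage (algComponentLift 𝒟)
    (fun _ _ e => (algIn P).hom_ext (OperadAlgebra.Hom.ext
      (Operad.Hom.ext (funext fun l => congrArg P.ι.map (e (some l))))
      (congrArg P.ι.map (e none))))
    (fun I => have := h.hasProducts I; alg_computesLimits P (Discrete I))
    (fun K _ _ => have := h.hasFilteredColimits.HasColimitsOfShape K
      alg_computesColimits P K fun A => (htensor A).preserves_filtered_colimits K)
    (fun _ hF i => match i with
      | none => hF.2
      | some l => hF.1 l) h

lemma algOver_isCompatible (O : Operad C) :
    IsCompatible Ξ (algOverTriple 𝒟 O) (algOverEquiv 𝒟.equiv O) (algOverSheaf P J O) := by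
  have e : algOverEquiv 𝒟.equiv O =
      familyInverseImage (fun _ : Unit => algOverForget P O) 𝒟.equiv := by
    ext A B f
    exact ⟨fun h _ => h, fun h => h ()⟩
  rw [e]
  exact isCompatible_familyInverseImage
    (fun _ => (algOverLift 𝒟 O).restrictTarget (V := algOverForget P O) 𝒟.closed)
    (fun _ _ e => (algOverIn P O).hom_ext (Operad.Algebra.Hom.ext (congrArg P.ι.map (e ()))))
    (fun I => have := h.hasProducts I; algOver_computesLimits P (Discrete I) O)
    (fun K _ _ => have := h.hasFilteredColimits.HasColimitsOfShape K
      algOver_computesColimits P K (fun A => (htensor A).preserves_filtered_colimits K) O)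
    (fun _ hF _ => hF) h

end Main

end

end OperadDescent

theorem mainTheorem4
    {C : Type u} [Category.{v} C] [MonoidalCategory C] [SymmetricCategory C]
    (P : ObjectProperty C) (𝒟 : OperadDescent.MonoidalDescentSubcategory C P)
    {X : Type w} [SmallCategory X] (J : GrothendieckTopology X)
    (Ξ : ObjectProperty (GrothendieckTopology.Point.{w} J)) [ObjectProperty.Small.{w} Ξ]
    (hΞ : Ξ.IsConservativeFamilyOfPoints)
    (hcompat : OperadDescent.IsCompatible Ξ 𝒟.restricted 𝒟.equiv
      (fun F : Xᵒᵖ ⥤ P.FullSubcategory => Presheaf.IsSheaf J F))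
    (hcolim : PreservesFilteredColimitsOfSize.{w, w} P.ι)
    (hprod : ∀ I : Type w, PreservesLimitsOfShape (Discrete I) P.ι)
    (htensor : ∀ A : C, PreservesFilteredColimitsOfSize.{w, w} (P.ι ⋙ tensorLeft A)) :
    (∃ (T : OperadDescent.DescentTriple (OperadDescent.Op P))
        (θ : ∀ l : ℕ+, OperadDescent.TripleLift
          ((OperadDescent.opIn P).ι ⋙ OperadDescent.Operad.arity C l) T 𝒟.triple),
      (∀ F : SimplexCategory ⥤ OperadDescent.Op P,
        OperadDescent.IsSimpleOperad (F ⋙ (OperadDescent.opIn P).ι) 𝒟.triple.simple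
          (T.simple.obj F).obj (fun l => (θ l).hom F)) ∧
      OperadDescent.IsCompatible Ξ T (OperadDescent.opEquiv 𝒟.equiv)
        (OperadDescent.opSheaf P J)) ∧
    (∃ (T : OperadDescent.DescentTriple (OperadDescent.Alg P))
        (θ : ∀ l : ℕ+, OperadDescent.TripleLift
          ((OperadDescent.algIn P).ι ⋙ OperadDescent.OperadAlgebra.toOperad C ⋙
            OperadDescent.Operad.arity C l) T 𝒟.triple)
        (θ' : OperadDescent.TripleLift
          ((OperadDescent.algIn P).ι ⋙ OperadDescent.OperadAlgebra.forget C) T 𝒟.triple),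
      (∀ F : SimplexCategory ⥤ OperadDescent.Alg P,
        OperadDescent.IsSimpleOperadAlgebra (F ⋙ (OperadDescent.algIn P).ι) 𝒟.triple.simple
          (T.simple.obj F).obj (fun l => (θ l).hom F) (θ'.hom F)) ∧
      OperadDescent.IsCompatible Ξ T (OperadDescent.algEquiv 𝒟.equiv)
        (OperadDescent.algSheaf P J)) ∧
    (∀ O : OperadDescent.Operad C,
      ∃ (T : OperadDescent.DescentTriple (OperadDescent.AlgOver P O))
        (θ : OperadDescent.TripleLift
          ((OperadDescent.algOverIn P O).ι ⋙ OperadDescent.Operad.Algebra.forget O) T 𝒟.triple),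
      (∀ F : SimplexCategory ⥤ OperadDescent.AlgOver P O,
        OperadDescent.IsSimpleAlgebra (F ⋙ (OperadDescent.algOverIn P O).ι) 𝒟.triple
          (T.simple.obj F).obj (θ.hom F)) ∧
      OperadDescent.IsCompatible Ξ T (OperadDescent.algOverEquiv 𝒟.equiv O)
        (OperadDescent.algOverSheaf P J O)) :=
  ⟨⟨OperadDescent.opTriple 𝒟, OperadDescent.opLift 𝒟,
      fun F => OperadDescent.operad_isSimple 𝒟.triple (F ⋙ (OperadDescent.opIn P).ι),
      OperadDescent.op_isCompatible 𝒟 hcompat hprod htensor⟩,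
    ⟨OperadDescent.algTriple 𝒟, OperadDescent.algLift 𝒟, OperadDescent.algLift' 𝒟,
      fun F => OperadDescent.operadAlgebra_isSimple 𝒟.triple (F ⋙ (OperadDescent.algIn P).ι),
      OperadDescent.alg_isCompatible 𝒟 hcompat hprod htensor⟩,
    fun O => ⟨OperadDescent.algOverTriple 𝒟 O, OperadDescent.algOverLift 𝒟 O,
      fun F => OperadDescent.algebra_isSimple 𝒟.triple O 𝒟.normalized
        (F ⋙ (OperadDescent.algOverIn P O).ι),
      OperadDescent.algOver_isCompatible 𝒟 hcompat hprod htensor O⟩⟩
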